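/- Let $0\le p\le n$ be integers and $k>0$. Let $V_{n,p}=\{U\in\mathbb R^{n\times p}: U^TU=I_p\}$, let $P_p$ be the set of symmetric positive definite $p\times p$ matrices, and let $S^+(p,n)$ be the set of symmetric positive semidefinite $n\times n$ matrices of rank $p$, each with its smooth structure of embedded submanifold of a space of matrices. Let the orthogonal group $O(p)$ act on $V_{n,p}\times P_p$ by $(U,R^2)\mapsto(UO,O^TR^2O)$, where $R\in P_p$. (i) The quotient $(V_{n,p}\times P_p)/O(p)$, with the quotient topology, is a smooth manifold of dimension $pn-p(p-1)/2$ whose canonical projection is a smooth submersion, and $(U,R^2)\mapsto UR^2U^T$ induces a diffeomorphism $(V_{n,p}\times P_p)/O(p)\cong S^+(p,n)$. (ii) Let $(U,R^2)\in V_{n,p}\times P_p$ and let $U_\perp\in V_{n,n-p}$ with $U^TU_\perp=0$. The tangent space $T_{(U,R^2)}(V_{n,p}\times P_p)$ is the direct sum of the vertical space $\{(U\Omega,R^2\Omega-\Omega R^2):\Omega^T=-\Omega\}$, which is the kernel of the differential of $\pi:(U,R^2)\mapsto UR^2U^T$, and of the horizontal space $$\mathcal H_{(U,R^2)}=\{(U_\perp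 B,\,RD_0R): B\in\mathbb R^{(n-p)\times p},\ D_0\in\mathbb R^{p\times p}\text{ symmetric}\}.$$ (iii) There is a smooth Riemannian metric $g$ on $S^+(p,n)$ such that, for every $A\in S^+(p,n)$, every representative $(U,R^2)$ of $A=UR^2U^T$ and all $(\Delta_1,D_1),(\Delta_2,D_2)\in\mathcal H_{(U,R^2)}$, $$g_A\bigl(d\pi(\Delta_1,D_1),d\pi(\Delta_2,D_2)\bigr)=\operatorname{tr}(\Delta_1^T\Delta_2)+k\operatorname{tr}(R^{-1}D_1R^{-2}D_2R^{-1});$$ in particular the right-hand side does not depend on the chosen representative. (iv) The metric $g$ is invariant under the diffeomorphisms $A\mapsto OAO^T$ ($O\in O(n)$), $A\mapsto\mu^2A$ ($\mu\in\mathbb R$, $\mu\ne0$) and $A\mapsto A^\dagger$ (the Moore-Penrose pseudoinverse) of $S^+(p,n)$. -/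

import Mathlib

open scoped Manifold ContDiff Matrix

namespace FixedRankPSD

/-- Real `m × n` matrices. -/
abbrev Mat (m n : ℕ) : Type := Matrix (Fin m) (Fin n) ℝ

/-- The space of arrays `ℝ^{m×n}`, as a normed space: it carries the canonical smooth structure of
the space of `m × n` matrices, on whose type Mathlib fixes no norm. -/
abbrev Arr (m n : ℕ) : Type := Fin m → Fin n → ℝ

/-- The array of the entries of a matrix. -/
abbrev entries {m n : ℕ} (A : Mat m n) : Arr m n := fun i j ↦ A i j

/-- The orthogonal group `O(p)`. -/
abbrev O (p : ℕ) : Type := Matrix.orthogonalGroup (Fin p) ℝ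

/-- The Stiefel manifold `V_{n,p}`: the `n × p` matrices with orthonormal columns. -/
abbrev Stiefel (n p : ℕ) : Type := {U : Mat n p // Uᵀ * U = 1}

/-- `P_p`: the symmetric positive definite `p × p` matrices. -/
abbrev PD (p : ℕ) : Type := {S : Mat p p // S.PosDef}

/-- `S⁺(p,n)`: the symmetric positive semidefinite `n × n` matrices of rank `p`. -/
abbrev SPlus (p n : ℕ) : Type := {A : Mat n n // A.PosSemidef ∧ A.rank = p}

theorem orthogonal_transpose_mul {p : ℕ} (Q : O p) : (Q : Mat p p)ᵀ * (Q : Mat p p) = 1 :=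
  (Matrix.mem_orthogonalGroup_iff' (Fin p) ℝ).1 Q.2

theorem orthogonal_isUnit {p : ℕ} (Q : O p) : IsUnit (Q : Mat p p) :=
  IsUnit.of_mul_eq_one_right _ (orthogonal_transpose_mul Q)

/-- The right action `U ↦ U O` of `O(p)` on `V_{n,p}`. -/
instance instMulActionStiefel (n p : ℕ) : MulAction (O p)ᵐᵒᵖ (Stiefel n p) where
  smul Q U := ⟨U.1 * (Q.unop : Mat p p), by
    rw [Matrix.transpose_mul, Matrix.mul_assoc, ← Matrix.mul_assoc U.1ᵀ, U.2, Matrix.one_mul,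
      orthogonal_transpose_mul]⟩
  one_smul U := Subtype.ext (by
    change U.1 * (1 : Mat p p) = U.1
    rw [Matrix.mul_one])
  mul_smul Q₁ Q₂ U := Subtype.ext (by
    change U.1 * ((Q₂.unop : Mat p p) * (Q₁.unop : Mat p p)) =
      U.1 * (Q₂.unop : Mat p p) * (Q₁.unop : Mat p p)
    rw [Matrix.mul_assoc])

/-- The right action `S ↦ Oᵀ S O` of `O(p)` on `P_p`. -/
instance instMulActionPD (p : ℕ) : MulAction (O p)ᵐᵒᵖ (PD p) where
  smul Q S := ⟨(Q.unop : Mat p p)ᵀ * S.1 * (Q.unop : Mat p p), by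
    have h := S.2.conjTranspose_mul_mul_same (B := (Q.unop : Mat p p))
      (Matrix.mulVec_injective_of_isUnit (orthogonal_isUnit Q.unop))
    rwa [Matrix.conjTranspose_eq_transpose_of_trivial] at h⟩
  one_smul S := Subtype.ext (by
    change (1 : Mat p p)ᵀ * S.1 * (1 : Mat p p) = S.1
    simp)
  mul_smul Q₁ Q₂ S := Subtype.ext (by
    change ((Q₂.unop : Mat p p) * (Q₁.unop : Mat p p))ᵀ * S.1 *
        ((Q₂.unop : Mat p p) * (Q₁.unop : Mat p p)) =
      (Q₁.unop : Mat p p)ᵀ * ((Q₂.unop : Mat p p)ᵀ * S.1 * (Q₂.unop : Mat p p)) *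
        (Q₁.unop : Mat p p)
    simp only [Matrix.transpose_mul, Matrix.mul_assoc])

/-- The quotient `(V_{n,p} × P_p) / O(p)` (with the quotient topology) by the product action
`(U, S) ↦ (U O, Oᵀ S O)`. -/
abbrev StructureQuotient (n p : ℕ) : Type :=
  MulAction.orbitRel.Quotient (O p)ᵐᵒᵖ (Stiefel n p × PD p)

/-- The canonical projection `V_{n,p} × P_p → (V_{n,p} × P_p) / O(p)`. -/
def toQuotient (n p : ℕ) (x : Stiefel n p × PD p) : StructureQuotient n p :=
  Quotient.mk (MulAction.orbitRel (O p)ᵐᵒᵖ (Stiefel n p × PD p)) x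

theorem stiefel_rank {n p : ℕ} (U : Stiefel n p) (S : PD p) :
    (U.1 * S.1 * U.1ᵀ).rank = p := by
  apply le_antisymm
  · calc (U.1 * S.1 * U.1ᵀ).rank ≤ (U.1ᵀ).rank := Matrix.rank_mul_le_right _ _
      _ ≤ p := Matrix.rank_le_height _
  · have h : U.1ᵀ * (U.1 * S.1 * U.1ᵀ) * U.1 = S.1 := by
      have e : U.1ᵀ * (U.1 * S.1 * U.1ᵀ) * U.1 = (U.1ᵀ * U.1) * S.1 * (U.1ᵀ * U.1) := by
        simp only [Matrix.mul_assoc]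
      rw [e, U.2, Matrix.one_mul, Matrix.mul_one]
    calc p = S.1.rank := by rw [Matrix.rank_of_isUnit _ S.2.isUnit, Fintype.card_fin]
      _ = (U.1ᵀ * (U.1 * S.1 * U.1ᵀ) * U.1).rank := by rw [h]
      _ ≤ (U.1ᵀ * (U.1 * S.1 * U.1ᵀ)).rank := Matrix.rank_mul_le_left _ _
      _ ≤ (U.1 * S.1 * U.1ᵀ).rank := Matrix.rank_mul_le_right _ _

/-- The map `(U, S) ↦ U S Uᵀ` from the structure space to `S⁺(p,n)`. -/
def toSPlus (n p : ℕ) (x : Stiefel n p × PD p) : SPlus p n :=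
  ⟨x.1.1 * x.2.1 * x.1.1ᵀ, by
    have h := x.2.2.posSemidef.mul_mul_conjTranspose_same (B := x.1.1)
    rwa [Matrix.conjTranspose_eq_transpose_of_trivial] at h, stiefel_rank x.1 x.2⟩

/-- The inclusion of the structure space into the space of pairs of matrices. -/
def inclusion (n p : ℕ) (x : Stiefel n p × PD p) : Arr n p × Arr p p :=
  (entries x.1.1, entries x.2.1)

/-- The dimension of `V_{n,p}`. -/
abbrev dimStiefel (n p : ℕ) : ℕ := n * p - p * (p + 1) / 2

/-- The dimension of `P_p`. -/
abbrev dimPD (p : ℕ) : ℕ := p * (p + 1) / 2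

/-- The dimension of `S⁺(p,n)`. -/
abbrev dimSPlus (p n : ℕ) : ℕ := n * p - p * (p - 1) / 2

section Smooth

variable {E E' H H' M M' : Type} [NormedAddCommGroup E] [NormedSpace ℝ E]
  [NormedAddCommGroup E'] [NormedSpace ℝ E'] [TopologicalSpace H] [TopologicalSpace H']
  [TopologicalSpace M] [ChartedSpace H M] [TopologicalSpace M'] [ChartedSpace H' M']

/-- A smooth embedding of a finite-dimensional manifold in a normed space: a smooth map with
injective differentials that is a homeomorphism onto its image. -/
structure IsEmbeddingSmooth (I : ModelWithCorners ℝ E H) (f : M → E') : Prop where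
  contMDiff : ContMDiff I 𝓘(ℝ, E') ∞ f
  injective_mfderiv : ∀ x, Function.Injective (mfderiv I 𝓘(ℝ, E') f x)
  isEmbedding : Topology.IsEmbedding f

/-- A smooth submersion of finite-dimensional manifolds: a smooth map with surjective
differentials. -/
structure IsSubmersionSmooth (I : ModelWithCorners ℝ E H) (I' : ModelWithCorners ℝ E' H')
    (f : M → M') : Prop where
  contMDiff : ContMDiff I I' ∞ f
  surjective_mfderiv : ∀ x, Function.Surjective (mfderiv I I' f x)

end Smooth

/-- The tangent vector at `x = (U, S)` of the structure space, read as a pair of matrices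
`(Ξ, D)`. -/
noncomputable def tangentPair {n p : ℕ}
    [ChartedSpace (EuclideanSpace ℝ (Fin (dimStiefel n p))) (Stiefel n p)]
    [ChartedSpace (EuclideanSpace ℝ (Fin (dimPD p))) (PD p)] (x : Stiefel n p × PD p) :
    TangentSpace ((𝓡 (dimStiefel n p)).prod (𝓡 (dimPD p))) x →ₗ[ℝ] Mat n p × Mat p p :=
  ((Matrix.ofLinearEquiv ℝ).prodCongr (Matrix.ofLinearEquiv ℝ) :
      (Arr n p × Arr p p) ≃ₗ[ℝ] Mat n p × Mat p p).toLinearMap ∘ₗ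
    ((mfderiv ((𝓡 (dimStiefel n p)).prod (𝓡 (dimPD p))) 𝓘(ℝ, Arr n p × Arr p p)
      (inclusion n p) x).toLinearMap :
      TangentSpace ((𝓡 (dimStiefel n p)).prod (𝓡 (dimPD p))) x →ₗ[ℝ] Arr n p × Arr p p)

/-- The horizontal space `{(U⊥ B, R D₀ R) : B ∈ ℝ^{(n-p)×p}, D₀ ∈ Sym(p)}`. -/
def horizontalSpace {n p : ℕ} (Uperp : Mat n (n - p)) (R : Mat p p) :
    Submodule ℝ (Mat n p × Mat p p) where
  carrier := {X | ∃ (B : Mat (n - p) p) (D₀ : Mat p p),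
    D₀ᵀ = D₀ ∧ X = (Uperp * B, R * D₀ * R)}
  zero_mem' := ⟨0, 0, by simp, by simp [Prod.ext_iff]⟩
  add_mem' := by
    rintro _ _ ⟨B, D, hD, rfl⟩ ⟨B', D', hD', rfl⟩
    exact ⟨B + B', D + D', by rw [Matrix.transpose_add, hD, hD'],
      by simp [Matrix.mul_add, Matrix.add_mul]⟩
  smul_mem' := by
    rintro c _ ⟨B, D, hD, rfl⟩
    exact ⟨c • B, c • D, by rw [Matrix.transpose_smul, hD], by simp⟩

/-- The vertical space `{(U Ω, S Ω - Ω S) : Ω skew-symmetric}`, tangent to the `O(p)`-orbit of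
`(U, S)`. -/
def verticalSpace {n p : ℕ} (U : Mat n p) (S : Mat p p) :
    Submodule ℝ (Mat n p × Mat p p) where
  carrier := {X | ∃ Ω : Mat p p, Ωᵀ = -Ω ∧ X = (U * Ω, S * Ω - Ω * S)}
  zero_mem' := ⟨0, by simp, by simp [Prod.ext_iff]⟩
  add_mem' := by
    rintro _ _ ⟨Ω, h, rfl⟩ ⟨Ω', h', rfl⟩
    refine ⟨Ω + Ω', by rw [Matrix.transpose_add, h, h']; abel, ?_⟩
    simp only [Matrix.mul_add, Matrix.add_mul, Prod.mk_add_mk, Prod.mk.injEq, true_and]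
    abel
  smul_mem' := by
    rintro c _ ⟨Ω, h, rfl⟩
    exact ⟨c • Ω, by rw [Matrix.transpose_smul, h, smul_neg],
      by simp [smul_sub]⟩

/-- `tr(Δ₁ᵀ Δ₂) + k tr(R⁻¹ D₁ R⁻² D₂ R⁻¹)` for `X = (Δ₁, D₁)` and `Y = (Δ₂, D₂)`. -/
noncomputable def metricForm {n p : ℕ} (k : ℝ) (R : Mat p p) (X Y : Mat n p × Mat p p) : ℝ :=
  (X.1ᵀ * Y.1).trace + k * (R⁻¹ * X.2 * (R ^ 2)⁻¹ * Y.2 * R⁻¹).trace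

/-- `B` is the Moore-Penrose pseudoinverse of the real matrix `A`. -/
structure IsPseudoinverse {n : ℕ} (A B : Mat n n) : Prop where
  mul_mul_left : A * B * A = A
  mul_mul_right : B * A * B = B
  symm_left : (A * B)ᵀ = A * B
  symm_right : (B * A)ᵀ = B * A

/-- Smooth Riemannian metrics on `S⁺(p,n)`, for a given smooth structure. -/
abbrev Metric (p n : ℕ) [ChartedSpace (EuclideanSpace ℝ (Fin (dimSPlus p n))) (SPlus p n)]
    [IsManifold (𝓡 (dimSPlus p n)) ∞ (SPlus p n)] : Type :=
  Bundle.ContMDiffRiemannianMetric (𝓡 (dimSPlus p n)) ∞ (EuclideanSpace ℝ (Fin (dimSPlus p n)))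
    (fun A : SPlus p n ↦ TangentSpace (𝓡 (dimSPlus p n)) A)

/-- The diffeomorphism `f` of `S⁺(p,n)` leaves the Riemannian metric `g` invariant. -/
def Preserves {p n : ℕ} [ChartedSpace (EuclideanSpace ℝ (Fin (dimSPlus p n))) (SPlus p n)]
    [IsManifold (𝓡 (dimSPlus p n)) ∞ (SPlus p n)] (g : Metric p n)
    (f : SPlus p n ≃ₘ^∞⟮𝓡 (dimSPlus p n), 𝓡 (dimSPlus p n)⟯ SPlus p n) : Prop :=
  ∀ (A : SPlus p n) (v w : TangentSpace (𝓡 (dimSPlus p n)) A),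
    g.inner (f A) (mfderiv (𝓡 (dimSPlus p n)) (𝓡 (dimSPlus p n)) f A v)
      (mfderiv (𝓡 (dimSPlus p n)) (𝓡 (dimSPlus p n)) f A w) = g.inner A v w

end FixedRankPSD

open FixedRankPSD

/-!
The quotient map is studied through `π (U, S) = U S Uᵀ`. By the spectral theorem `π` is onto
`S⁺(p,n)` (`toSPlus_surjective`), and its fibres are the orbits of `O(p)` (`toSPlus_eq_iff`). It is
a closed map, because the Stiefel manifold is compact (`isClosedMap_toSPlus`); so it induces a
homeomorphism of the quotient with `S⁺(p,n)`, along which the smooth structure is transported.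

The three matrix manifolds are embedded submanifolds of spaces of matrices, given by slice charts
(`SliceChart`): maps that are restrictions of smooth maps of the ambient space and have inverses
that are smooth into the ambient space. `P_p` is open in the symmetric matrices. On the Stiefel
manifold, the Cayley transform gives rational charts with values in the tangent spaces
(`cayleyCoord`). On `S⁺(p,n)`, the chart around `U S Uᵀ` is `A ↦ A U`, with inverse `Y ↦ Y (Uᵀ Y)⁻¹
Yᵀ` (`sliceParam`). Maps to such a manifold are smooth as soon as they are so as matrix-valued maps,
and tangent vectors may be read as matrices; differentials are then computed by the product rule
(`HasMatDeriv`).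

Differentiating `Uᵀ U = 1`, and comparing dimensions, identifies the tangent spaces of the structure
space (`mem_range_tangentPair`). The kernel of `dπ` is computed by matrix algebra
(`dproj_eq_zero_iff`); its dimension is what makes `dπ` surjective. The decomposition in horizontal
and vertical vectors is `Ξ = U⊥ (U⊥ᵀ Ξ) + U (Uᵀ Ξ)` (`range_tangentPair_eq`).

The metric is defined without reference to representatives: at `A` it is the form `tr(A†² a (1 - A
A†) b) + k tr(A† a A† b)` in the tangent matrices `a` and `b` (`formAt`), smooth because `A†` is
locally a rational function of `A` (`pinvFormula`). For a representative `(U, S)` of `A` it equals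
`tr(Δᵀ Δ') + k tr(S⁻¹ D S⁻¹ D')`, where `(Δ, D)` and `(Δ', D')` are the horizontal lifts of `a` and
`b` (`formAt_toSPlus`). This gives the formula for the metric, its positivity, and, with the
representatives `(Q U, S)`, `(U, μ² S)` and `(U, S⁻¹)` of `Q A Qᵀ`, `μ² A` and `A†`, its invariance.
For the pseudoinverse, the derivatives of the identities `A A† A = A` and `A A† = A† A` show that
the lift `(Δ, D)` becomes `(Δ, -S⁻¹ D S⁻¹)` (`pinv_deriv_parts`).
-/

namespace FixedRankPSD

/-! ### Embedded submanifolds from slice charts -/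

section SliceCharts

variable {X E : Type} [TopologicalSpace X] [NormedAddCommGroup E] [NormedSpace ℝ E]

/-- A slice chart of a subspace `ι : X → E` of a normed space: an open `source ⊆ X` is identified
with an open `target ⊆ ℝ^d` by the restriction of a smooth map `toFun`, defined on the open set
`domain` of the ambient space, and the inverse, read in the ambient space, is a smooth map `invFun`.
This is what makes `X` an embedded submanifold near the points of `source`. The values of the two
maps outside `domain` and `target` play no role. -/
structure SliceChart (ι : X → E) (d : ℕ) where
  source : Set X
  target : Set (EuclideanSpace ℝ (Fin d))
  domain : Set E
  toFun : E → EuclideanSpace ℝ (Fin d)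
  invFun : EuclideanSpace ℝ (Fin d) → E
  isOpen_source : IsOpen source
  isOpen_target : IsOpen target
  isOpen_domain : IsOpen domain
  contDiffOn_toFun : ContDiffOn ℝ ∞ toFun domain
  contDiffOn_invFun : ContDiffOn ℝ ∞ invFun target
  mem_domain : ∀ x ∈ source, ι x ∈ domain
  mem_target : ∀ x ∈ source, toFun (ι x) ∈ target
  left_inv : ∀ x ∈ source, invFun (toFun (ι x)) = ι x
  exists_preimage : ∀ t ∈ target, ∃ x ∈ source, ι x = invFun t ∧ toFun (invFun t) = t

variable {ι : X → E} {d : ℕ}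

open Classical in
/-- The chart of the topological space `X` given by a slice chart. The point `x₀` only serves as the
value of the inverse outside `target`. -/
noncomputable def SliceChart.chart (c : SliceChart ι d) (hι : Topology.IsEmbedding ι) (x₀ : X) :
    OpenPartialHomeomorph X (EuclideanSpace ℝ (Fin d)) where
  toFun x := c.toFun (ι x)
  invFun t := if h : t ∈ c.target then (c.exists_preimage t h).choose else x₀
  source := c.source
  target := c.target
  map_source' x hx := c.mem_target x hx
  map_target' t ht := by
    rw [dif_pos ht]
    exact (c.exists_preimage t ht).choose_spec.1
  left_inv' x hx := by
    have ht := c.mem_target x hx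
    rw [dif_pos ht]
    apply hι.injective
    rw [(c.exists_preimage _ ht).choose_spec.2.1, c.left_inv x hx]
  right_inv' t ht := by
    rw [dif_pos ht, (c.exists_preimage _ ht).choose_spec.2.1,
      (c.exists_preimage _ ht).choose_spec.2.2]
  open_source := c.isOpen_source
  open_target := c.isOpen_target
  continuousOn_toFun := c.contDiffOn_toFun.continuousOn.comp hι.continuous.continuousOn
    c.mem_domain
  continuousOn_invFun := by
    rw [hι.continuousOn_iff]
    refine c.contDiffOn_invFun.continuousOn.congr fun t ht ↦ ?_
    simp only [Function.comp_apply]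
    rw [dif_pos ht, (c.exists_preimage _ ht).choose_spec.2.1]

theorem SliceChart.comp_chart_symm (c : SliceChart ι d) (hι : Topology.IsEmbedding ι) (x₀ : X)
    {t : EuclideanSpace ℝ (Fin d)} (ht : t ∈ c.target) :
    ι ((c.chart hι x₀).symm t) = c.invFun t := by
  have h : (c.chart hι x₀).symm t = (c.exists_preimage t ht).choose := dif_pos ht
  rw [h, (c.exists_preimage t ht).choose_spec.2.1]

/-- An embedding `ι : X → E` with a slice chart around every point, so that `X` is an embedded
submanifold of dimension `d`. -/
structure SliceAtlas (ι : X → E) (d : ℕ) where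
  isEmbedding : Topology.IsEmbedding ι
  chartAt : X → SliceChart ι d
  mem_source : ∀ x, x ∈ (chartAt x).source

/-- The smooth structure defined by a slice atlas. It is not an instance, since it depends on the
atlas. -/
@[reducible] noncomputable def SliceAtlas.chartedSpace (a : SliceAtlas ι d) :
    ChartedSpace (EuclideanSpace ℝ (Fin d)) X where
  atlas := Set.range fun x ↦ (a.chartAt x).chart a.isEmbedding x
  chartAt x := (a.chartAt x).chart a.isEmbedding x
  mem_chart_source := a.mem_source
  chart_mem_atlas x := ⟨x, rfl⟩

theorem SliceAtlas.isManifold (a : SliceAtlas ι d) :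
    letI := a.chartedSpace
    IsManifold (𝓡 d) ∞ X := by
  let := a.chartedSpace
  apply isManifold_of_contDiffOn
  rintro _ _ ⟨x, rfl⟩ ⟨y, rfl⟩
  have h : ContDiffOn ℝ ∞ (fun t ↦ (a.chartAt y).toFun ((a.chartAt x).invFun t))
      ((a.chartAt x).target ∩ (a.chartAt x).invFun ⁻¹' (a.chartAt y).domain) :=
    (a.chartAt y).contDiffOn_toFun.comp
      ((a.chartAt x).contDiffOn_invFun.mono Set.inter_subset_left) fun t ht ↦ ht.2
  refine (h.congr ?_).mono ?_
  · rintro t ⟨ht, -⟩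
    change (a.chartAt y).toFun (ι (((a.chartAt x).chart a.isEmbedding x).symm t)) = _
    rw [SliceChart.comp_chart_symm _ _ _ ht]
  · rintro t ⟨⟨ht, ht'⟩, -⟩
    refine ⟨ht, ?_⟩
    have := (a.chartAt y).mem_domain _ ht'
    change ι (((a.chartAt x).chart a.isEmbedding x).symm t) ∈ _ at this
    exact (congrArg (· ∈ (a.chartAt y).domain)
      (SliceChart.comp_chart_symm _ a.isEmbedding x ht)).mp this

theorem SliceAtlas.contMDiff (a : SliceAtlas ι d) :
    letI := a.chartedSpace
    ContMDiff (𝓡 d) 𝓘(ℝ, E) ∞ ι := by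
  let := a.chartedSpace
  intro x
  have h1 : ContMDiffAt (𝓡 d) 𝓘(ℝ, EuclideanSpace ℝ (Fin d)) ∞ (extChartAt (𝓡 d) x) x :=
    contMDiffAt_extChartAt
  have ht := (a.chartAt x).mem_target x (a.mem_source x)
  have h2 : ContDiffAt ℝ ∞ (a.chartAt x).invFun ((a.chartAt x).toFun (ι x)) :=
    (a.chartAt x).contDiffOn_invFun.contDiffAt ((a.chartAt x).isOpen_target.mem_nhds ht)
  refine (ContMDiffAt.comp x (g := (a.chartAt x).invFun) h2.contMDiffAt h1).congr_of_eventuallyEq ?_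
  filter_upwards [(a.chartAt x).isOpen_source.mem_nhds (a.mem_source x)] with y hy
  exact ((a.chartAt x).left_inv y hy).symm

/-- The universal property of embedded submanifolds: a map to `X` is smooth as soon as it is smooth
as a map to the ambient space. -/
theorem SliceAtlas.contMDiffAt_of_comp (a : SliceAtlas ι d) {E' H' M : Type}
    [NormedAddCommGroup E'] [NormedSpace ℝ E'] [TopologicalSpace H'] [TopologicalSpace M]
    [ChartedSpace H' M] {I : ModelWithCorners ℝ E' H'} {g : M → X} {y : M}
    (hg : ContMDiffAt I 𝓘(ℝ, E) ∞ (fun z ↦ ι (g z)) y) :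
    letI := a.chartedSpace
    ContMDiffAt I (𝓡 d) ∞ g y := by
  let := a.chartedSpace
  rw [contMDiffAt_iff_target]
  refine ⟨a.isEmbedding.continuousAt_iff.2 hg.continuousAt, ?_⟩
  have h : ContDiffAt ℝ ∞ (a.chartAt (g y)).toFun (ι (g y)) :=
    (a.chartAt (g y)).contDiffOn_toFun.contDiffAt
      ((a.chartAt (g y)).isOpen_domain.mem_nhds
        ((a.chartAt (g y)).mem_domain _ (a.mem_source _)))
  exact ContMDiffAt.comp y (g := (a.chartAt (g y)).toFun) h.contMDiffAt hg

/-- The differential of `ι` is injective because a chart, whose differential is invertible, factors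
through `ι`. -/
theorem SliceAtlas.isEmbeddingSmooth (a : SliceAtlas ι d) :
    letI := a.chartedSpace
    IsEmbeddingSmooth (𝓡 d) ι := by
  let := a.chartedSpace
  have := a.isManifold
  refine ⟨a.contMDiff, fun x ↦ ?_, a.isEmbedding⟩
  have h : ContDiffAt ℝ ∞ (a.chartAt x).toFun (ι x) :=
    (a.chartAt x).contDiffOn_toFun.contDiffAt
      ((a.chartAt x).isOpen_domain.mem_nhds ((a.chartAt x).mem_domain _ (a.mem_source _)))
  have h0 : extChartAt (𝓡 d) x = (a.chartAt x).toFun ∘ ι := rfl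
  have h1 := (isInvertible_mfderiv_extChartAt (I := 𝓡 d) (mem_extChartAt_source x)).injective
  rw [h0, mfderiv_comp x (I' := 𝓘(ℝ, E)) (h.contMDiffAt.mdifferentiableAt (by simp))
    (a.contMDiff.mdifferentiableAt (by simp))] at h1
  exact Function.Injective.of_comp (f := mfderiv 𝓘(ℝ, E) 𝓘(ℝ, EuclideanSpace ℝ (Fin d)) _ _) h1

/-- A slice chart whose coordinates take values in a `d`-dimensional linear subspace `F` of a space
`E₂`, in place of `ℝ^d`. The coordinates are extended from `F` to `E₂` by a linear retraction `π` of
`E₂` onto `F`. -/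
noncomputable def SliceChart.ofSubmodule {E₂ : Type} [NormedAddCommGroup E₂] [NormedSpace ℝ E₂]
    [FiniteDimensional ℝ E₂] (F : Submodule ℝ E₂) (hF : Module.finrank ℝ F = d)
    (source : Set X) (domain : Set E) (target : Set E₂) (f : E → E₂) (g : E₂ → E)
    (hs : IsOpen source) (hd : IsOpen domain) (ht : IsOpen target)
    (hf : ContDiffOn ℝ ∞ f domain) (hg : ContDiffOn ℝ ∞ g target)
    (mem_domain : ∀ x ∈ source, ι x ∈ domain)
    (mem_F : ∀ x ∈ source, f (ι x) ∈ F)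
    (mem_target : ∀ x ∈ source, f (ι x) ∈ target)
    (left_inv : ∀ x ∈ source, g (f (ι x)) = ι x)
    (exists_preimage : ∀ t ∈ F, t ∈ target → ∃ x ∈ source, ι x = g t ∧ f (g t) = t) :
    SliceChart ι d :=
  let e : F ≃L[ℝ] EuclideanSpace ℝ (Fin d) :=
    ContinuousLinearEquiv.ofFinrankEq (by rw [hF, finrank_euclideanSpace_fin])
  let π : E₂ →L[ℝ] F :=
    (F.subtype.exists_leftInverse_of_injective (by simp)).choose.toContinuousLinearMap
  have hπ : ∀ z (hz : z ∈ F), π z = ⟨z, hz⟩ := fun z hz ↦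
    LinearMap.congr_fun (F.subtype.exists_leftInverse_of_injective (by simp)).choose_spec ⟨z, hz⟩
  let j : EuclideanSpace ℝ (Fin d) →L[ℝ] E₂ := F.subtypeL ∘L e.symm
  have hj : ∀ z ∈ F, j (e (π z)) = z := fun z hz ↦ by simp [j, hπ z hz]
  { source := source
    target := j ⁻¹' target
    domain := domain
    toFun := fun y ↦ e (π (f y))
    invFun := fun t ↦ g (j t)
    isOpen_source := hs
    isOpen_target := ht.preimage j.continuous
    isOpen_domain := hd
    contDiffOn_toFun := (e.contDiff.comp π.contDiff).comp_contDiffOn hf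
    contDiffOn_invFun := hg.comp j.contDiff.contDiffOn fun _ h ↦ h
    mem_domain := mem_domain
    mem_target := fun x hx ↦ by
      change j (e (π (f (ι x)))) ∈ target
      rw [hj _ (mem_F x hx)]
      exact mem_target x hx
    left_inv := fun x hx ↦ by rw [hj _ (mem_F x hx), left_inv x hx]
    exists_preimage := fun t h ↦ by
      obtain ⟨x, hx, h1, h2⟩ := exists_preimage (j t) (e.symm t).2 h
      refine ⟨x, hx, h1, ?_⟩
      rw [h2, hπ (j t) (e.symm t).2]
      exact e.apply_symm_apply t }

end SliceCharts

/-! ### Riemannian metrics pulled back from a normed space -/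

section PullbackMetric

open ContinuousLinearMap

/-- In finite dimension the unit ball of a positive definite form is bounded: the form is at least
`c ‖v‖ ^ 2`, where `c > 0` is its minimum on the unit sphere. -/
theorem isVonNBounded_of_pos {F : Type} [NormedAddCommGroup F] [NormedSpace ℝ F]
    [FiniteDimensional ℝ F] (b : F →L[ℝ] F →L[ℝ] ℝ) (hb : ∀ v, v ≠ 0 → 0 < b v v) :
    Bornology.IsVonNBounded ℝ {v : F | b v v < 1} := by
  rw [NormedSpace.isVonNBounded_iff]
  have hc : Continuous fun v ↦ b v v := by fun_prop
  obtain ⟨c, hc0, hc1⟩ : ∃ c > 0, ∀ v ∈ Metric.sphere (0 : F) 1, c ≤ b v v := by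
    rcases (Metric.sphere (0 : F) 1).eq_empty_or_nonempty with h | h
    · exact ⟨1, one_pos, by simp [h]⟩
    · obtain ⟨v, hv, hmin⟩ := (isCompact_sphere (0 : F) 1).exists_isMinOn h hc.continuousOn
      exact ⟨b v v, hb v (ne_zero_of_mem_unit_sphere ⟨v, hv⟩), fun w hw ↦ hmin hw⟩
  have key : ∀ v, c * ‖v‖ ^ 2 ≤ b v v := fun v ↦ by
    rcases eq_or_ne v 0 with rfl | hv
    · simp
    have hn : ‖v‖ ≠ 0 := norm_ne_zero_iff.2 hv
    have h := hc1 (‖v‖⁻¹ • v) (by simp [norm_smul, hn])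
    simp only [map_smul, smul_apply, smul_eq_mul] at h
    calc c * ‖v‖ ^ 2 ≤ (‖v‖⁻¹ * (‖v‖⁻¹ * b v v)) * ‖v‖ ^ 2 := by gcongr
      _ = b v v := by field_simp
  refine (Metric.isBounded_closedBall (x := (0 : F)) (r := c⁻¹ + 1)).subset fun v hv ↦ ?_
  rw [mem_closedBall_zero_iff]
  by_contra! h
  have h1 : 1 < c * (c⁻¹ + 1) := by
    rw [mul_add, mul_inv_cancel₀ hc0.ne']; linarith
  have h2 : (1 : ℝ) ≤ c⁻¹ + 1 := by have := inv_pos.2 hc0; linarith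
  have h3 : c * (c⁻¹ + 1) ≤ c * ‖v‖ ^ 2 := by
    gcongr
    nlinarith
  exact absurd (key v) (not_le.2 (lt_trans hv (h1.trans_le h3)))

variable {E M : Type} {d : ℕ} [NormedAddCommGroup E] [NormedSpace ℝ E] [TopologicalSpace M]
  [ChartedSpace (EuclideanSpace ℝ (Fin d)) M]

/-- The pull-back along `f : M → E` of a field `G` of bilinear forms of `E` parametrised by the
points of `M`: the form `(v, w) ↦ G x (df v, df w)` on `T_x M`. -/
noncomputable def pullbackForm (f : M → E) (G : M → E →L[ℝ] E →L[ℝ] ℝ) (x : M) :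
    TangentSpace (𝓡 d) x →L[ℝ] TangentSpace (𝓡 d) x →L[ℝ] ℝ :=
  (ContinuousLinearMap.precomp ℝ (mfderiv (𝓡 d) 𝓘(ℝ, E) f x)).comp
    ((G x).comp (mfderiv (𝓡 d) 𝓘(ℝ, E) f x))

theorem pullbackForm_apply (f : M → E) (G : M → E →L[ℝ] E →L[ℝ] ℝ) (x : M)
    (v w : TangentSpace (𝓡 d) x) : pullbackForm f G x v w =
      G x (mfderiv (𝓡 d) 𝓘(ℝ, E) f x v) (mfderiv (𝓡 d) 𝓘(ℝ, E) f x w) := rfl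

variable [IsManifold (𝓡 d) ∞ M]

/-- In the trivialisation of the tangent bundle at `x₀`, the differential of `f` becomes a smooth
operator-valued map `Λ`, and the pulled-back form becomes `(u, u') ↦ G x (Λ x u) (Λ x u')`. -/
theorem contMDiff_pullback_form {f : M → E} (hf : ContMDiff (𝓡 d) 𝓘(ℝ, E) ∞ f)
    {G : M → E →L[ℝ] E →L[ℝ] ℝ} (hG : ContMDiff (𝓡 d) 𝓘(ℝ, E →L[ℝ] E →L[ℝ] ℝ) ∞ G) :
    ContMDiff (𝓡 d) ((𝓡 d).prod 𝓘(ℝ, EuclideanSpace ℝ (Fin d) →L[ℝ]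
        EuclideanSpace ℝ (Fin d) →L[ℝ] ℝ)) ∞
      (fun x ↦ Bundle.TotalSpace.mk' (EuclideanSpace ℝ (Fin d) →L[ℝ]
        EuclideanSpace ℝ (Fin d) →L[ℝ] ℝ)
        (E := fun x : M ↦ TangentSpace (𝓡 d) x →L[ℝ] TangentSpace (𝓡 d) x →L[ℝ] ℝ) x
        (pullbackForm f G x)) := by
  intro x₀
  rw [contMDiffAt_hom_bundle]
  refine ⟨contMDiffAt_id, ?_⟩
  set Λ := inTangentCoordinates (𝓡 d) 𝓘(ℝ, E) id f (mfderiv (𝓡 d) 𝓘(ℝ, E) f) x₀ with hΛ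
  have hΛs : ContMDiffAt (𝓡 d) 𝓘(ℝ, EuclideanSpace ℝ (Fin d) →L[ℝ] E) ∞ Λ x₀ :=
    (hf x₀).mfderiv_const (by simp)
  have h1 : ContMDiffAt (𝓡 d) 𝓘(ℝ, EuclideanSpace ℝ (Fin d) →L[ℝ] (E →L[ℝ] ℝ)) ∞
      (fun x ↦ (G x).comp (Λ x)) x₀ := (hG x₀).clm_comp hΛs
  have h2 : ContMDiffAt (𝓡 d) 𝓘(ℝ, (E →L[ℝ] ℝ) →L[ℝ] (EuclideanSpace ℝ (Fin d) →L[ℝ] ℝ)) ∞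
      (fun x ↦ (compL ℝ (EuclideanSpace ℝ (Fin d)) E ℝ).flip (Λ x)) x₀ :=
    ContMDiffAt.comp x₀ (g := (compL ℝ (EuclideanSpace ℝ (Fin d)) E ℝ).flip)
      (ContinuousLinearMap.contMDiff _ _) hΛs
  refine (h2.clm_comp h1).congr_of_eventuallyEq ?_
  have hmem : (trivializationAt (EuclideanSpace ℝ (Fin d)) (TangentSpace (𝓡 d) (M := M))
      x₀).baseSet ∈ nhds x₀ :=
    (trivializationAt _ _ x₀).open_baseSet.mem_nhds (FiberBundle.mem_baseSet_trivializationAt' x₀)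
  filter_upwards [hmem] with x hx
  have hΛx : ∀ u, Λ x u = mfderiv (𝓡 d) 𝓘(ℝ, E) f x ((trivializationAt (EuclideanSpace ℝ (Fin d))
      (TangentSpace (𝓡 d) (M := M)) x₀).symm x u) := fun u ↦ by
    simp only [hΛ, inTangentCoordinates, inCoordinates,
      TangentBundle.continuousLinearMapAt_model_space, id_eq]
    rw [← Bundle.Trivialization.symmL_apply (R := ℝ) (hb := hx)]
    rfl
  ext v w
  rw [inCoordinates_apply_eq₂ hx hx (Set.mem_univ _), pullbackForm_apply, ← hΛx, ← hΛx]
  have hL : (trivializationAt ℝ (fun _ : M ↦ ℝ) x₀).linearMapAt ℝ x = LinearMap.id := by simp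
  rw [hL]
  rfl

/-- The Riemannian metric pulled back along `f : M → E` from a smooth family `G` of bilinear forms
of `E` which need only be symmetric and positive definite on the ranges of the differentials of `f`.
-/
noncomputable def pullbackMetric {f : M → E} (hf : ContMDiff (𝓡 d) 𝓘(ℝ, E) ∞ f)
    {G : M → E →L[ℝ] E →L[ℝ] ℝ} (hG : ContMDiff (𝓡 d) 𝓘(ℝ, E →L[ℝ] E →L[ℝ] ℝ) ∞ G)
    (symm : ∀ x v w, G x (mfderiv (𝓡 d) 𝓘(ℝ, E) f x v) (mfderiv (𝓡 d) 𝓘(ℝ, E) f x w) =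
      G x (mfderiv (𝓡 d) 𝓘(ℝ, E) f x w) (mfderiv (𝓡 d) 𝓘(ℝ, E) f x v))
    (pos : ∀ x v, v ≠ 0 →
      0 < G x (mfderiv (𝓡 d) 𝓘(ℝ, E) f x v) (mfderiv (𝓡 d) 𝓘(ℝ, E) f x v)) :
    Bundle.ContMDiffRiemannianMetric (𝓡 d) ∞ (EuclideanSpace ℝ (Fin d))
      (fun x : M ↦ TangentSpace (𝓡 d) x) where
  inner x := pullbackForm f G x
  symm := symm
  pos := pos
  isVonNBounded x := isVonNBounded_of_pos (F := EuclideanSpace ℝ (Fin d)) (pullbackForm f G x)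
    (pos x)
  contMDiff := contMDiff_pullback_form hf hG

end PullbackMetric

/-! ### Smooth matrix-valued maps and their differentials -/

section Calculus

variable {X : Type} [NormedAddCommGroup X] [NormedSpace ℝ X] {x : X} {l m n : ℕ}

theorem contDiffAt_entries {F : X → Mat m n} :
    ContDiffAt ℝ ∞ (fun y ↦ entries (F y)) x ↔ ∀ i j, ContDiffAt ℝ ∞ (fun y ↦ F y i j) x := by
  simp only [contDiffAt_pi]

theorem contDiffAt_entries_mul {F : X → Mat l m} {G : X → Mat m n}
    (hF : ContDiffAt ℝ ∞ (fun y ↦ entries (F y)) x)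
    (hG : ContDiffAt ℝ ∞ (fun y ↦ entries (G y)) x) :
    ContDiffAt ℝ ∞ (fun y ↦ entries (F y * G y)) x := by
  rw [contDiffAt_entries] at *
  intro i j
  simp only [Matrix.mul_apply]
  exact ContDiffAt.sum fun k _ ↦ (hF i k).mul (hG k j)

theorem contDiffAt_entries_transpose {F : X → Mat m n}
    (hF : ContDiffAt ℝ ∞ (fun y ↦ entries (F y)) x) :
    ContDiffAt ℝ ∞ (fun y ↦ entries (F y)ᵀ) x := by
  rw [contDiffAt_entries] at *
  exact fun i j ↦ hF j i

theorem contDiffAt_entries_add {F G : X → Mat m n}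
    (hF : ContDiffAt ℝ ∞ (fun y ↦ entries (F y)) x)
    (hG : ContDiffAt ℝ ∞ (fun y ↦ entries (G y)) x) :
    ContDiffAt ℝ ∞ (fun y ↦ entries (F y + G y)) x := hF.add hG

theorem contDiffAt_entries_sub {F G : X → Mat m n}
    (hF : ContDiffAt ℝ ∞ (fun y ↦ entries (F y)) x)
    (hG : ContDiffAt ℝ ∞ (fun y ↦ entries (G y)) x) :
    ContDiffAt ℝ ∞ (fun y ↦ entries (F y - G y)) x := hF.sub hG

theorem contDiffAt_trace {F : X → Mat n n}
    (hF : ContDiffAt ℝ ∞ (fun y ↦ entries (F y)) x) :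
    ContDiffAt ℝ ∞ (fun y ↦ (F y).trace) x := by
  rw [contDiffAt_entries] at hF
  exact ContDiffAt.sum fun k _ ↦ hF k k

theorem contDiffAt_det {F : X → Mat n n}
    (hF : ContDiffAt ℝ ∞ (fun y ↦ entries (F y)) x) :
    ContDiffAt ℝ ∞ (fun y ↦ (F y).det) x := by
  rw [contDiffAt_entries] at hF
  simp only [Matrix.det_apply]
  exact ContDiffAt.sum fun σ _ ↦ (contDiffAt_prod fun k _ ↦ hF _ k).const_smul _

theorem contDiffAt_entries_inv {F : X → Mat n n}
    (hF : ContDiffAt ℝ ∞ (fun y ↦ entries (F y)) x) (hx : IsUnit (F x)) :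
    ContDiffAt ℝ ∞ (fun y ↦ entries (F y)⁻¹) x := by
  have hdet : (F x).det ≠ 0 := ((Matrix.isUnit_iff_isUnit_det _).1 hx).ne_zero
  rw [contDiffAt_entries]
  intro i j
  simp only [Matrix.inv_def, Ring.inverse_eq_inv', Matrix.smul_apply, smul_eq_mul,
    Matrix.adjugate_apply]
  refine ((contDiffAt_det hF).inv hdet).mul (contDiffAt_det ?_)
  rw [contDiffAt_entries] at *
  intro k l
  rcases eq_or_ne k j with rfl | hk
  · simpa using contDiffAt_const
  · simpa [Matrix.updateRow_apply, hk] using hF k l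

/-- Matrix multiplication as a continuous bilinear map of arrays. -/
noncomputable def mulCLM (l m n : ℕ) : Arr l m →L[ℝ] Arr m n →L[ℝ] Arr l n :=
  (LinearMap.mk₂ ℝ (fun (A : Arr l m) (B : Arr m n) ↦ entries (Matrix.of A * Matrix.of B))
    (fun A A' B ↦ Matrix.add_mul (Matrix.of A) (Matrix.of A') (Matrix.of B))
    (fun c A B ↦ Matrix.smul_mul c (Matrix.of A) (Matrix.of B))
    (fun A B B' ↦ Matrix.mul_add (Matrix.of A) (Matrix.of B) (Matrix.of B'))
    (fun c A B ↦ Matrix.mul_smul (Matrix.of A) c (Matrix.of B))).toContinuousBilinearMap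

/-- Transposition as a continuous linear map of arrays. -/
noncomputable def transposeCLM (m n : ℕ) : Arr m n →L[ℝ] Arr n m :=
  LinearMap.toContinuousLinearMap
    { toFun := fun A i j ↦ A j i
      map_add' := fun _ _ ↦ rfl
      map_smul' := fun _ _ ↦ rfl }

variable {E H M : Type} [NormedAddCommGroup E] [NormedSpace ℝ E] [TopologicalSpace H]
  [TopologicalSpace M] [ChartedSpace H M] {I : ModelWithCorners ℝ E H} {z : M}

/-- The matrix-valued map `F` is differentiable at `z`, with differential the matrix-valued map
`F'`. The differential is read through `entries`, as no norm is fixed on matrices. -/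
def HasMatDeriv (I : ModelWithCorners ℝ E H) (F : M → Mat m n) (z : M)
    (F' : TangentSpace I z → Mat m n) : Prop :=
  MDifferentiableAt I 𝓘(ℝ, Arr m n) (fun y ↦ entries (F y)) z ∧
    ∀ v, mfderiv I 𝓘(ℝ, Arr m n) (fun y ↦ entries (F y)) z v = entries (F' v)

theorem hasMFDerivAt_bilinear {E₁ E₂ E₃ : Type} [NormedAddCommGroup E₁] [NormedSpace ℝ E₁]
    [NormedAddCommGroup E₂] [NormedSpace ℝ E₂] [NormedAddCommGroup E₃] [NormedSpace ℝ E₃]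
    (B : E₁ →L[ℝ] E₂ →L[ℝ] E₃) {f : M → E₁} {g : M → E₂} {f' : E →L[ℝ] E₁} {g' : E →L[ℝ] E₂}
    (hf : HasMFDerivAt I 𝓘(ℝ, E₁) f z f') (hg : HasMFDerivAt I 𝓘(ℝ, E₂) g z g') :
    HasMFDerivAt I 𝓘(ℝ, E₃) (fun y ↦ B (f y) (g y)) z
      (B.precompR E (f z) g' + B.precompL E f' (g z) : E →L[ℝ] E₃) := by
  refine ⟨B.continuous₂.continuousAt.comp (hf.1.prodMk hg.1), ?_⟩
  have h := B.hasFDerivWithinAt_of_bilinear hf.2 hg.2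
  simp only [mfld_simps] at h ⊢
  exact h

theorem HasMatDeriv.mul {F : M → Mat l m} {G : M → Mat m n} {F' G'}
    (hF : HasMatDeriv I F z F') (hG : HasMatDeriv I G z G') :
    HasMatDeriv I (fun y ↦ F y * G y) z (fun v ↦ F' v * G z + F z * G' v) := by
  have h := hasMFDerivAt_bilinear (mulCLM l m n) hF.1.hasMFDerivAt hG.1.hasMFDerivAt
  refine ⟨h.mdifferentiableAt, fun v ↦ ?_⟩
  refine (DFunLike.congr_fun h.mfderiv v).trans ?_
  rw [add_comm]
  change (mulCLM l m n (mfderiv I 𝓘(ℝ, Arr l m) (fun y ↦ entries (F y)) z v) (entries (G z)) +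
    mulCLM l m n (entries (F z)) (mfderiv I 𝓘(ℝ, Arr m n) (fun y ↦ entries (G y)) z v) :
      Arr l n) = _
  rw [hF.2, hG.2]
  rfl

theorem HasMatDeriv.transpose {F : M → Mat m n} {F'} (hF : HasMatDeriv I F z F') :
    HasMatDeriv I (fun y ↦ (F y)ᵀ) z (fun v ↦ (F' v)ᵀ) := by
  have h : HasMFDerivAt I 𝓘(ℝ, Arr n m) (fun y ↦ entries (F y)ᵀ) z
      ((transposeCLM m n).comp (mfderiv I 𝓘(ℝ, Arr m n) (fun y ↦ entries (F y)) z)) :=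
    HasMFDerivAt.comp z (g := transposeCLM m n) (transposeCLM m n).hasMFDerivAt hF.1.hasMFDerivAt
  refine ⟨h.mdifferentiableAt, fun v ↦ ?_⟩
  rw [h.mfderiv]
  change transposeCLM m n (mfderiv I 𝓘(ℝ, Arr m n) (fun y ↦ entries (F y)) z v) = _
  rw [hF.2]
  rfl

theorem hasMatDeriv_const (A : Mat m n) : HasMatDeriv I (fun _ : M ↦ A) z (fun _ ↦ 0) :=
  ⟨mdifferentiableAt_const, fun v ↦ by rw [mfderiv_const]; rfl⟩

theorem HasMatDeriv.unique {F : M → Mat m n} {F' F''} (h : HasMatDeriv I F z F')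
    (h' : HasMatDeriv I F z F'') : F' = F'' :=
  funext fun v ↦ (h.2 v).symm.trans (h'.2 v)

end Calculus

/-! ### Symmetric and skew-symmetric matrices, dimensions, and the manifold `P_p` -/

section Dimensions

/-- The space of symmetric `p × p` matrices. -/
def symSubmodule (p : ℕ) : Submodule ℝ (Arr p p) where
  carrier := {A | ∀ i j, A i j = A j i}
  zero_mem' _ _ := rfl
  add_mem' {A B} hA hB i j := by simp [hA i j, hB i j]
  smul_mem' c A hA i j := by simp [hA i j]

/-- The space of skew-symmetric `p × p` matrices. -/
def skewSubmodule (p : ℕ) : Submodule ℝ (Arr p p) where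
  carrier := {A | ∀ i j, A i j = - A j i}
  zero_mem' _ _ := by simp
  add_mem' {A B} hA hB i j := by simp only [Pi.add_apply, hA i j, hB i j]; ring
  smul_mem' c A hA i j := by simp [hA i j]

theorem entries_mem_symSubmodule {p : ℕ} {A : Mat p p} :
    entries A ∈ symSubmodule p ↔ Aᵀ = A :=
  ⟨fun h ↦ Matrix.ext fun i j ↦ (h i j).symm, fun h i j ↦ congrFun (congrFun h j) i⟩

theorem entries_mem_skewSubmodule {p : ℕ} {A : Mat p p} :
    entries A ∈ skewSubmodule p ↔ Aᵀ = -A :=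
  ⟨fun h ↦ Matrix.ext fun i j ↦ h j i, fun h i j ↦ congrFun (congrFun h j) i⟩

/-- Symmetric matrices are the functions on unordered pairs of indices. -/
theorem finrank_symSubmodule (p : ℕ) : Module.finrank ℝ (symSubmodule p) = p * (p + 1) / 2 := by
  have e : symSubmodule p ≃ₗ[ℝ] (Sym2 (Fin p) → ℝ) :=
    { toFun := fun A ↦ Sym2.lift ⟨A.1, A.2⟩
      invFun := fun f ↦ ⟨fun i j ↦ f s(i, j), fun i j ↦ congrArg f Sym2.eq_swap⟩
      map_add' := fun A B ↦ by ext s; induction s; rfl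
      map_smul' := fun c A ↦ by ext s; induction s; rfl
      left_inv := fun A ↦ rfl
      right_inv := fun f ↦ by ext s; induction s; rfl }
  rw [e.finrank_eq, Module.finrank_fintype_fun_eq_card, Sym2.card, Fintype.card_fin,
    Nat.choose_two_right, Nat.add_sub_cancel, mul_comm]

variable {n p : ℕ}

/-- The map `Z ↦ Uᵀ Z + Zᵀ U`. It is the differential of `U ↦ Uᵀ U`, and its kernel is the tangent
space of the Stiefel manifold at `U`. -/
def symPart (U : Mat n p) : Arr n p →ₗ[ℝ] Arr p p where
  toFun Z := entries (Uᵀ * Matrix.of Z + (Matrix.of Z)ᵀ * U)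
  map_add' Z W := by
    change Uᵀ * (Matrix.of Z + Matrix.of W) + (Matrix.of Z + Matrix.of W)ᵀ * U =
      (Uᵀ * Matrix.of Z + (Matrix.of Z)ᵀ * U) + (Uᵀ * Matrix.of W + (Matrix.of W)ᵀ * U)
    rw [Matrix.transpose_add, Matrix.mul_add, Matrix.add_mul]
    abel
  map_smul' c Z := by
    change Uᵀ * (c • Matrix.of Z) + (c • Matrix.of Z)ᵀ * U =
      c • (Uᵀ * Matrix.of Z + (Matrix.of Z)ᵀ * U)
    rw [Matrix.transpose_smul, Matrix.mul_smul, Matrix.smul_mul, smul_add]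

/-- The map `Z ↦ Uᵀ Z - Zᵀ U`. Its kernel is the model space of the chart of `S⁺(p,n)` that sends
`A` to `A U`. -/
def skewPart (U : Mat n p) : Arr n p →ₗ[ℝ] Arr p p where
  toFun Z := entries (Uᵀ * Matrix.of Z - (Matrix.of Z)ᵀ * U)
  map_add' Z W := by
    change Uᵀ * (Matrix.of Z + Matrix.of W) - (Matrix.of Z + Matrix.of W)ᵀ * U =
      (Uᵀ * Matrix.of Z - (Matrix.of Z)ᵀ * U) + (Uᵀ * Matrix.of W - (Matrix.of W)ᵀ * U)
    rw [Matrix.transpose_add, Matrix.mul_add, Matrix.add_mul]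
    abel
  map_smul' c Z := by
    change Uᵀ * (c • Matrix.of Z) - (c • Matrix.of Z)ᵀ * U =
      c • (Uᵀ * Matrix.of Z - (Matrix.of Z)ᵀ * U)
    rw [Matrix.transpose_smul, Matrix.mul_smul, Matrix.smul_mul, smul_sub]

theorem entries_mem_ker_symPart {U Z : Mat n p} :
    entries Z ∈ LinearMap.ker (symPart U) ↔ (Uᵀ * Z)ᵀ = -(Uᵀ * Z) := by
  rw [LinearMap.mem_ker, Matrix.transpose_mul, Matrix.transpose_transpose,
    eq_neg_iff_add_eq_zero, add_comm]
  rfl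

theorem entries_mem_ker_skewPart {U Z : Mat n p} :
    entries Z ∈ LinearMap.ker (skewPart U) ↔ (Uᵀ * Z)ᵀ = Uᵀ * Z := by
  rw [LinearMap.mem_ker, Matrix.transpose_mul, Matrix.transpose_transpose, eq_comm (a := Zᵀ * U)]
  exact sub_eq_zero (a := Uᵀ * Z) (b := Zᵀ * U)

theorem range_symPart {U : Mat n p} (hU : Uᵀ * U = 1) :
    LinearMap.range (symPart U) = symSubmodule p := by
  apply le_antisymm
  · rintro _ ⟨Z, rfl⟩
    refine (entries_mem_symSubmodule (A := Uᵀ * Matrix.of Z + (Matrix.of Z)ᵀ * U)).2 ?_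
    simp [add_comm]
  · intro A hA
    have hA' : (Matrix.of A)ᵀ = Matrix.of A := entries_mem_symSubmodule.1 hA
    refine ⟨entries (U * ((1 / 2 : ℝ) • Matrix.of A)), ?_⟩
    change Uᵀ * (U * ((1 / 2 : ℝ) • Matrix.of A)) + (U * ((1 / 2 : ℝ) • Matrix.of A))ᵀ * U =
      Matrix.of A
    rw [Matrix.transpose_mul, Matrix.mul_assoc, ← Matrix.mul_assoc Uᵀ, hU, Matrix.transpose_smul,
      hA', Matrix.one_mul, Matrix.mul_one, ← add_smul]
    norm_num

theorem range_skewPart {U : Mat n p} (hU : Uᵀ * U = 1) :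
    LinearMap.range (skewPart U) = skewSubmodule p := by
  apply le_antisymm
  · rintro _ ⟨Z, rfl⟩
    refine (entries_mem_skewSubmodule (A := Uᵀ * Matrix.of Z - (Matrix.of Z)ᵀ * U)).2 ?_
    simp
  · intro A hA
    have hA' : (Matrix.of A)ᵀ = -Matrix.of A := entries_mem_skewSubmodule.1 hA
    refine ⟨entries (U * ((1 / 2 : ℝ) • Matrix.of A)), ?_⟩
    change Uᵀ * (U * ((1 / 2 : ℝ) • Matrix.of A)) - (U * ((1 / 2 : ℝ) • Matrix.of A))ᵀ * U =
      Matrix.of A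
    rw [Matrix.transpose_mul, Matrix.mul_assoc, ← Matrix.mul_assoc Uᵀ, hU, Matrix.transpose_smul,
      hA', Matrix.one_mul, Matrix.mul_one, smul_neg, sub_neg_eq_add, ← add_smul]
    norm_num

theorem finrank_arr (m n : ℕ) : Module.finrank ℝ (Arr m n) = m * n := by
  simp [Arr, Module.finrank_pi_fintype]

/-- Rank-nullity for `Z ↦ Z - Zᵀ`, whose kernel is the space of symmetric matrices. -/
theorem finrank_skewSubmodule (p : ℕ) :
    Module.finrank ℝ (skewSubmodule p) = p * (p - 1) / 2 := by
  have h := LinearMap.finrank_range_add_finrank_ker (skewPart (1 : Mat p p))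
  have hk : LinearMap.ker (skewPart (1 : Mat p p)) = symSubmodule p := by
    ext A
    refine (entries_mem_ker_skewPart (U := 1) (Z := Matrix.of A)).trans ?_
    rw [Matrix.transpose_one, Matrix.one_mul]
    exact entries_mem_symSubmodule.symm
  rw [range_skewPart (by simp), hk, finrank_symSubmodule, finrank_arr] at h
  rcases p with _ | q
  · simpa using h
  · have h1 := Nat.even_mul_succ_self q
    have h2 := Nat.even_mul_succ_self (q + 1)
    obtain ⟨a, ha⟩ := h1
    obtain ⟨b, hb⟩ := h2
    have : (q + 1) * (q + 1 - 1) = a + a := by rw [← ha, Nat.add_sub_cancel, mul_comm]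
    rw [this]
    have e : (q + 1) * (q + 1) + (q + 1) * (q + 1) = a + a + (b + b) := by
      rw [← ha, ← hb]; ring
    rw [hb] at h
    omega

theorem finrank_ker_symPart {U : Mat n p} (hU : Uᵀ * U = 1) :
    Module.finrank ℝ (LinearMap.ker (symPart U)) = dimStiefel n p := by
  have h := LinearMap.finrank_range_add_finrank_ker (symPart U)
  rw [range_symPart hU, finrank_symSubmodule, finrank_arr] at h
  exact (Nat.sub_eq_of_eq_add' h.symm).symm

theorem finrank_ker_skewPart {U : Mat n p} (hU : Uᵀ * U = 1) :
    Module.finrank ℝ (LinearMap.ker (skewPart U)) = dimSPlus p n := by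
  have h := LinearMap.finrank_range_add_finrank_ker (skewPart U)
  rw [range_skewPart hU, finrank_skewSubmodule, finrank_arr] at h
  exact (Nat.sub_eq_of_eq_add' h.symm).symm

end Dimensions

section Embeddings

variable (n p : ℕ)

theorem isEmbedding_entries_subtype (P : Mat n p → Prop) :
    Topology.IsEmbedding fun A : {A : Mat n p // P A} ↦ entries A.1 :=
  Topology.IsEmbedding.subtypeVal

end Embeddings

section PosDef

variable {p : ℕ}

/-- The quadratic form of `A` is positive off the origin; unlike for `Matrix.PosDef`, no symmetry is
asked, so that the condition is open in the space of all matrices. -/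
def IsPositive (A : Mat p p) : Prop := ∀ v : Fin p → ℝ, v ≠ 0 → 0 < v ⬝ᵥ (A *ᵥ v)

theorem posDef_iff {A : Mat p p} : A.PosDef ↔ Aᵀ = A ∧ IsPositive A := by
  rw [Matrix.posDef_iff_dotProduct_mulVec, Matrix.IsHermitian,
    Matrix.conjTranspose_eq_transpose_of_trivial]
  simp [IsPositive]

/-- Positivity may be tested on the unit sphere, which is compact. -/
theorem isOpen_isPositive : IsOpen {A : Arr p p | IsPositive (Matrix.of A)} := by
  have hs : {A : Arr p p | IsPositive (Matrix.of A)} =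
      {A : Arr p p | ∀ v ∈ Metric.sphere (0 : Fin p → ℝ) 1, 0 < v ⬝ᵥ (Matrix.of A *ᵥ v)} := by
    ext A
    refine ⟨fun h v hv ↦ h v (ne_zero_of_mem_unit_sphere ⟨v, hv⟩), fun h v hv ↦ ?_⟩
    have hn : 0 < ‖v‖ := norm_pos_iff.2 hv
    have h1 := h (‖v‖⁻¹ • v) (by simp [norm_smul, hn.ne'])
    rw [Matrix.mulVec_smul, smul_dotProduct, dotProduct_smul, smul_eq_mul, smul_eq_mul] at h1
    have h2 := inv_pos.2 hn
    exact pos_of_mul_pos_right (pos_of_mul_pos_right h1 h2.le) h2.le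
  rw [hs, isOpen_iff_mem_nhds]
  intro A hA
  refine (isCompact_sphere (0 : Fin p → ℝ) 1).eventually_forall_of_forall_eventually fun v hv ↦ ?_
  have hc : Continuous fun z : Arr p p × (Fin p → ℝ) ↦ z.2 ⬝ᵥ (Matrix.of z.1 *ᵥ z.2) := by
    simp only [dotProduct, Matrix.mulVec, Matrix.of_apply]
    fun_prop
  exact hc.continuousAt.eventually (lt_mem_nhds (hA v hv))

/-- The slice atlas of `P_p`, an open subset of the space of symmetric matrices, with one chart. -/
noncomputable def atlasPD (p : ℕ) :
    SliceAtlas (fun S : PD p ↦ entries (S : Mat p p)) (dimPD p) where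
  isEmbedding := isEmbedding_entries_subtype p p _
  chartAt _ := SliceChart.ofSubmodule (symSubmodule p) (finrank_symSubmodule p) Set.univ Set.univ
    {A | IsPositive (Matrix.of A)} id id isOpen_univ isOpen_univ isOpen_isPositive contDiffOn_id
    contDiffOn_id (fun _ _ ↦ trivial) (fun S _ ↦ entries_mem_symSubmodule.2 (posDef_iff.1 S.2).1)
    (fun S _ ↦ (posDef_iff.1 S.2).2) (fun _ _ ↦ rfl)
    (fun A h h' ↦ ⟨⟨Matrix.of A, posDef_iff.2 ⟨entries_mem_symSubmodule.1 h, h'⟩⟩, trivial,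
      rfl, rfl⟩)
  mem_source _ := trivial

end PosDef

/-! ### Cayley charts of the Stiefel manifold -/

section StiefelChart

variable {n p : ℕ}

theorem isOpen_setOf_isUnit {X : Type} [TopologicalSpace X] {F : X → Mat n n} (hF : Continuous F) :
    IsOpen {x | IsUnit (F x)} := by
  simp only [Matrix.isUnit_iff_isUnit_det, isUnit_iff_ne_zero]
  exact isOpen_ne_fun hF.matrix_det continuous_const

theorem contDiffAt_arr (A : Arr n p) : ContDiffAt ℝ ∞ (fun B : Arr n p ↦ entries (Matrix.of B)) A :=
  contDiffAt_id

theorem contDiffAt_entries_const {X : Type} [NormedAddCommGroup X] [NormedSpace ℝ X] {x : X}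
    (A : Mat n p) : ContDiffAt ℝ ∞ (fun _ : X ↦ entries A) x := contDiffAt_const

/-- The matrix `K = (U - U₀ U₀ᵀ U) (1 + U₀ᵀ U)⁻¹`: the component of `U` orthogonal to the columns of
`U₀`, normalised so that `K` and the Cayley transform of `U₀ᵀ U` are coordinates of `U`. -/
noncomputable def cayleyNormal (U₀ U : Mat n p) : Mat n p :=
  (U - U₀ * (U₀ᵀ * U)) * (1 + U₀ᵀ * U)⁻¹

/-- The Cayley coordinates of `U` around `U₀`, with values in the tangent space
`{Z : U₀ᵀ Z skew-symmetric}`. With `T = U₀ᵀ U` and `K = cayleyNormal U₀ U`, the Cayley transform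
`C = (T - 1) (1 + T)⁻¹` satisfies `C + Cᵀ = -2 Kᵀ K` when `Uᵀ U = 1`, so that `C + Kᵀ K` is
skew-symmetric; the coordinates are `U₀ (C + Kᵀ K) + K`. -/
noncomputable def cayleyCoord (U₀ U : Mat n p) : Mat n p :=
  U₀ * ((U₀ᵀ * U - 1) * (1 + U₀ᵀ * U)⁻¹ + (cayleyNormal U₀ U)ᵀ * cayleyNormal U₀ U) +
    cayleyNormal U₀ U

/-- The component of `Z` orthogonal to the columns of `U₀`. -/
def normalPart (U₀ Z : Mat n p) : Mat n p := Z - U₀ * (U₀ᵀ * Z)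

/-- The Cayley transform `C` of `U₀ᵀ U`, recovered from the Cayley coordinates `Z` of `U`. -/
def cayleyCore (U₀ Z : Mat n p) : Mat p p :=
  U₀ᵀ * Z - (normalPart U₀ Z)ᵀ * normalPart U₀ Z

/-- The inverse of `cayleyCoord`: the matrix `U₀ (1 + C) (1 - C)⁻¹ + 2 K (1 - C)⁻¹`, where `K` is
the normal component of `Z` and `C = cayleyCore U₀ Z`. -/
noncomputable def cayleyParam (U₀ Z : Mat n p) : Mat n p :=
  U₀ * ((1 + cayleyCore U₀ Z) * (1 - cayleyCore U₀ Z)⁻¹) +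
    (2 : ℝ) • (normalPart U₀ Z * (1 - cayleyCore U₀ Z)⁻¹)

theorem transpose_mul_normalPart {U₀ : Mat n p} (h₀ : U₀ᵀ * U₀ = 1) (Z : Mat n p) :
    U₀ᵀ * normalPart U₀ Z = 0 := by
  rw [normalPart, Matrix.mul_sub, ← Matrix.mul_assoc U₀ᵀ, h₀, Matrix.one_mul, sub_self]

theorem transpose_mul_cayleyCoord {U₀ : Mat n p} (h₀ : U₀ᵀ * U₀ = 1) (U : Mat n p) :
    U₀ᵀ * cayleyCoord U₀ U = (U₀ᵀ * U - 1) * (1 + U₀ᵀ * U)⁻¹ +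
      (cayleyNormal U₀ U)ᵀ * cayleyNormal U₀ U := by
  have h : U₀ᵀ * cayleyNormal U₀ U = 0 := by
    rw [cayleyNormal, ← Matrix.mul_assoc]
    exact (congrArg (· * _) (transpose_mul_normalPart h₀ U)).trans (Matrix.zero_mul _)
  rw [cayleyCoord, Matrix.mul_add, h, add_zero, ← Matrix.mul_assoc U₀ᵀ, h₀, Matrix.one_mul]

theorem normalPart_cayleyCoord {U₀ : Mat n p} (h₀ : U₀ᵀ * U₀ = 1) (U : Mat n p) :
    normalPart U₀ (cayleyCoord U₀ U) = cayleyNormal U₀ U := by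
  rw [normalPart, transpose_mul_cayleyCoord h₀, cayleyCoord, add_sub_cancel_left]

theorem cayleyCore_cayleyCoord {U₀ : Mat n p} (h₀ : U₀ᵀ * U₀ = 1) (U : Mat n p) :
    cayleyCore U₀ (cayleyCoord U₀ U) = (U₀ᵀ * U - 1) * (1 + U₀ᵀ * U)⁻¹ := by
  rw [cayleyCore, transpose_mul_cayleyCoord h₀, normalPart_cayleyCoord h₀, add_sub_cancel_right]

theorem one_sub_cayleyCore_cayleyCoord {U₀ U : Mat n p} (h₀ : U₀ᵀ * U₀ = 1)
    (h : IsUnit (1 + U₀ᵀ * U)) :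
    1 - cayleyCore U₀ (cayleyCoord U₀ U) = (2 : ℝ) • (1 + U₀ᵀ * U)⁻¹ := by
  rw [cayleyCore_cayleyCoord h₀]
  nth_rewrite 1 [← Matrix.mul_nonsing_inv _ ((Matrix.isUnit_iff_isUnit_det _).1 h)]
  rw [← Matrix.sub_mul, show 1 + U₀ᵀ * U - (U₀ᵀ * U - 1) = 1 + 1 by abel,
    ← two_smul ℝ (1 : Mat p p), Matrix.smul_mul, Matrix.one_mul]

theorem isUnit_one_sub_cayleyCore_cayleyCoord {U₀ U : Mat n p} (h₀ : U₀ᵀ * U₀ = 1)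
    (h : IsUnit (1 + U₀ᵀ * U)) : IsUnit (1 - cayleyCore U₀ (cayleyCoord U₀ U)) := by
  rw [one_sub_cayleyCore_cayleyCoord h₀ h]
  have := (Matrix.isUnit_nonsing_inv_iff).2 h
  exact this.smul (Units.mk0 (2 : ℝ) two_ne_zero)

theorem cayleyParam_cayleyCoord {U₀ U : Mat n p} (h₀ : U₀ᵀ * U₀ = 1)
    (h : IsUnit (1 + U₀ᵀ * U)) : cayleyParam U₀ (cayleyCoord U₀ U) = U := by
  have hd := (Matrix.isUnit_iff_isUnit_det _).1 h
  have hM : (1 - cayleyCore U₀ (cayleyCoord U₀ U))⁻¹ = (1 / 2 : ℝ) • (1 + U₀ᵀ * U) := by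
    apply Matrix.inv_eq_left_inv
    rw [one_sub_cayleyCore_cayleyCoord h₀ h, Matrix.smul_mul, Matrix.mul_smul,
      Matrix.mul_nonsing_inv _ hd, smul_smul]
    norm_num
  have hC : 1 + cayleyCore U₀ (cayleyCoord U₀ U) = (2 : ℝ) • ((U₀ᵀ * U) * (1 + U₀ᵀ * U)⁻¹) := by
    rw [cayleyCore_cayleyCoord h₀]
    nth_rewrite 1 [← Matrix.mul_nonsing_inv _ hd]
    rw [← Matrix.add_mul, two_smul, ← Matrix.add_mul]
    congr 1
    abel
  rw [cayleyParam, hM, hC, normalPart_cayleyCoord h₀, cayleyNormal]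
  simp only [Matrix.smul_mul, Matrix.mul_smul, Matrix.mul_assoc, Matrix.nonsing_inv_mul _ hd,
    smul_smul, Matrix.mul_one]
  norm_num

theorem cayleyCoord_mem {U₀ U : Mat n p} (h₀ : U₀ᵀ * U₀ = 1) (hU : Uᵀ * U = 1)
    (h : IsUnit (1 + U₀ᵀ * U)) : entries (cayleyCoord U₀ U) ∈ LinearMap.ker (symPart U₀) := by
  have hd := (Matrix.isUnit_iff_isUnit_det _).1 h
  rw [entries_mem_ker_symPart, transpose_mul_cayleyCoord h₀]
  have hK : (cayleyNormal U₀ U)ᵀ * cayleyNormal U₀ U =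
      ((1 + U₀ᵀ * U)⁻¹)ᵀ * (1 - (U₀ᵀ * U)ᵀ * (U₀ᵀ * U)) * (1 + U₀ᵀ * U)⁻¹ := by
    have : (U - U₀ * (U₀ᵀ * U))ᵀ * (U - U₀ * (U₀ᵀ * U)) = 1 - (U₀ᵀ * U)ᵀ * (U₀ᵀ * U) := by
      have h1 := transpose_mul_normalPart h₀ U
      rw [normalPart] at h1
      rw [Matrix.transpose_sub, Matrix.transpose_mul, Matrix.sub_mul, Matrix.mul_assoc _ U₀ᵀ, h1,
        Matrix.mul_zero, sub_zero, Matrix.mul_sub, hU, Matrix.transpose_mul,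
        Matrix.transpose_transpose, Matrix.mul_assoc Uᵀ]
    rw [cayleyNormal, Matrix.transpose_mul, ← this]
    simp only [Matrix.mul_assoc]
  have h1 : (U₀ᵀ * U - 1) * (1 + U₀ᵀ * U)⁻¹ =
      ((1 + U₀ᵀ * U)⁻¹)ᵀ * ((1 + U₀ᵀ * U)ᵀ * (U₀ᵀ * U - 1)) * (1 + U₀ᵀ * U)⁻¹ := by
    rw [← Matrix.mul_assoc, ← Matrix.transpose_mul, Matrix.mul_nonsing_inv _ hd,
      Matrix.transpose_one, Matrix.one_mul]
  rw [hK, h1, ← Matrix.add_mul, ← Matrix.mul_add]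
  generalize (1 + U₀ᵀ * U)⁻¹ = N
  generalize U₀ᵀ * U = T
  simp only [Matrix.transpose_mul, Matrix.transpose_add, Matrix.transpose_sub,
    Matrix.transpose_transpose, Matrix.transpose_one]
  rw [eq_neg_iff_add_eq_zero]
  noncomm_ring

/-- Orthonormality of the columns comes from
`(1 + C)ᵀ (1 + C) + 4 Kᵀ K = (1 - C)ᵀ (1 - C)`, which is the relation `C + Cᵀ = -2 Kᵀ K`. -/
theorem cayleyParam_spec {U₀ Z : Mat n p} (h₀ : U₀ᵀ * U₀ = 1)
    (hZ : entries Z ∈ LinearMap.ker (symPart U₀)) (h : IsUnit (1 - cayleyCore U₀ Z)) :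
    (cayleyParam U₀ Z)ᵀ * cayleyParam U₀ Z = 1 ∧ IsUnit (1 + U₀ᵀ * cayleyParam U₀ Z) ∧
      cayleyCoord U₀ (cayleyParam U₀ Z) = Z := by
  have hd := (Matrix.isUnit_iff_isUnit_det _).1 h
  have hK := transpose_mul_normalPart h₀ Z
  have hT : U₀ᵀ * cayleyParam U₀ Z = (1 + cayleyCore U₀ Z) * (1 - cayleyCore U₀ Z)⁻¹ := by
    rw [cayleyParam, Matrix.mul_add, ← Matrix.mul_assoc, h₀, Matrix.one_mul, Matrix.mul_smul,
      ← Matrix.mul_assoc, hK, Matrix.zero_mul, smul_zero, add_zero]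
  have h1T : 1 + U₀ᵀ * cayleyParam U₀ Z = (2 : ℝ) • (1 - cayleyCore U₀ Z)⁻¹ := by
    rw [hT]
    nth_rewrite 1 [← Matrix.mul_nonsing_inv _ hd]
    rw [← Matrix.add_mul, sub_add_add_cancel, ← two_smul ℝ (1 : Mat p p), Matrix.smul_mul,
      Matrix.one_mul]
  have hinv : (1 + U₀ᵀ * cayleyParam U₀ Z)⁻¹ = (1 / 2 : ℝ) • (1 - cayleyCore U₀ Z) := by
    apply Matrix.inv_eq_left_inv
    rw [h1T, Matrix.smul_mul, Matrix.mul_smul, Matrix.mul_nonsing_inv _ hd, smul_smul]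
    norm_num
  have hN : cayleyNormal U₀ (cayleyParam U₀ Z) = normalPart U₀ Z := by
    rw [cayleyNormal, hinv, hT, cayleyParam, add_sub_cancel_left, Matrix.smul_mul, Matrix.mul_smul,
      Matrix.mul_assoc, Matrix.nonsing_inv_mul _ hd, smul_smul]
    norm_num
  refine ⟨?_, ?_, ?_⟩
  · have hC : cayleyCore U₀ Z + (cayleyCore U₀ Z)ᵀ =
        -((2 : ℝ) • ((normalPart U₀ Z)ᵀ * normalPart U₀ Z)) := by
      rw [cayleyCore, Matrix.transpose_sub, entries_mem_ker_symPart.1 hZ, Matrix.transpose_mul,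
        Matrix.transpose_transpose, two_smul]
      abel
    have h4 : (cayleyParam U₀ Z)ᵀ * cayleyParam U₀ Z = ((1 - cayleyCore U₀ Z)⁻¹)ᵀ *
        ((1 + cayleyCore U₀ Z)ᵀ * (1 + cayleyCore U₀ Z) +
          (4 : ℝ) • ((normalPart U₀ Z)ᵀ * normalPart U₀ Z)) * (1 - cayleyCore U₀ Z)⁻¹ := by
      have hK' : (normalPart U₀ Z)ᵀ * U₀ = 0 := by
        have := congrArg Matrix.transpose hK
        rwa [Matrix.transpose_mul, Matrix.transpose_transpose, Matrix.transpose_zero] at this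
      have e1 : U₀ᵀ * cayleyParam U₀ Z = (1 + cayleyCore U₀ Z) * (1 - cayleyCore U₀ Z)⁻¹ := hT
      have e2 : (normalPart U₀ Z)ᵀ * cayleyParam U₀ Z =
          (2 : ℝ) • ((normalPart U₀ Z)ᵀ * normalPart U₀ Z * (1 - cayleyCore U₀ Z)⁻¹) := by
        rw [cayleyParam, Matrix.mul_add, ← Matrix.mul_assoc, hK', Matrix.zero_mul, zero_add,
          Matrix.mul_smul, Matrix.mul_assoc]
      nth_rewrite 1 [cayleyParam]
      rw [Matrix.transpose_add, Matrix.transpose_mul, Matrix.transpose_smul, Matrix.transpose_mul,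
        Matrix.transpose_mul, Matrix.add_mul, Matrix.mul_assoc _ U₀ᵀ, e1, Matrix.smul_mul,
        Matrix.mul_assoc _ (normalPart U₀ Z)ᵀ, e2, Matrix.mul_smul, smul_smul]
      norm_num
      simp only [Matrix.mul_add, Matrix.add_mul, Matrix.mul_smul, Matrix.smul_mul,
        Matrix.mul_assoc]
    have h5 : (1 + cayleyCore U₀ Z)ᵀ * (1 + cayleyCore U₀ Z) +
          (4 : ℝ) • ((normalPart U₀ Z)ᵀ * normalPart U₀ Z) =
        (1 - cayleyCore U₀ Z)ᵀ * (1 - cayleyCore U₀ Z) := by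
      have e3 : (4 : ℝ) • ((normalPart U₀ Z)ᵀ * normalPart U₀ Z) =
          -((2 : ℝ) • (cayleyCore U₀ Z + (cayleyCore U₀ Z)ᵀ)) := by
        rw [hC, smul_neg, neg_neg, smul_smul]
        norm_num
      rw [e3, two_smul, Matrix.transpose_add, Matrix.transpose_sub, Matrix.transpose_one]
      noncomm_ring
    rw [h4, h5, ← Matrix.mul_assoc, ← Matrix.transpose_mul, Matrix.mul_nonsing_inv _ hd,
      Matrix.mul_assoc, Matrix.mul_nonsing_inv _ hd, Matrix.transpose_one, Matrix.one_mul]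
  · rw [h1T]
    exact ((Matrix.isUnit_nonsing_inv_iff).2 h).smul (Units.mk0 (2 : ℝ) two_ne_zero)
  · rw [cayleyCoord, hN, hinv, hT]
    have e : (1 + cayleyCore U₀ Z) * (1 - cayleyCore U₀ Z)⁻¹ - 1 =
        (2 : ℝ) • (cayleyCore U₀ Z * (1 - cayleyCore U₀ Z)⁻¹) := by
      nth_rewrite 3 [← Matrix.mul_nonsing_inv _ hd]
      rw [← Matrix.sub_mul, two_smul, ← Matrix.add_mul]
      congr 1
      abel
    rw [e, Matrix.smul_mul, Matrix.mul_smul, Matrix.mul_assoc, Matrix.nonsing_inv_mul _ hd,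
      smul_smul, Matrix.mul_one]
    norm_num
    rw [cayleyCore, sub_add_cancel, normalPart, add_sub_cancel]

theorem contDiffAt_cayleyCoord (U₀ : Mat n p) {A : Arr n p}
    (hA : IsUnit (1 + U₀ᵀ * Matrix.of A)) :
    ContDiffAt ℝ ∞ (fun A : Arr n p ↦ entries (cayleyCoord U₀ (Matrix.of A))) A := by
  have hT : ContDiffAt ℝ ∞ (fun A : Arr n p ↦ entries (U₀ᵀ * Matrix.of A)) A :=
    contDiffAt_entries_mul (contDiffAt_entries_const _) (contDiffAt_arr A)
  have hinv : ContDiffAt ℝ ∞ (fun A : Arr n p ↦ entries (1 + U₀ᵀ * Matrix.of A)⁻¹) A :=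
    contDiffAt_entries_inv (contDiffAt_entries_add (contDiffAt_entries_const _) hT) hA
  have hK : ContDiffAt ℝ ∞ (fun A : Arr n p ↦ entries (cayleyNormal U₀ (Matrix.of A))) A :=
    contDiffAt_entries_mul (contDiffAt_entries_sub (contDiffAt_arr A)
      (contDiffAt_entries_mul (contDiffAt_entries_const _) hT)) hinv
  exact contDiffAt_entries_add (contDiffAt_entries_mul (contDiffAt_entries_const _)
    (contDiffAt_entries_add
      (contDiffAt_entries_mul (contDiffAt_entries_sub hT (contDiffAt_entries_const _)) hinv)
      (contDiffAt_entries_mul (contDiffAt_entries_transpose hK) hK))) hK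

theorem contDiffAt_cayleyParam (U₀ : Mat n p) {A : Arr n p}
    (hA : IsUnit (1 - cayleyCore U₀ (Matrix.of A))) :
    ContDiffAt ℝ ∞ (fun A : Arr n p ↦ entries (cayleyParam U₀ (Matrix.of A))) A := by
  have hT : ContDiffAt ℝ ∞ (fun A : Arr n p ↦ entries (U₀ᵀ * Matrix.of A)) A :=
    contDiffAt_entries_mul (contDiffAt_entries_const _) (contDiffAt_arr A)
  have hK : ContDiffAt ℝ ∞ (fun A : Arr n p ↦ entries (normalPart U₀ (Matrix.of A))) A :=
    contDiffAt_entries_sub (contDiffAt_arr A)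
      (contDiffAt_entries_mul (contDiffAt_entries_const _) hT)
  have hC : ContDiffAt ℝ ∞ (fun A : Arr n p ↦ entries (cayleyCore U₀ (Matrix.of A))) A :=
    contDiffAt_entries_sub hT (contDiffAt_entries_mul (contDiffAt_entries_transpose hK) hK)
  have hinv : ContDiffAt ℝ ∞ (fun A : Arr n p ↦ entries (1 - cayleyCore U₀ (Matrix.of A))⁻¹) A :=
    contDiffAt_entries_inv (contDiffAt_entries_sub (contDiffAt_entries_const _) hC) hA
  exact contDiffAt_entries_add (contDiffAt_entries_mul (contDiffAt_entries_const _)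
    (contDiffAt_entries_mul (contDiffAt_entries_add (contDiffAt_entries_const _) hC) hinv))
    ((contDiffAt_entries_mul hK hinv).const_smul (2 : ℝ))

/-- The slice atlas of the Stiefel manifold: the chart around `U₀` is the Cayley chart, defined
where `1 + U₀ᵀ U` is invertible. -/
noncomputable def atlasStiefel (n p : ℕ) :
    SliceAtlas (fun U : Stiefel n p ↦ entries (U : Mat n p)) (dimStiefel n p) where
  isEmbedding := isEmbedding_entries_subtype n p _
  chartAt U₀ := SliceChart.ofSubmodule (LinearMap.ker (symPart U₀.1)) (finrank_ker_symPart U₀.2)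
    {U | IsUnit (1 + U₀.1ᵀ * U.1)} {A | IsUnit (1 + U₀.1ᵀ * Matrix.of A)}
    {Z | IsUnit (1 - cayleyCore U₀.1 (Matrix.of Z))}
    (fun A ↦ entries (cayleyCoord U₀.1 (Matrix.of A)))
    (fun Z ↦ entries (cayleyParam U₀.1 (Matrix.of Z)))
    (isOpen_setOf_isUnit (by fun_prop))
    (isOpen_setOf_isUnit (by fun_prop))
    (isOpen_setOf_isUnit (by unfold cayleyCore normalPart; fun_prop))
    (fun A hA ↦ (contDiffAt_cayleyCoord U₀.1 hA).contDiffWithinAt)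
    (fun A hA ↦ (contDiffAt_cayleyParam U₀.1 hA).contDiffWithinAt)
    (fun _ h ↦ h)
    (fun U h ↦ cayleyCoord_mem U₀.2 U.2 h)
    (fun U h ↦ isUnit_one_sub_cayleyCore_cayleyCoord U₀.2 h)
    (fun U h ↦ congrArg entries (cayleyParam_cayleyCoord U₀.2 h))
    (fun Z hZ h ↦ ⟨⟨_, (cayleyParam_spec U₀.2 hZ h).1⟩, (cayleyParam_spec U₀.2 hZ h).2.1, rfl,
      congrArg entries (cayleyParam_spec U₀.2 hZ h).2.2⟩)
  mem_source U := by
    change IsUnit (1 + U.1ᵀ * U.1)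
    rw [U.2, ← two_smul ℝ (1 : Mat p p)]
    exact isUnit_one.smul (Units.mk0 (2 : ℝ) two_ne_zero)

end StiefelChart

/-! ### The projection to `S⁺(p,n)` and the charts of `S⁺(p,n)` -/

section FixedRank

variable {n p : ℕ}

theorem PD.transpose_eq (S : PD p) : S.1ᵀ = S.1 := (posDef_iff.1 S.2).1

theorem PD.mul_inv (S : PD p) : S.1 * S.1⁻¹ = 1 :=
  Matrix.mul_nonsing_inv _ ((Matrix.isUnit_iff_isUnit_det _).1 S.2.isUnit)

theorem PD.inv_mul (S : PD p) : S.1⁻¹ * S.1 = 1 :=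
  Matrix.nonsing_inv_mul _ ((Matrix.isUnit_iff_isUnit_det _).1 S.2.isUnit)

theorem SPlus.transpose_eq (A : SPlus p n) : A.1ᵀ = A.1 := by
  have := A.2.1.isHermitian
  rwa [Matrix.IsHermitian, Matrix.conjTranspose_eq_transpose_of_trivial] at this

/-- By the spectral theorem: `U` consists of the eigenvectors of `A` for the `p` nonzero
eigenvalues, and `S` is the diagonal matrix of these eigenvalues. -/
theorem toSPlus_surjective : Function.Surjective (toSPlus n p) := by
  rintro ⟨A, hA, hr⟩
  have hH := hA.isHermitian
  have hcard : Fintype.card {i // hH.eigenvalues i ≠ 0} = p := by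
    rw [← hH.rank_eq_card_non_zero_eigs, hr]
  let e : Fin p ≃ {i // hH.eigenvalues i ≠ 0} := (Fintype.equivFinOfCardEq hcard).symm
  let V : Mat n n := (hH.eigenvectorUnitary : Matrix (Fin n) (Fin n) ℝ)
  have hV : Vᵀ * V = 1 := by
    have := Unitary.coe_star_mul_self hH.eigenvectorUnitary
    rwa [Matrix.star_eq_conjTranspose, Matrix.conjTranspose_eq_transpose_of_trivial] at this
  let U : Mat n p := V.submatrix id fun i ↦ (e i).1
  let S : Mat p p := Matrix.diagonal fun i ↦ hH.eigenvalues (e i).1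
  have hU : Uᵀ * U = 1 := by
    have : Uᵀ * U = (Vᵀ * V).submatrix (fun i ↦ (e i).1) fun i ↦ (e i).1 := by
      ext i j
      simp [U, Matrix.mul_apply]
    rw [this, hV]
    exact Matrix.submatrix_one _ (Subtype.val_injective.comp e.injective)
  have hS : S.PosDef := Matrix.PosDef.diagonal fun i ↦
    lt_of_le_of_ne (hA.eigenvalues_nonneg _) (e i).2.symm
  refine ⟨(⟨U, hU⟩, ⟨S, hS⟩), Subtype.ext ?_⟩
  change U * S * Uᵀ = A
  have hspec : A = V * Matrix.diagonal hH.eigenvalues * Vᵀ := by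
    have := hH.spectral_theorem
    rw [Unitary.conjStarAlgAut_apply] at this
    rw [← Matrix.conjTranspose_eq_transpose_of_trivial, ← Matrix.star_eq_conjTranspose]
    exact this
  rw [hspec]
  ext i j
  have h1 : (U * S * Uᵀ) i j =
      ∑ k, V i (e k).1 * hH.eigenvalues (e k).1 * V j (e k).1 := by
    rw [Matrix.mul_apply]
    exact Finset.sum_congr rfl fun k _ ↦ by rw [Matrix.mul_diagonal]; rfl
  have h2 : (V * Matrix.diagonal hH.eigenvalues * Vᵀ) i j =
      ∑ k, V i k * hH.eigenvalues k * V j k := by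
    rw [Matrix.mul_apply]
    exact Finset.sum_congr rfl fun k _ ↦ by rw [Matrix.mul_diagonal]; rfl
  rw [h1, h2, e.sum_comp fun k ↦ V i k.1 * hH.eigenvalues k.1 * V j k.1,
    ← Finset.sum_subtype (Finset.univ.filter fun k ↦ hH.eigenvalues k ≠ 0) (by simp)
      fun k ↦ V i k * hH.eigenvalues k * V j k]
  exact Finset.sum_filter_of_ne fun k _ h h0 ↦ h (by rw [h0]; ring)

/-- The fibres of `(U, S) ↦ U S Uᵀ` are the orbits of `O(p)`: if `(U, S)` and `(V, T)` have the same
image, both have the same column space, so that `U = V Q` for the orthogonal matrix `Q = Vᵀ U`. -/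
theorem toSPlus_eq_iff (x y : Stiefel n p × PD p) :
    toSPlus n p x = toSPlus n p y ↔ toQuotient n p x = toQuotient n p y := by
  have key : toQuotient n p x = toQuotient n p y ↔ ∃ Q : (O p)ᵐᵒᵖ, Q • y = x := Quotient.eq
  rw [key]
  constructor
  · intro h
    have hA : x.1.1 * x.2.1 * x.1.1ᵀ = y.1.1 * y.2.1 * y.1.1ᵀ := congrArg Subtype.val h
    have h1 : y.1.1 * (y.1.1ᵀ * x.1.1) = x.1.1 := by
      have e : x.1.1 = y.1.1 * y.2.1 * y.1.1ᵀ * (x.1.1 * x.2.1⁻¹) := by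
        rw [← hA, Matrix.mul_assoc, ← Matrix.mul_assoc x.1.1ᵀ, x.1.2, Matrix.one_mul,
          Matrix.mul_assoc, x.2.mul_inv, Matrix.mul_one]
      rw [e]
      simp only [Matrix.mul_assoc]
      rw [← Matrix.mul_assoc y.1.1ᵀ y.1.1, y.1.2, Matrix.one_mul]
    have hQ : (y.1.1ᵀ * x.1.1)ᵀ * (y.1.1ᵀ * x.1.1) = 1 := by
      rw [Matrix.transpose_mul, Matrix.transpose_transpose, Matrix.mul_assoc, h1, x.1.2]
    refine ⟨MulOpposite.op ⟨_, (Matrix.mem_orthogonalGroup_iff' (Fin p) ℝ).2 hQ⟩, ?_⟩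
    refine Prod.ext (Subtype.ext h1) (Subtype.ext ?_)
    change (y.1.1ᵀ * x.1.1)ᵀ * y.2.1 * (y.1.1ᵀ * x.1.1) = x.2.1
    calc (y.1.1ᵀ * x.1.1)ᵀ * y.2.1 * (y.1.1ᵀ * x.1.1)
        = x.1.1ᵀ * (y.1.1 * y.2.1 * y.1.1ᵀ) * x.1.1 := by
          simp only [Matrix.transpose_mul, Matrix.transpose_transpose, Matrix.mul_assoc]
      _ = (x.1.1ᵀ * x.1.1) * x.2.1 * (x.1.1ᵀ * x.1.1) := by
          rw [← hA]; simp only [Matrix.mul_assoc]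
      _ = x.2.1 := by rw [x.1.2, Matrix.one_mul, Matrix.mul_one]
  · rintro ⟨Q, rfl⟩
    apply Subtype.ext
    have hQ : (Q.unop : Mat p p) * (Q.unop : Mat p p)ᵀ = 1 :=
      mul_eq_one_comm.1 (orthogonal_transpose_mul Q.unop)
    change y.1.1 * (Q.unop : Mat p p) * ((Q.unop : Mat p p)ᵀ * y.2.1 * (Q.unop : Mat p p)) *
      (y.1.1 * (Q.unop : Mat p p))ᵀ = y.1.1 * y.2.1 * y.1.1ᵀ
    calc _ = y.1.1 * ((Q.unop : Mat p p) * (Q.unop : Mat p p)ᵀ) * y.2.1 *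
        ((Q.unop : Mat p p) * (Q.unop : Mat p p)ᵀ) * y.1.1ᵀ := by
          simp only [Matrix.transpose_mul, Matrix.mul_assoc]
      _ = _ := by rw [hQ, Matrix.mul_one, Matrix.mul_one]

/-- The matrix `Y (U₀ᵀ Y)⁻¹ Yᵀ`: when `U₀ᵀ Y` is symmetric positive definite,
it is the element `A` of `S⁺(p,n)` with `A U₀ = Y`. -/
noncomputable def sliceParam (U₀ : Mat n p) (Y : Mat n p) : Mat n n := Y * (U₀ᵀ * Y)⁻¹ * Yᵀ

theorem sliceParam_mul (U₀ : Mat n p) (A : SPlus p n) (h : IsUnit (U₀ᵀ * A.1 * U₀)) :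
    sliceParam U₀ (A.1 * U₀) = A.1 := by
  obtain ⟨⟨U, S⟩, rfl⟩ := toSPlus_surjective A
  have hd := (Matrix.isUnit_iff_isUnit_det _).1 h
  set G := U₀ᵀ * (toSPlus n p (U, S)).1 * U₀ with hG
  have hA : (toSPlus n p (U, S)).1 = U.1 * S.1 * U.1ᵀ := rfl
  -- `U₀ᵀ U` is invertible, and its right inverse is also a left inverse
  have h1 : (U₀ᵀ * U.1) * (S.1 * (U.1ᵀ * U₀) * G⁻¹) = 1 := by
    refine Eq.trans ?_ (Matrix.mul_nonsing_inv _ hd)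
    nth_rewrite 2 [hG]
    rw [hA]
    simp only [Matrix.mul_assoc]
  have h2 := mul_eq_one_comm.1 h1
  calc sliceParam U₀ ((toSPlus n p (U, S)).1 * U₀)
      = (toSPlus n p (U, S)).1 * U₀ * G⁻¹ * (U₀ᵀ * (toSPlus n p (U, S)).1) := by
        rw [sliceParam, Matrix.transpose_mul, SPlus.transpose_eq, hG]
        simp only [Matrix.mul_assoc]
    _ = U.1 * (S.1 * (U.1ᵀ * U₀) * G⁻¹ * (U₀ᵀ * U.1)) * S.1 * U.1ᵀ := by
        rw [hA]
        simp only [Matrix.mul_assoc]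
    _ = (toSPlus n p (U, S)).1 := by rw [h2, Matrix.mul_one, hA]

theorem posDef_compression {U₀ : Mat n p} (A : SPlus p n) (h : IsUnit (U₀ᵀ * A.1 * U₀)) :
    (U₀ᵀ * A.1 * U₀).PosDef := by
  have := A.2.1.conjTranspose_mul_mul_same U₀
  rw [Matrix.conjTranspose_eq_transpose_of_trivial] at this
  exact this.posDef_iff_isUnit.2 h

theorem sliceParam_spec {U₀ Y : Mat n p} (h : (U₀ᵀ * Y).PosDef) :
    (sliceParam U₀ Y).PosSemidef ∧ (sliceParam U₀ Y).rank = p ∧ sliceParam U₀ Y * U₀ = Y := by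
  have h1 : sliceParam U₀ Y * U₀ = Y := by
    have e : Yᵀ * U₀ = U₀ᵀ * Y := by
      have := (posDef_iff.1 h).1
      rwa [Matrix.transpose_mul, Matrix.transpose_transpose] at this
    rw [sliceParam, Matrix.mul_assoc, e, Matrix.mul_assoc,
      Matrix.nonsing_inv_mul _ ((Matrix.isUnit_iff_isUnit_det _).1 h.isUnit), Matrix.mul_one]
  refine ⟨?_, le_antisymm ?_ ?_, h1⟩
  · have := h.inv.posSemidef.mul_mul_conjTranspose_same Y
    rwa [Matrix.conjTranspose_eq_transpose_of_trivial] at this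
  · exact (Matrix.rank_mul_le_right _ _).trans (Matrix.rank_le_height _)
  · calc p = (U₀ᵀ * Y).rank := by rw [Matrix.rank_of_isUnit _ h.isUnit, Fintype.card_fin]
      _ ≤ Y.rank := Matrix.rank_mul_le_right _ _
      _ = (sliceParam U₀ Y * U₀).rank := by rw [h1]
      _ ≤ (sliceParam U₀ Y).rank := Matrix.rank_mul_le_left _ _

theorem contDiffAt_sliceParam (U₀ : Mat n p) {Y : Arr n p} (h : IsUnit (U₀ᵀ * Matrix.of Y)) :
    ContDiffAt ℝ ∞ (fun Y : Arr n p ↦ entries (sliceParam U₀ (Matrix.of Y))) Y :=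
  contDiffAt_entries_mul (contDiffAt_entries_mul (contDiffAt_arr Y)
    (contDiffAt_entries_inv (contDiffAt_entries_mul (contDiffAt_entries_const _)
      (contDiffAt_arr Y)) h)) (contDiffAt_entries_transpose (contDiffAt_arr Y))

/-- The factor `S` of `A = U S Uᵀ` is determined by `A` and `U`. -/
theorem compression_eq (x : Stiefel n p × PD p) :
    x.1.1ᵀ * (toSPlus n p x).1 * x.1.1 = x.2.1 := by
  have e : x.1.1ᵀ * (toSPlus n p x).1 * x.1.1 = (x.1.1ᵀ * x.1.1) * x.2.1 * (x.1.1ᵀ * x.1.1) := by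
    simp only [toSPlus, Matrix.mul_assoc]
  rw [e, x.1.2, Matrix.one_mul, Matrix.mul_one]

/-- The slice chart `A ↦ A U₀` of `S⁺(p,n)`, defined where `U₀ᵀ A U₀` is invertible. Its values are
the matrices `Y` with `U₀ᵀ Y` symmetric positive definite. -/
noncomputable def sliceChartSPlus (U₀ : Stiefel n p) :
    SliceChart (fun A : SPlus p n ↦ entries (A : Mat n n)) (dimSPlus p n) :=
  SliceChart.ofSubmodule (LinearMap.ker (skewPart U₀.1)) (finrank_ker_skewPart U₀.2)
    {A | IsUnit (U₀.1ᵀ * A.1 * U₀.1)} Set.univ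
    -- invertibility is implied by positivity, but makes the smoothness of `sliceParam` immediate
    ((fun Y : Arr n p ↦ entries (U₀.1ᵀ * Matrix.of Y)) ⁻¹' {A | IsPositive (Matrix.of A)} ∩
      {Y | IsUnit (U₀.1ᵀ * Matrix.of Y)})
    (fun A ↦ entries (Matrix.of A * U₀.1))
    (fun Y ↦ entries (sliceParam U₀.1 (Matrix.of Y)))
    (isOpen_setOf_isUnit (by fun_prop)) isOpen_univ
    ((isOpen_isPositive.preimage (by
      change Continuous fun Y : Arr n p ↦ U₀.1ᵀ * Matrix.of Y
      fun_prop)).inter (isOpen_setOf_isUnit (by fun_prop)))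
    (fun A _ ↦ (contDiffAt_entries_mul (contDiffAt_arr A)
      (contDiffAt_entries_const _)).contDiffWithinAt)
    (fun Y hY ↦ (contDiffAt_sliceParam U₀.1 hY.2).contDiffWithinAt)
    (fun _ _ ↦ trivial)
    (fun A hA ↦ entries_mem_ker_skewPart.2 (by
      rw [← Matrix.mul_assoc]; exact (posDef_iff.1 (posDef_compression A hA)).1))
    (fun A hA ↦ by
      change IsPositive (U₀.1ᵀ * (A.1 * U₀.1)) ∧ IsUnit (U₀.1ᵀ * (A.1 * U₀.1))
      rw [← Matrix.mul_assoc]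
      exact ⟨(posDef_iff.1 (posDef_compression A hA)).2, hA⟩)
    (fun A hA ↦ congrArg entries (sliceParam_mul U₀.1 A hA))
    (fun Y hY hY' ↦ by
      have hP : (U₀.1ᵀ * Matrix.of Y).PosDef :=
        posDef_iff.2 ⟨entries_mem_ker_skewPart.1 hY, hY'.1⟩
      obtain ⟨h1, h2, h3⟩ := sliceParam_spec hP
      refine ⟨⟨_, h1, h2⟩, ?_, rfl, congrArg entries h3⟩
      change IsUnit (U₀.1ᵀ * sliceParam U₀.1 (Matrix.of Y) * U₀.1)
      rw [Matrix.mul_assoc, h3]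
      exact hP.isUnit)

/-- A chosen representative `(U, S)` of `A = U S Uᵀ`. -/
noncomputable def SPlus.rep (A : SPlus p n) : Stiefel n p × PD p := (toSPlus_surjective A).choose

theorem SPlus.toSPlus_rep (A : SPlus p n) : toSPlus n p A.rep = A :=
  (toSPlus_surjective A).choose_spec

/-- The slice atlas of `S⁺(p,n)`: around `A = U S Uᵀ`, the chart `B ↦ B U`. -/
noncomputable def atlasSPlus (p n : ℕ) :
    SliceAtlas (fun A : SPlus p n ↦ entries (A : Mat n n)) (dimSPlus p n) where
  isEmbedding := isEmbedding_entries_subtype n n _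
  chartAt A := sliceChartSPlus A.rep.1
  mem_source A := by
    change IsUnit (A.rep.1.1ᵀ * A.1 * A.rep.1.1)
    have h := compression_eq A.rep
    rw [A.toSPlus_rep] at h
    rw [h]
    exact A.rep.2.2.isUnit

end FixedRank

/-! ### The quotient by `O(p)` -/

section Quotient

variable {n p : ℕ}

instance compactSpace_stiefel : CompactSpace (Stiefel n p) := by
  have hcl : IsClosed {A : Arr n p | (Matrix.of A)ᵀ * Matrix.of A = 1} :=
    isClosed_eq (by fun_prop) continuous_const
  have hbd : Bornology.IsBounded {A : Arr n p | (Matrix.of A)ᵀ * Matrix.of A = 1} := by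
    refine (Metric.isBounded_closedBall (x := (0 : Arr n p)) (r := 1)).subset fun A hA ↦ ?_
    rw [mem_closedBall_zero_iff, pi_norm_le_iff_of_nonneg zero_le_one]
    intro i
    rw [pi_norm_le_iff_of_nonneg zero_le_one]
    intro j
    have h1 : ∑ k, A k j * A k j = 1 := by
      have := congrFun (congrFun hA j) j
      rwa [Matrix.mul_apply, Matrix.one_apply_eq] at this
    have h2 : A i j * A i j ≤ ∑ k, A k j * A k j :=
      Finset.single_le_sum (f := fun k ↦ A k j * A k j) (fun k _ ↦ mul_self_nonneg _)
        (Finset.mem_univ i)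
    rw [Real.norm_eq_abs, abs_le_one_iff_mul_self_le_one]
    linarith
  exact isCompact_iff_compactSpace.1 (Metric.isCompact_of_isClosed_isBounded hcl hbd)

theorem continuous_toSPlus : Continuous (toSPlus n p) := by
  unfold toSPlus
  fun_prop

/-- The equation `U (Uᵀ A U) Uᵀ = A` says that the columns of `U` span the range of `A`; then
`(U, Uᵀ A U)` is a representative of `A`. -/
theorem posDef_of_compression_eq {U : Stiefel n p} {A : SPlus p n}
    (h : U.1 * (U.1ᵀ * A.1 * U.1) * U.1ᵀ = A.1) : (U.1ᵀ * A.1 * U.1).PosDef := by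
  obtain ⟨⟨V, S⟩, rfl⟩ := toSPlus_surjective A
  have hA : (toSPlus n p (V, S)).1 = V.1 * S.1 * V.1ᵀ := rfl
  have h1 : U.1 * (U.1ᵀ * V.1) = V.1 := by
    have e : V.1 = (toSPlus n p (V, S)).1 * (V.1 * S.1⁻¹) := by
      rw [hA, Matrix.mul_assoc, ← Matrix.mul_assoc V.1ᵀ, V.2, Matrix.one_mul,
        Matrix.mul_assoc, S.mul_inv, Matrix.mul_one]
    rw [e, ← h]
    simp only [Matrix.mul_assoc]
    rw [← Matrix.mul_assoc U.1ᵀ U.1, U.2, Matrix.one_mul]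
  have hQ : (U.1ᵀ * V.1) * (U.1ᵀ * V.1)ᵀ = 1 := by
    rw [mul_eq_one_comm, Matrix.transpose_mul, Matrix.transpose_transpose, Matrix.mul_assoc, h1,
      V.2]
  let Q : O p := ⟨(U.1ᵀ * V.1)ᵀ, (Matrix.mem_orthogonalGroup_iff' (Fin p) ℝ).2 hQ⟩
  have e : U.1ᵀ * (toSPlus n p (V, S)).1 * U.1 = (MulOpposite.op Q • S).1 := by
    change _ = ((U.1ᵀ * V.1)ᵀ)ᵀ * S.1 * (U.1ᵀ * V.1)ᵀ
    rw [hA]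
    simp only [Matrix.transpose_mul, Matrix.transpose_transpose, Matrix.mul_assoc]
  rw [e]
  exact (MulOpposite.op Q • S).2

/-- The pairs `(U, A)` with `U (Uᵀ A U) Uᵀ = A` form a closed set `K`, on which `(U, A) ↦ (U, Uᵀ A
U)` is continuous. A closed set of representatives is thus a closed set of such pairs, and its image
in `S⁺(p,n)` is a projection along the compact Stiefel manifold. -/
theorem isClosedMap_toSPlus : IsClosedMap (toSPlus n p) := by
  intro C hC
  let K : Set (Stiefel n p × SPlus p n) :=
    {z | z.1.1 * (z.1.1ᵀ * z.2.1 * z.1.1) * z.1.1ᵀ = z.2.1}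
  have hK : IsClosed K := isClosed_eq (by fun_prop) (by fun_prop)
  let h : K → Stiefel n p × PD p := fun z ↦ (z.1.1, ⟨_, posDef_of_compression_eq z.2⟩)
  have hh : Continuous h := by
    refine Continuous.prodMk (by fun_prop) (Continuous.subtype_mk ?_ _)
    fun_prop
  have e : toSPlus n p '' C = Prod.snd '' (Subtype.val '' (h ⁻¹' C)) := by
    ext A
    constructor
    · rintro ⟨x, hx, rfl⟩
      have hz : ((x.1, toSPlus n p x) : Stiefel n p × SPlus p n) ∈ K := by
        change x.1.1 * (x.1.1ᵀ * (toSPlus n p x).1 * x.1.1) * x.1.1ᵀ = _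
        rw [compression_eq]
        rfl
      refine ⟨_, ⟨⟨_, hz⟩, ?_, rfl⟩, rfl⟩
      have : h ⟨_, hz⟩ = x := Prod.ext rfl (Subtype.ext (compression_eq x))
      rwa [Set.mem_preimage, this]
    · rintro ⟨_, ⟨z, hz, rfl⟩, rfl⟩
      exact ⟨h z, hz, Subtype.ext z.2⟩
  rw [e]
  exact isClosedMap_snd_of_compactSpace _
    (hK.isClosedEmbedding_subtypeVal.isClosedMap _ (hC.preimage hh))

/-- The homeomorphism of the topological quotient with `S⁺(p,n)` induced by `(U, S) ↦ U S Uᵀ`. -/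
noncomputable def quotientHomeomorph (n p : ℕ) : StructureQuotient n p ≃ₜ SPlus p n :=
  (Equiv.ofBijective
    (Quotient.lift (toSPlus n p) fun x y h ↦ (toSPlus_eq_iff x y).2 (Quotient.sound h))
    ⟨by
      rintro ⟨x⟩ ⟨y⟩ h
      exact (toSPlus_eq_iff x y).1 h, fun A ↦ ⟨toQuotient n p A.rep, A.toSPlus_rep⟩⟩
    ).toHomeomorphOfContinuousClosed (continuous_toSPlus.quotient_lift _) (by
      intro D hD
      have e : toSPlus n p '' (toQuotient n p ⁻¹' D) = Quotient.lift (toSPlus n p)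
          (fun x y h ↦ (toSPlus_eq_iff x y).2 (Quotient.sound h)) '' D := by
        ext A
        constructor
        · rintro ⟨x, hx, rfl⟩
          exact ⟨_, hx, rfl⟩
        · rintro ⟨⟨x⟩, hx, rfl⟩
          exact ⟨x, hx, rfl⟩
      exact e ▸ isClosedMap_toSPlus _ (hD.preimage continuous_quotient_mk'))

/-- The transport of a slice chart along a homeomorphism. -/
def SliceChart.compHomeomorph {X Y E : Type} [TopologicalSpace X] [TopologicalSpace Y]
    [NormedAddCommGroup E] [NormedSpace ℝ E] {ι : X → E} {d : ℕ} (c : SliceChart ι d) (h : Y ≃ₜ X) :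
    SliceChart (fun y ↦ ι (h y)) d where
  source := h ⁻¹' c.source
  target := c.target
  domain := c.domain
  toFun := c.toFun
  invFun := c.invFun
  isOpen_source := c.isOpen_source.preimage h.continuous
  isOpen_target := c.isOpen_target
  isOpen_domain := c.isOpen_domain
  contDiffOn_toFun := c.contDiffOn_toFun
  contDiffOn_invFun := c.contDiffOn_invFun
  mem_domain y hy := c.mem_domain _ hy
  mem_target y hy := c.mem_target _ hy
  left_inv y hy := c.left_inv _ hy
  exists_preimage t ht := by
    obtain ⟨x, hx, h1⟩ := c.exists_preimage t ht
    exact ⟨h.symm x, by simpa using hx, by simpa using h1⟩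

/-- The slice atlas of the quotient, transported from `S⁺(p,n)`. -/
noncomputable def atlasQuotient (n p : ℕ) :
    SliceAtlas (fun q : StructureQuotient n p ↦ entries (quotientHomeomorph n p q : Mat n n))
      (dimSPlus p n) where
  isEmbedding := (atlasSPlus p n).isEmbedding.comp (quotientHomeomorph n p).isEmbedding
  chartAt q := ((atlasSPlus p n).chartAt (quotientHomeomorph n p q)).compHomeomorph
    (quotientHomeomorph n p)
  mem_source q := (atlasSPlus p n).mem_source (quotientHomeomorph n p q)

end Quotient

section Instances

variable {n p : ℕ}

noncomputable instance : ChartedSpace (EuclideanSpace ℝ (Fin (dimStiefel n p))) (Stiefel n p) :=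
  (atlasStiefel n p).chartedSpace

instance : IsManifold (𝓡 (dimStiefel n p)) ∞ (Stiefel n p) := (atlasStiefel n p).isManifold

noncomputable instance : ChartedSpace (EuclideanSpace ℝ (Fin (dimPD p))) (PD p) :=
  (atlasPD p).chartedSpace

instance : IsManifold (𝓡 (dimPD p)) ∞ (PD p) := (atlasPD p).isManifold

noncomputable instance : ChartedSpace (EuclideanSpace ℝ (Fin (dimSPlus p n))) (SPlus p n) :=
  (atlasSPlus p n).chartedSpace

instance : IsManifold (𝓡 (dimSPlus p n)) ∞ (SPlus p n) := (atlasSPlus p n).isManifold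

noncomputable instance :
    ChartedSpace (EuclideanSpace ℝ (Fin (dimSPlus p n))) (StructureQuotient n p) :=
  (atlasQuotient n p).chartedSpace

instance : IsManifold (𝓡 (dimSPlus p n)) ∞ (StructureQuotient n p) :=
  (atlasQuotient n p).isManifold

end Instances

/-! ### Tangent spaces, the vertical space, and the submersion -/

/-- The model with corners of the structure space `V_{n,p} × P_p`. -/
local notation "𝓘S" n:max p:max => ModelWithCorners.prod (𝓡 (dimStiefel n p)) (𝓡 (dimPD p))

section Submersion

variable {n p : ℕ}

theorem contMDiff_stiefel_entries :
    ContMDiff (𝓘S n p) 𝓘(ℝ, Arr n p) ∞ fun x : Stiefel n p × PD p ↦ entries x.1.1 :=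
  (atlasStiefel n p).contMDiff.comp contMDiff_fst

theorem contMDiff_pd_entries :
    ContMDiff (𝓘S n p) 𝓘(ℝ, Arr p p) ∞ fun x : Stiefel n p × PD p ↦ entries x.2.1 :=
  (atlasPD p).contMDiff.comp contMDiff_snd

theorem contMDiff_inclusion :
    ContMDiff (𝓘S n p) 𝓘(ℝ, Arr n p × Arr p p) ∞ (inclusion n p) :=
  contMDiff_stiefel_entries.prodMk_space contMDiff_pd_entries

theorem mdifferentiableAt_inclusion (x : Stiefel n p × PD p) :
    MDifferentiableAt (𝓘S n p) 𝓘(ℝ, Arr n p × Arr p p) (inclusion n p) x :=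
  contMDiff_inclusion.mdifferentiableAt (by simp)

theorem hasMatDeriv_fst (x : Stiefel n p × PD p) :
    HasMatDeriv (𝓘S n p) (fun y : Stiefel n p × PD p ↦ y.1.1) x fun v ↦ (tangentPair x v).1 := by
  refine ⟨contMDiff_stiefel_entries.mdifferentiableAt (by simp), fun v ↦ ?_⟩
  have h := HasMFDerivAt.comp x (g := ContinuousLinearMap.fst ℝ (Arr n p) (Arr p p))
    (ContinuousLinearMap.hasMFDerivAt _) (mdifferentiableAt_inclusion x).hasMFDerivAt
  exact DFunLike.congr_fun h.mfderiv v

theorem hasMatDeriv_snd (x : Stiefel n p × PD p) :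
    HasMatDeriv (𝓘S n p) (fun y : Stiefel n p × PD p ↦ y.2.1) x fun v ↦ (tangentPair x v).2 := by
  refine ⟨contMDiff_pd_entries.mdifferentiableAt (by simp), fun v ↦ ?_⟩
  have h := HasMFDerivAt.comp x (g := ContinuousLinearMap.snd ℝ (Arr n p) (Arr p p))
    (ContinuousLinearMap.hasMFDerivAt _) (mdifferentiableAt_inclusion x).hasMFDerivAt
  exact DFunLike.congr_fun h.mfderiv v

theorem tangentPair_injective (x : Stiefel n p × PD p) : Function.Injective (tangentPair x) := by
  rw [injective_iff_map_eq_zero]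
  rintro v hv
  have h1 := HasMFDerivAt.comp x (g := fun U : Stiefel n p ↦ entries U.1)
    ((atlasStiefel n p).contMDiff.mdifferentiableAt (by simp)).hasMFDerivAt
    (hasMFDerivAt_fst (I := 𝓡 (dimStiefel n p)) (I' := 𝓡 (dimPD p)) x)
  have h2 := HasMFDerivAt.comp x (g := fun S : PD p ↦ entries S.1)
    ((atlasPD p).contMDiff.mdifferentiableAt (by simp)).hasMFDerivAt
    (hasMFDerivAt_snd (I := 𝓡 (dimStiefel n p)) (I' := 𝓡 (dimPD p)) x)
  have e1 : mfderiv (𝓡 (dimStiefel n p)) 𝓘(ℝ, Arr n p) (fun U : Stiefel n p ↦ entries U.1) x.1 v.1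
      = 0 := by
    refine (DFunLike.congr_fun h1.mfderiv v).symm.trans (((hasMatDeriv_fst x).2 v).trans ?_)
    exact congrArg (fun X : Mat n p × Mat p p ↦ entries X.1) hv
  have e2 : mfderiv (𝓡 (dimPD p)) 𝓘(ℝ, Arr p p) (fun S : PD p ↦ entries S.1) x.2 v.2
      = 0 := by
    refine (DFunLike.congr_fun h2.mfderiv v).symm.trans (((hasMatDeriv_snd x).2 v).trans ?_)
    exact congrArg (fun X : Mat n p × Mat p p ↦ entries X.2) hv
  exact Prod.ext
    ((injective_iff_map_eq_zero _).1
      ((atlasStiefel n p).isEmbeddingSmooth.injective_mfderiv x.1) _ e1)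
    ((injective_iff_map_eq_zero _).1 ((atlasPD p).isEmbeddingSmooth.injective_mfderiv x.2) _ e2)

theorem finrank_tangentSpace (x : Stiefel n p × PD p) :
    Module.finrank ℝ (TangentSpace (𝓘S n p) x) = dimStiefel n p + dimPD p := by
  change Module.finrank ℝ (EuclideanSpace ℝ (Fin (dimStiefel n p)) ×
    EuclideanSpace ℝ (Fin (dimPD p))) = _
  rw [Module.finrank_prod, finrank_euclideanSpace_fin, finrank_euclideanSpace_fin]

instance (x : Stiefel n p × PD p) : FiniteDimensional ℝ (TangentSpace (𝓘S n p) x) :=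
  inferInstanceAs (FiniteDimensional ℝ (EuclideanSpace ℝ (Fin (dimStiefel n p)) ×
    EuclideanSpace ℝ (Fin (dimPD p))))

/-- The tangent space of the structure space at `(U, S)` consists of the pairs `(Ξ, D)` with `Uᵀ Ξ`
skew-symmetric and `D` symmetric. One inclusion follows by differentiating `Uᵀ U = 1` and `Sᵀ = S`,
the other one from the equality of dimensions. -/
theorem mem_range_tangentPair (x : Stiefel n p × PD p) (X : Mat n p × Mat p p) :
    X ∈ LinearMap.range (tangentPair x) ↔ (x.1.1ᵀ * X.1)ᵀ = -(x.1.1ᵀ * X.1) ∧ X.2ᵀ = X.2 := by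
  let e : (Arr n p × Arr p p) ≃ₗ[ℝ] Mat n p × Mat p p :=
    (Matrix.ofLinearEquiv ℝ).prodCongr (Matrix.ofLinearEquiv ℝ)
  let T : Submodule ℝ (Mat n p × Mat p p) :=
    ((LinearMap.ker (symPart x.1.1)).prod (symSubmodule p)).map e.toLinearMap
  have hT : ∀ Y, Y ∈ T ↔ (x.1.1ᵀ * Y.1)ᵀ = -(x.1.1ᵀ * Y.1) ∧ Y.2ᵀ = Y.2 := fun Y ↦ by
    rw [← entries_mem_ker_symPart, ← entries_mem_symSubmodule]
    constructor
    · rintro ⟨Z, hZ, rfl⟩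
      exact hZ
    · intro h
      exact ⟨(entries Y.1, entries Y.2), h, rfl⟩
  have hle : LinearMap.range (tangentPair x) ≤ T := by
    rintro _ ⟨v, rfl⟩
    rw [hT]
    constructor
    · have h1 := (hasMatDeriv_fst x).transpose.mul (hasMatDeriv_fst x)
      have h2 : HasMatDeriv (𝓘S n p) (fun y : Stiefel n p × PD p ↦ y.1.1ᵀ * y.1.1) x 0 := by
        have : (fun y : Stiefel n p × PD p ↦ y.1.1ᵀ * y.1.1) = fun _ ↦ 1 := funext fun y ↦ y.1.2
        rw [this]
        exact hasMatDeriv_const _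
      have h3 := congrFun (h1.unique h2) v
      rw [Matrix.transpose_mul, Matrix.transpose_transpose]
      exact eq_neg_of_add_eq_zero_left h3
    · have h2 : HasMatDeriv (𝓘S n p) (fun y : Stiefel n p × PD p ↦ y.2.1ᵀ) x
          fun v ↦ (tangentPair x v).2 := by
        have : (fun y : Stiefel n p × PD p ↦ y.2.1ᵀ) = fun y ↦ y.2.1 :=
          funext fun y ↦ y.2.transpose_eq
        rw [this]
        exact hasMatDeriv_snd x
      exact congrFun ((hasMatDeriv_snd x).transpose.unique h2) v
  have hfin : Module.finrank ℝ (LinearMap.range (tangentPair x)) = Module.finrank ℝ T := by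
    rw [LinearMap.finrank_range_of_inj (tangentPair_injective x), finrank_tangentSpace,
      LinearEquiv.finrank_map_eq, ← finrank_ker_symPart x.1.2, dimPD, ← finrank_symSubmodule,
      ← Module.finrank_prod]
    let e' : (LinearMap.ker (symPart x.1.1)).prod (symSubmodule p) ≃ₗ[ℝ]
        LinearMap.ker (symPart x.1.1) × symSubmodule p :=
      { toFun := fun z ↦ (⟨z.1.1, z.2.1⟩, ⟨z.1.2, z.2.2⟩)
        invFun := fun w ↦ ⟨(w.1, w.2), w.1.2, w.2.2⟩
        map_add' := fun _ _ ↦ rfl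
        map_smul' := fun _ _ ↦ rfl }
    exact e'.finrank_eq.symm
  rw [Submodule.eq_of_le_of_finrank_eq hle hfin, hT]

/-- The differential of `(U, S) ↦ U S Uᵀ` at `x = (U, S)`, on pairs of matrices. -/
def dproj (x : Stiefel n p × PD p) (X : Mat n p × Mat p p) : Mat n n :=
  X.1 * x.2.1 * x.1.1ᵀ + x.1.1 * X.2 * x.1.1ᵀ + x.1.1 * x.2.1 * X.1ᵀ

theorem hasMatDeriv_toSPlus (x : Stiefel n p × PD p) :
    HasMatDeriv (𝓘S n p) (fun y ↦ (toSPlus n p y).1) x fun v ↦ dproj x (tangentPair x v) := by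
  have h := ((hasMatDeriv_fst x).mul (hasMatDeriv_snd x)).mul (hasMatDeriv_fst x).transpose
  refine ⟨h.1, fun v ↦ (h.2 v).trans (congrArg entries ?_)⟩
  simp only [dproj, Matrix.add_mul]

theorem contMDiff_toSPlus : ContMDiff (𝓘S n p) (𝓡 (dimSPlus p n)) ∞ (toSPlus n p) := fun x ↦ by
  refine (atlasSPlus p n).contMDiffAt_of_comp ?_
  have h : ContDiffAt ℝ ∞ (fun z : Arr n p × Arr p p ↦
      entries (Matrix.of z.1 * Matrix.of z.2 * (Matrix.of z.1)ᵀ)) (inclusion n p x) :=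
    contDiffAt_entries_mul (contDiffAt_entries_mul contDiffAt_fst contDiffAt_snd)
      (contDiffAt_entries_transpose contDiffAt_fst)
  exact ContMDiffAt.comp x (f := inclusion n p) h.contMDiffAt contMDiff_inclusion.contMDiffAt

/-- A tangent vector of `S⁺(p,n)`, read as a matrix. -/
noncomputable def tangentMat (A : SPlus p n) (v : TangentSpace (𝓡 (dimSPlus p n)) A) : Mat n n :=
  Matrix.of (mfderiv (𝓡 (dimSPlus p n)) 𝓘(ℝ, Arr n n) (fun B : SPlus p n ↦ entries B.1) A v)

theorem tangentMat_eq_zero {A : SPlus p n} {v : TangentSpace (𝓡 (dimSPlus p n)) A} :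
    tangentMat A v = 0 ↔ v = 0 := by
  constructor
  · intro h
    exact (injective_iff_map_eq_zero _).1
      ((atlasSPlus p n).isEmbeddingSmooth.injective_mfderiv A) v h
  · rintro rfl
    exact map_zero (mfderiv (𝓡 (dimSPlus p n)) 𝓘(ℝ, Arr n n) (fun B : SPlus p n ↦ entries B.1) A)

theorem hasMatDeriv_coe (A : SPlus p n) :
    HasMatDeriv (𝓡 (dimSPlus p n)) (fun B : SPlus p n ↦ B.1) A (tangentMat A) :=
  ⟨(atlasSPlus p n).contMDiff.mdifferentiableAt (by simp), fun _ ↦ rfl⟩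

/-- The chain rule: the matrix differential of a map to `S⁺(p,n)` is the matrix of its differential.
-/
theorem hasMatDeriv_comp {E H M : Type} [NormedAddCommGroup E] [NormedSpace ℝ E]
    [TopologicalSpace H] [TopologicalSpace M] [ChartedSpace H M] {I : ModelWithCorners ℝ E H}
    {f : M → SPlus p n} {x : M} (hf : MDifferentiableAt I (𝓡 (dimSPlus p n)) f x) :
    HasMatDeriv I (fun y ↦ (f y).1) x
      fun v ↦ tangentMat (f x) (mfderiv I (𝓡 (dimSPlus p n)) f x v) := by
  have h := HasMFDerivAt.comp x (hasMatDeriv_coe (f x)).1.hasMFDerivAt hf.hasMFDerivAt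
  exact ⟨h.mdifferentiableAt, fun v ↦ DFunLike.congr_fun h.mfderiv v⟩

theorem tangentMat_mfderiv_toSPlus (x : Stiefel n p × PD p) (v : TangentSpace (𝓘S n p) x) :
    tangentMat (toSPlus n p x) (mfderiv (𝓘S n p) (𝓡 (dimSPlus p n)) (toSPlus n p) x v) =
      dproj x (tangentPair x v) :=
  congrFun ((hasMatDeriv_comp (contMDiff_toSPlus.mdifferentiableAt (by simp))).unique
    (hasMatDeriv_toSPlus x)) v

/-- Multiplying `dπ(Ξ, D) = 0` by `Uᵀ` and `U` gives `D = S Ω - Ω S` with `Ω = Uᵀ Ξ`; multiplying by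
`U` alone then gives `(Ξ - U Ω) S = 0`. -/
theorem dproj_eq_zero_iff (x : Stiefel n p × PD p) {X : Mat n p × Mat p p}
    (h1 : (x.1.1ᵀ * X.1)ᵀ = -(x.1.1ᵀ * X.1)) :
    dproj x X = 0 ↔ X ∈ verticalSpace x.1.1 x.2.1 := by
  obtain ⟨⟨U, hU⟩, S⟩ := x
  obtain ⟨Ξ, D⟩ := X
  have hS := S.transpose_eq
  simp only [dproj] at h1 ⊢
  constructor
  · intro h
    have h2 : Ξ * S.1 + U * D + U * S.1 * (Ξᵀ * U) = 0 := by
      have := congrArg (fun Z : Mat n n ↦ Z * U) h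
      simpa only [Matrix.add_mul, Matrix.mul_assoc, hU, Matrix.mul_one, Matrix.zero_mul] using this
    have hΞU : Ξᵀ * U = -(Uᵀ * Ξ) := by
      rw [← h1, Matrix.transpose_mul, Matrix.transpose_transpose]
    have h3 : Uᵀ * Ξ * S.1 + D - S.1 * (Uᵀ * Ξ) = 0 := by
      have := congrArg (fun Z : Mat n p ↦ Uᵀ * Z) h2
      simp only [Matrix.mul_add, ← Matrix.mul_assoc, hU, Matrix.one_mul, Matrix.mul_zero] at this
      rw [Matrix.mul_assoc S.1, hΞU, Matrix.mul_neg, ← sub_eq_add_neg] at this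
      exact this
    have hD : D = S.1 * (Uᵀ * Ξ) - Uᵀ * Ξ * S.1 := by
      rw [← sub_eq_zero, ← h3]; abel
    refine ⟨Uᵀ * Ξ, h1, Prod.ext ?_ hD⟩
    have h4 : (Ξ - U * (Uᵀ * Ξ)) * S.1 = 0 := by
      rw [hΞU, hD] at h2
      rw [Matrix.sub_mul, ← h2]
      simp only [Matrix.mul_sub, Matrix.mul_neg, Matrix.mul_assoc]
      abel
    have h5 := congrArg (fun Z : Mat n p ↦ Z * S.1⁻¹) h4
    simp only [Matrix.mul_assoc, S.mul_inv, Matrix.mul_one, Matrix.zero_mul] at h5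
    exact sub_eq_zero.1 h5
  · rintro ⟨Ω, hΩ, he⟩
    obtain ⟨rfl, rfl⟩ := Prod.mk.inj he
    rw [Matrix.transpose_mul, hΩ]
    simp only [Matrix.mul_sub, Matrix.sub_mul, Matrix.mul_neg, Matrix.neg_mul, Matrix.mul_assoc]
    abel

theorem mfderiv_toSPlus_eq_zero_iff (x : Stiefel n p × PD p) (v : TangentSpace (𝓘S n p) x) :
    mfderiv (𝓘S n p) (𝓡 (dimSPlus p n)) (toSPlus n p) x v = 0 ↔
      tangentPair x v ∈ verticalSpace x.1.1 x.2.1 := by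
  rw [← tangentMat_eq_zero, tangentMat_mfderiv_toSPlus]
  exact dproj_eq_zero_iff x ((mem_range_tangentPair x _).1 ⟨v, rfl⟩).1

theorem finrank_verticalSpace_le (U : Mat n p) (S : Mat p p) :
    Module.finrank ℝ (verticalSpace U S) ≤ p * (p - 1) / 2 := by
  let f : Mat p p →ₗ[ℝ] Mat n p × Mat p p :=
    { toFun := fun Ω ↦ (U * Ω, S * Ω - Ω * S)
      map_add' := fun Ω Ω' ↦ by
        simp only [Matrix.mul_add, Matrix.add_mul, Prod.mk_add_mk, Prod.mk.injEq, true_and]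
        abel
      map_smul' := fun c Ω ↦ by simp [smul_sub] }
  have h : verticalSpace U S =
      (skewSubmodule p).map (f ∘ₗ (Matrix.ofLinearEquiv ℝ).toLinearMap) := by
    ext X
    constructor
    · rintro ⟨Ω, hΩ, rfl⟩
      exact ⟨entries Ω, entries_mem_skewSubmodule.2 hΩ, rfl⟩
    · rintro ⟨Ω, hΩ, rfl⟩
      exact ⟨Matrix.of Ω, entries_mem_skewSubmodule.1 hΩ, rfl⟩
  rw [h, ← finrank_skewSubmodule]
  exact Submodule.finrank_map_le _ _

/-- By dimensions: the kernel has dimension at most `p (p - 1) / 2`, which is the difference of the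
dimensions of `V_{n,p} × P_p` and `S⁺(p,n)`. -/
theorem surjective_mfderiv_toSPlus (x : Stiefel n p × PD p) :
    Function.Surjective (mfderiv (𝓘S n p) (𝓡 (dimSPlus p n)) (toSPlus n p) x) := by
  let L : TangentSpace (𝓘S n p) x →ₗ[ℝ] EuclideanSpace ℝ (Fin (dimSPlus p n)) :=
    (mfderiv (𝓘S n p) (𝓡 (dimSPlus p n)) (toSPlus n p) x).toLinearMap
  change Function.Surjective L
  have hker : Module.finrank ℝ (LinearMap.ker L) ≤ p * (p - 1) / 2 := by
    refine le_trans ?_ (finrank_verticalSpace_le x.1.1 x.2.1)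
    refine LinearMap.finrank_le_finrank_of_injective
      (f := (tangentPair x).restrict fun v hv ↦ (mfderiv_toSPlus_eq_zero_iff x v).1 hv) ?_
    exact fun v w h ↦ Subtype.ext (tangentPair_injective x (congrArg Subtype.val h))
  have h := LinearMap.finrank_range_add_finrank_ker L
  rw [finrank_tangentSpace] at h
  rw [← LinearMap.range_eq_top]
  apply Submodule.eq_top_of_finrank_eq
  refine le_antisymm (Submodule.finrank_le _) ?_
  rw [finrank_euclideanSpace_fin]
  have h1 := LinearMap.finrank_range_add_finrank_ker (symPart x.1.1)
  rw [range_symPart x.1.2, finrank_symSubmodule, finrank_arr, finrank_ker_symPart x.1.2] at h1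
  -- the truncated subtraction in `dimStiefel` is harmless: `h1` bounds `p (p + 1) / 2` by `n p`
  simp only [dimStiefel, dimPD, dimSPlus] at *
  omega

/-- The diffeomorphism of the quotient with `S⁺(p,n)` induced by `(U, S) ↦ U S Uᵀ`. -/
noncomputable def quotientDiffeomorph (n p : ℕ) :
    StructureQuotient n p ≃ₘ^∞⟮𝓡 (dimSPlus p n), 𝓡 (dimSPlus p n)⟯ SPlus p n where
  toEquiv := (quotientHomeomorph n p).toEquiv
  contMDiff_toFun q := (atlasSPlus p n).contMDiffAt_of_comp ((atlasQuotient n p).contMDiff q)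
  contMDiff_invFun A := (atlasQuotient n p).contMDiffAt_of_comp (by
    refine ((atlasSPlus p n).contMDiff A).congr_of_eventuallyEq (.of_forall fun B ↦ ?_)
    exact congrArg (fun C : SPlus p n ↦ entries C.1) ((quotientHomeomorph n p).apply_symm_apply B))

theorem isSubmersionSmooth_toQuotient :
    IsSubmersionSmooth (𝓘S n p) (𝓡 (dimSPlus p n)) (toQuotient n p) := by
  have h : ContMDiff (𝓘S n p) (𝓡 (dimSPlus p n)) ∞ (toQuotient n p) := fun x ↦
    (atlasQuotient n p).contMDiffAt_of_comp
      (((atlasSPlus p n).contMDiff.comp contMDiff_toSPlus) x)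
  refine ⟨h, fun x w ↦ ?_⟩
  let e := (quotientDiffeomorph n p).mfderivToContinuousLinearEquiv (by simp) (toQuotient n p x)
  obtain ⟨v, hv⟩ := surjective_mfderiv_toSPlus x (e w)
  refine ⟨v, e.injective ?_⟩
  rw [← hv]
  have hc := mfderiv_comp x ((quotientDiffeomorph n p).contMDiff.mdifferentiableAt (by simp))
    (h.mdifferentiableAt (x := x) (by simp))
  exact (DFunLike.congr_fun hc v).symm

end Submersion

/-! ### The horizontal space, and the pseudoinverse -/

section Decomposition

variable {n p : ℕ}

/-- The square matrix with the columns of `U` and `V` is orthogonal. -/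
theorem complement_projection (hp : p ≤ n) {U : Mat n p} {V : Mat n (n - p)} (hU : Uᵀ * U = 1)
    (hV : Vᵀ * V = 1) (hUV : Uᵀ * V = 0) : U * Uᵀ + V * Vᵀ = 1 := by
  have hVU : Vᵀ * U = 0 := by
    have := congrArg Matrix.transpose hUV
    rwa [Matrix.transpose_mul, Matrix.transpose_transpose, Matrix.transpose_zero] at this
  let e : Fin n ≃ Fin p ⊕ Fin (n - p) :=
    (finCongr (Nat.add_sub_cancel' hp).symm).trans finSumFinEquiv.symm
  let W : Matrix (Fin n) (Fin p ⊕ Fin (n - p)) ℝ := Matrix.fromCols U V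
  have h1 : Wᵀ * W = 1 := by
    rw [Matrix.transpose_fromCols, Matrix.fromRows_mul_fromCols, hU, hV, hUV, hVU,
      Matrix.fromBlocks_one]
  have h2 : W * Wᵀ = 1 := by
    rwa [Matrix.mul_eq_one_comm_of_equiv e]
  rwa [Matrix.transpose_fromCols, Matrix.fromCols_mul_fromRows] at h2

/-- A tangent vector `(Ξ, D)` splits as `(V Vᵀ Ξ, D - (S Ω - Ω S)) + (U Ω, S Ω - Ω S)` with `Ω = Uᵀ
Ξ`. -/
theorem range_tangentPair_eq (hp : p ≤ n) (x : Stiefel n p × PD p) {V : Mat n (n - p)} {R : Mat p p}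
    (hV : Vᵀ * V = 1) (hUV : x.1.1ᵀ * V = 0) (hR : R.PosDef) :
    LinearMap.range (tangentPair x) = horizontalSpace V R ⊔ verticalSpace x.1.1 x.2.1 := by
  have hRt : Rᵀ = R := (posDef_iff.1 hR).1
  have hd := (Matrix.isUnit_iff_isUnit_det _).1 hR.isUnit
  ext ⟨Ξ, D⟩
  rw [mem_range_tangentPair, Submodule.mem_sup]
  constructor
  · rintro ⟨h1, h2⟩
    simp only at h1 h2
    have hE : (D - (x.2.1 * (x.1.1ᵀ * Ξ) - x.1.1ᵀ * Ξ * x.2.1))ᵀ =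
        D - (x.2.1 * (x.1.1ᵀ * Ξ) - x.1.1ᵀ * Ξ * x.2.1) := by
      rw [Matrix.transpose_sub, Matrix.transpose_sub, Matrix.transpose_mul _ x.2.1,
        Matrix.transpose_mul x.2.1, x.2.transpose_eq, h1, h2, Matrix.neg_mul, Matrix.mul_neg]
      abel
    refine ⟨(V * (Vᵀ * Ξ), D - (x.2.1 * (x.1.1ᵀ * Ξ) - x.1.1ᵀ * Ξ * x.2.1)),
      ⟨Vᵀ * Ξ, R⁻¹ * (D - (x.2.1 * (x.1.1ᵀ * Ξ) - x.1.1ᵀ * Ξ * x.2.1)) * R⁻¹, ?_, ?_⟩,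
      (x.1.1 * (x.1.1ᵀ * Ξ), x.2.1 * (x.1.1ᵀ * Ξ) - x.1.1ᵀ * Ξ * x.2.1),
      ⟨x.1.1ᵀ * Ξ, h1, rfl⟩, ?_⟩
    · rw [Matrix.transpose_mul, Matrix.transpose_mul, Matrix.transpose_nonsing_inv, hRt, hE]
      exact (Matrix.mul_assoc _ _ _).symm
    · refine Prod.ext rfl ?_
      generalize D - (x.2.1 * (x.1.1ᵀ * Ξ) - x.1.1ᵀ * Ξ * x.2.1) = D'
      simp only [Matrix.mul_assoc, Matrix.nonsing_inv_mul _ hd, Matrix.mul_one]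
      rw [← Matrix.mul_assoc, Matrix.mul_nonsing_inv _ hd, Matrix.one_mul]
    · refine Prod.ext ?_ (sub_add_cancel _ _)
      change V * (Vᵀ * Ξ) + x.1.1 * (x.1.1ᵀ * Ξ) = Ξ
      rw [← Matrix.mul_assoc, ← Matrix.mul_assoc, ← Matrix.add_mul, add_comm,
        complement_projection hp x.1.2 hV hUV, Matrix.one_mul]
  · rintro ⟨_, ⟨B, D₀, hD, rfl⟩, _, ⟨Ω, hΩ, rfl⟩, he⟩
    obtain ⟨rfl, rfl⟩ := Prod.mk.inj he
    simp only
    constructor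
    · rw [Matrix.mul_add, ← Matrix.mul_assoc, hUV, Matrix.zero_mul, zero_add, ← Matrix.mul_assoc,
        x.1.2, Matrix.one_mul, hΩ]
    · simp only [Matrix.transpose_add, Matrix.transpose_sub, Matrix.transpose_mul, hRt, hD, hΩ,
        x.2.transpose_eq, Matrix.mul_assoc, Matrix.neg_mul, Matrix.mul_neg]
      abel

theorem disjoint_horizontal_vertical {U : Mat n p} {S : Mat p p} {V : Mat n (n - p)} {R : Mat p p}
    (hU : Uᵀ * U = 1) (hUV : Uᵀ * V = 0) :
    Disjoint (horizontalSpace V R) (verticalSpace U S) := by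
  rw [Submodule.disjoint_def]
  rintro _ ⟨B, D₀, -, rfl⟩ ⟨Ω, -, h⟩
  obtain ⟨h1, h2⟩ := Prod.mk.inj h
  have hΩ : Ω = 0 := by
    have := congrArg (fun Z : Mat n p ↦ Uᵀ * Z) h1
    simp only [← Matrix.mul_assoc, hUV, hU, Matrix.zero_mul, Matrix.one_mul] at this
    exact this.symm
  subst hΩ
  rw [h1, h2]
  simp [Prod.ext_iff]

end Decomposition

section Pseudoinverse

variable {n p : ℕ}

theorem IsPseudoinverse.unique {A B C : Mat n n} (hB : IsPseudoinverse A B)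
    (hC : IsPseudoinverse A C) : B = C := by
  have h1 : A * B = A * C := by
    calc A * B = (A * C) * (A * B) := by rw [← Matrix.mul_assoc, hC.mul_mul_left]
      _ = (A * C)ᵀ * (A * B)ᵀ := by rw [hC.symm_left, hB.symm_left]
      _ = (A * B * (A * C))ᵀ := by rw [Matrix.transpose_mul (A * B)]
      _ = A * C := by rw [← Matrix.mul_assoc, hB.mul_mul_left, hC.symm_left]
  have h2 : B * A = C * A := by
    calc B * A = (B * A) * (C * A) := by
          rw [Matrix.mul_assoc, ← Matrix.mul_assoc A, hC.mul_mul_left]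
      _ = (B * A)ᵀ * (C * A)ᵀ := by rw [hC.symm_right, hB.symm_right]
      _ = (C * A * (B * A))ᵀ := by rw [Matrix.transpose_mul (C * A)]
      _ = C * A := by
        rw [Matrix.mul_assoc, ← Matrix.mul_assoc A, hB.mul_mul_left, hC.symm_right]
  rw [← hB.mul_mul_right, h2, Matrix.mul_assoc, h1, ← Matrix.mul_assoc, hC.mul_mul_right]

theorem IsPseudoinverse.symm {A B : Mat n n} (h : IsPseudoinverse A B) : IsPseudoinverse B A :=
  ⟨h.mul_mul_right, h.mul_mul_left, h.symm_right, h.symm_left⟩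

/-- The inverse of a positive definite matrix, in `P_p`. -/
noncomputable def PD.inv (S : PD p) : PD p := ⟨S.1⁻¹, S.2.inv⟩

theorem PD.inv_inv (S : PD p) : S.inv.inv = S :=
  Subtype.ext (Matrix.nonsing_inv_nonsing_inv _ ((Matrix.isUnit_iff_isUnit_det _).1 S.2.isUnit))

theorem toSPlus_mul_toSPlus_inv (U : Stiefel n p) (S : PD p) :
    (toSPlus n p (U, S)).1 * (toSPlus n p (U, S.inv)).1 = U.1 * U.1ᵀ := by
  calc U.1 * S.1 * U.1ᵀ * (U.1 * S.1⁻¹ * U.1ᵀ) = U.1 * (S.1 * (U.1ᵀ * U.1) * S.1⁻¹) * U.1ᵀ := by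
        simp only [Matrix.mul_assoc]
    _ = U.1 * U.1ᵀ := by rw [U.2, Matrix.mul_one, S.mul_inv, Matrix.mul_one]

theorem toSPlus_inv_mul_toSPlus (U : Stiefel n p) (S : PD p) :
    (toSPlus n p (U, S.inv)).1 * (toSPlus n p (U, S)).1 = U.1 * U.1ᵀ := by
  have := toSPlus_mul_toSPlus_inv U S.inv
  rwa [S.inv_inv] at this

theorem projection_mul_toSPlus (U : Stiefel n p) (S : PD p) :
    U.1 * U.1ᵀ * (toSPlus n p (U, S)).1 = (toSPlus n p (U, S)).1 := by
  calc U.1 * U.1ᵀ * (U.1 * S.1 * U.1ᵀ) = U.1 * (U.1ᵀ * U.1) * S.1 * U.1ᵀ := by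
        simp only [Matrix.mul_assoc]
    _ = _ := by rw [U.2, Matrix.mul_one]; rfl

theorem isPseudoinverse_toSPlus (U : Stiefel n p) (S : PD p) :
    IsPseudoinverse (toSPlus n p (U, S)).1 (toSPlus n p (U, S.inv)).1 where
  mul_mul_left := by rw [toSPlus_mul_toSPlus_inv, projection_mul_toSPlus]
  mul_mul_right := by rw [toSPlus_inv_mul_toSPlus, projection_mul_toSPlus]
  symm_left := by
    rw [toSPlus_mul_toSPlus_inv, Matrix.transpose_mul, Matrix.transpose_transpose]
  symm_right := by
    rw [toSPlus_inv_mul_toSPlus, Matrix.transpose_mul, Matrix.transpose_transpose]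

/-- The pseudoinverse `U S⁻¹ Uᵀ` of `A = U S Uᵀ`. -/
noncomputable def SPlus.pinv (A : SPlus p n) : SPlus p n := toSPlus n p (A.rep.1, A.rep.2.inv)

theorem SPlus.isPseudoinverse_pinv (A : SPlus p n) : IsPseudoinverse A.1 A.pinv.1 := by
  have := isPseudoinverse_toSPlus A.rep.1 A.rep.2
  rwa [Prod.mk.eta, A.toSPlus_rep] at this

theorem pinv_toSPlus (U : Stiefel n p) (S : PD p) :
    (toSPlus n p (U, S)).pinv = toSPlus n p (U, S.inv) :=
  Subtype.ext ((SPlus.isPseudoinverse_pinv _).unique (isPseudoinverse_toSPlus U S))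

theorem SPlus.pinv_pinv (A : SPlus p n) : A.pinv.pinv = A :=
  Subtype.ext (A.pinv.isPseudoinverse_pinv.unique A.isPseudoinverse_pinv.symm)

/-- The expression `A U₀ H⁻¹ (U₀ᵀ A U₀) H⁻¹ U₀ᵀ A`, where `H = U₀ᵀ A² U₀`. It is rational in `A` for
fixed `U₀`, and it is the pseudoinverse of `A` where `H` is invertible. -/
noncomputable def pinvFormula (U₀ : Mat n p) (A : Mat n n) : Mat n n :=
  A * U₀ * (U₀ᵀ * (A * A) * U₀)⁻¹ * (U₀ᵀ * A * U₀) * (U₀ᵀ * (A * A) * U₀)⁻¹ * (U₀ᵀ * A)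

theorem pinvFormula_eq {U₀ : Mat n p} (A : SPlus p n) (h : IsUnit (U₀ᵀ * (A.1 * A.1) * U₀)) :
    pinvFormula U₀ A.1 = A.pinv.1 := by
  obtain ⟨⟨U, S⟩, rfl⟩ := toSPlus_surjective A
  rw [pinv_toSPlus]
  have hd := (Matrix.isUnit_iff_isUnit_det _).1 h
  have hA : (toSPlus n p (U, S)).1 = U.1 * S.1 * U.1ᵀ := rfl
  have hAA : U₀ᵀ * ((toSPlus n p (U, S)).1 * (toSPlus n p (U, S)).1) * U₀ =
      (U₀ᵀ * U.1) * (S.1 * S.1 * (U.1ᵀ * U₀)) := by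
    calc _ = U₀ᵀ * U.1 * S.1 * (U.1ᵀ * U.1) * S.1 * U.1ᵀ * U₀ := by
          rw [hA]; simp only [Matrix.mul_assoc]
      _ = _ := by rw [U.2, Matrix.mul_one]; simp only [Matrix.mul_assoc]
  set H := U₀ᵀ * ((toSPlus n p (U, S)).1 * (toSPlus n p (U, S)).1) * U₀ with hH
  have hHt : (H⁻¹)ᵀ = H⁻¹ := by
    rw [Matrix.transpose_nonsing_inv, hH]
    simp only [Matrix.transpose_mul, Matrix.transpose_transpose, SPlus.transpose_eq,
      Matrix.mul_assoc]
  -- `U₀ᵀ U` is invertible, so that the one-sided inverse is two-sided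
  have h1 : S.1 * S.1 * (U.1ᵀ * U₀) * H⁻¹ * (U₀ᵀ * U.1) = 1 := by
    rw [mul_eq_one_comm, ← Matrix.mul_assoc, ← hAA]
    exact Matrix.mul_nonsing_inv _ hd
  have h2 : S.1 * (U.1ᵀ * U₀) * H⁻¹ * (U₀ᵀ * U.1) = S.1⁻¹ := by
    have := congrArg (fun Z : Mat p p ↦ S.1⁻¹ * Z) h1
    simp only [← Matrix.mul_assoc, S.inv_mul, Matrix.one_mul, Matrix.mul_one] at this
    simpa only [← Matrix.mul_assoc] using this
  have h3 : (U.1ᵀ * U₀) * H⁻¹ * (U₀ᵀ * U.1) * S.1 = S.1⁻¹ := by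
    have := congrArg Matrix.transpose h2
    rw [Matrix.transpose_mul, Matrix.transpose_mul, Matrix.transpose_mul, Matrix.transpose_mul,
      Matrix.transpose_mul, hHt, Matrix.transpose_transpose, Matrix.transpose_transpose,
      Matrix.transpose_nonsing_inv, S.transpose_eq] at this
    rw [← this]
    simp only [Matrix.mul_assoc]
  calc pinvFormula U₀ (toSPlus n p (U, S)).1
      = U.1 * (S.1 * (U.1ᵀ * U₀) * H⁻¹ * (U₀ᵀ * U.1)) * S.1 *
        ((U.1ᵀ * U₀) * H⁻¹ * (U₀ᵀ * U.1) * S.1) * U.1ᵀ := by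
        rw [pinvFormula, ← hH, hA]
        simp only [Matrix.mul_assoc]
    _ = U.1 * (S.1⁻¹ * S.1) * S.1⁻¹ * U.1ᵀ := by
        rw [h2, h3, Matrix.mul_assoc U.1]
    _ = (toSPlus n p (U, S.inv)).1 := by rw [S.inv_mul, Matrix.mul_one]; rfl

theorem contDiffAt_pinvFormula {U₀ : Mat n p} {A : Arr n n}
    (h : IsUnit (U₀ᵀ * (Matrix.of A * Matrix.of A) * U₀)) :
    ContDiffAt ℝ ∞ (fun A : Arr n n ↦ entries (pinvFormula U₀ (Matrix.of A))) A := by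
  have hA := contDiffAt_arr A
  have hc : ContDiffAt ℝ ∞ (fun _ : Arr n n ↦ entries U₀) A := contDiffAt_const
  have hc' : ContDiffAt ℝ ∞ (fun _ : Arr n n ↦ entries U₀ᵀ) A := contDiffAt_const
  have hi := contDiffAt_entries_inv (contDiffAt_entries_mul (contDiffAt_entries_mul hc'
    (contDiffAt_entries_mul hA hA)) hc) h
  exact contDiffAt_entries_mul (contDiffAt_entries_mul (contDiffAt_entries_mul
    (contDiffAt_entries_mul (contDiffAt_entries_mul hA hc) hi)
    (contDiffAt_entries_mul (contDiffAt_entries_mul hc' hA) hc)) hi) (contDiffAt_entries_mul hc' hA)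

theorem contMDiff_pinv :
    ContMDiff (𝓡 (dimSPlus p n)) (𝓡 (dimSPlus p n)) ∞ (SPlus.pinv : SPlus p n → SPlus p n) := by
  intro A
  refine (atlasSPlus p n).contMDiffAt_of_comp ?_
  have hU : IsUnit (A.rep.1.1ᵀ * (A.1 * A.1) * A.rep.1.1) := by
    have h1 : A.1 = A.rep.1.1 * A.rep.2.1 * A.rep.1.1ᵀ := congrArg Subtype.val A.toSPlus_rep.symm
    have h2 : A.rep.1.1ᵀ * (A.1 * A.1) * A.rep.1.1 = A.rep.2.1 * A.rep.2.1 := by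
      calc _ = A.rep.1.1ᵀ * ((A.rep.1.1 * A.rep.2.1 * A.rep.1.1ᵀ) *
            (A.rep.1.1 * A.rep.2.1 * A.rep.1.1ᵀ)) * A.rep.1.1 := by rw [← h1]
        _ = (A.rep.1.1ᵀ * A.rep.1.1) * A.rep.2.1 * (A.rep.1.1ᵀ * A.rep.1.1) * A.rep.2.1 *
            (A.rep.1.1ᵀ * A.rep.1.1) := by simp only [Matrix.mul_assoc]
        _ = _ := by simp only [A.rep.1.2, Matrix.one_mul, Matrix.mul_one]
    rw [h2]
    exact A.rep.2.2.isUnit.mul A.rep.2.2.isUnit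
  refine (ContMDiffAt.comp A (f := fun B : SPlus p n ↦ entries B.1)
    (contDiffAt_pinvFormula hU).contMDiffAt
    ((atlasSPlus p n).contMDiff A)).congr_of_eventuallyEq ?_
  have ho : IsOpen {B : SPlus p n | IsUnit (A.rep.1.1ᵀ * (B.1 * B.1) * A.rep.1.1)} :=
    isOpen_setOf_isUnit (by fun_prop)
  filter_upwards [ho.mem_nhds hU] with B hB
  exact congrArg entries (pinvFormula_eq B hB).symm

end Pseudoinverse

/-! ### The Riemannian metric -/

section Metric

variable {n p : ℕ}

/-- The bilinear form `tr(B² a (1 - A B) b) + k tr(B a B b)` in the matrices `a` and `b`. At `A` in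
`S⁺(p,n)` and `B = A†`, it is the Riemannian metric of `S⁺(p,n)` on tangent vectors; it is defined
on all matrices and polynomial in `(A, B)`, so that its smoothness is immediate. -/
noncomputable def ambientForm (k : ℝ) (A B : Mat n n) : Arr n n →L[ℝ] Arr n n →L[ℝ] ℝ :=
  (LinearMap.mk₂ ℝ (fun a b : Arr n n ↦
      (B * B * Matrix.of a * (1 - A * B) * Matrix.of b).trace +
        k * (B * Matrix.of a * B * Matrix.of b).trace)
    (fun a a' b ↦ by
      simp only [← Matrix.of_add_of, Matrix.mul_add, Matrix.add_mul, Matrix.trace_add]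
      ring)
    (fun c a b ↦ by
      simp only [← Matrix.smul_of, Matrix.mul_smul, Matrix.smul_mul, Matrix.trace_smul, smul_eq_mul]
      ring)
    (fun a b b' ↦ by
      simp only [← Matrix.of_add_of, Matrix.mul_add, Matrix.trace_add]
      ring)
    (fun c a b ↦ by
      simp only [← Matrix.smul_of, Matrix.mul_smul, Matrix.trace_smul, smul_eq_mul]
      ring)).toContinuousBilinearMap

theorem ambientForm_apply (k : ℝ) (A B : Mat n n) (a b : Arr n n) :
    ambientForm k A B a b = (B * B * Matrix.of a * (1 - A * B) * Matrix.of b).trace +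
        k * (B * Matrix.of a * B * Matrix.of b).trace := rfl

theorem contDiff_ambientForm (k : ℝ) : ContDiff ℝ ∞ fun z : Arr n n × Arr n n ↦
    ambientForm k (Matrix.of z.1) (Matrix.of z.2) := by
  rw [contDiff_clm_apply_iff]
  intro a
  rw [contDiff_clm_apply_iff]
  intro b
  rw [contDiff_iff_contDiffAt]
  intro z
  simp only [ambientForm_apply]
  have hA : ContDiffAt ℝ ∞ (fun z : Arr n n × Arr n n ↦ entries (Matrix.of z.1)) z := contDiffAt_fst
  have hB : ContDiffAt ℝ ∞ (fun z : Arr n n × Arr n n ↦ entries (Matrix.of z.2)) z := contDiffAt_snd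
  have hc := fun C : Mat n n ↦ contDiffAt_entries_const (x := z) C
  refine (contDiffAt_trace ?_).add (contDiffAt_const.mul (contDiffAt_trace ?_))
  · exact contDiffAt_entries_mul (contDiffAt_entries_mul (contDiffAt_entries_mul
      (contDiffAt_entries_mul hB hB) (hc _))
      (contDiffAt_entries_sub (hc _) (contDiffAt_entries_mul hA hB))) (hc _)
  · exact contDiffAt_entries_mul (contDiffAt_entries_mul (contDiffAt_entries_mul hB (hc _)) hB)
      (hc _)

/-- The form `ambientForm` at `A` and `A†`. -/
noncomputable def formAt (k : ℝ) (A : SPlus p n) : Arr n n →L[ℝ] Arr n n →L[ℝ] ℝ :=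
  ambientForm k A.1 A.pinv.1

theorem contMDiff_formAt (k : ℝ) :
    ContMDiff (𝓡 (dimSPlus p n)) 𝓘(ℝ, Arr n n →L[ℝ] Arr n n →L[ℝ] ℝ) ∞
      (formAt k : SPlus p n → _) :=
  fun A ↦ ContMDiffAt.comp A (f := fun B : SPlus p n ↦ (entries B.1, entries B.pinv.1))
    (contDiff_ambientForm k).contMDiff.contMDiffAt
    (((atlasSPlus p n).contMDiff A).prodMk_space
      (((atlasSPlus p n).contMDiff.comp contMDiff_pinv) A))

/-- The matrix `(1 - U Uᵀ) a U S⁻¹`. When `a = dπ(Δ, D)` with `(Δ, D)` horizontal at `x = (U, S)`,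
it is `Δ`, while `Uᵀ a U = D`. -/
noncomputable def horizontalPart (x : Stiefel n p × PD p) (a : Mat n n) : Mat n p :=
  (a * x.1.1 - x.1.1 * (x.1.1ᵀ * a * x.1.1)) * x.2.1⁻¹

/-- The form at `A = U S Uᵀ`, expressed by the horizontal lift of `a` and `b` to `(U, S)`. All that
concerns the metric is derived from this formula. -/
theorem formAt_toSPlus (k : ℝ) (x : Stiefel n p × PD p) {a b : Mat n n} (ha : aᵀ = a) :
    formAt k (toSPlus n p x) (entries a) (entries b) =
      ((horizontalPart x a)ᵀ * horizontalPart x b).trace +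
        k * (x.2.1⁻¹ * (x.1.1ᵀ * a * x.1.1) * x.2.1⁻¹ * (x.1.1ᵀ * b * x.1.1)).trace := by
  obtain ⟨U, S⟩ := x
  rw [formAt, ambientForm_apply, pinv_toSPlus, toSPlus_mul_toSPlus_inv]
  change ((toSPlus n p (U, S.inv)).1 * (toSPlus n p (U, S.inv)).1 * a * (1 - U.1 * U.1ᵀ) * b).trace
    + k * ((toSPlus n p (U, S.inv)).1 * a * (toSPlus n p (U, S.inv)).1 * b).trace = _
  have hB : (toSPlus n p (U, S.inv)).1 = U.1 * S.1⁻¹ * U.1ᵀ := rfl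
  have hSt : (S.1⁻¹)ᵀ = S.1⁻¹ := S.inv.transpose_eq
  congr 1
  · have h1 : (toSPlus n p (U, S.inv)).1 * (toSPlus n p (U, S.inv)).1 =
        U.1 * (S.1⁻¹ * (S.1⁻¹ * U.1ᵀ)) := by
      calc _ = U.1 * S.1⁻¹ * (U.1ᵀ * U.1) * S.1⁻¹ * U.1ᵀ := by
            rw [hB]; simp only [Matrix.mul_assoc]
        _ = _ := by rw [U.2, Matrix.mul_one]; simp only [Matrix.mul_assoc]
    have h2 : (horizontalPart (U, S) a)ᵀ * horizontalPart (U, S) b =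
        S.1⁻¹ * (U.1ᵀ * a * (1 - U.1 * U.1ᵀ) * b * U.1) * S.1⁻¹ := by
      have e1 : a * U.1 - U.1 * (U.1ᵀ * a * U.1) = (1 - U.1 * U.1ᵀ) * a * U.1 := by
        simp only [Matrix.sub_mul, Matrix.one_mul, Matrix.mul_assoc]
      have e2 : b * U.1 - U.1 * (U.1ᵀ * b * U.1) = (1 - U.1 * U.1ᵀ) * b * U.1 := by
        simp only [Matrix.sub_mul, Matrix.one_mul, Matrix.mul_assoc]
      have e3 : (1 - U.1 * U.1ᵀ)ᵀ = 1 - U.1 * U.1ᵀ := by simp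
      have e4 : (1 - U.1 * U.1ᵀ) * (1 - U.1 * U.1ᵀ) = 1 - U.1 * U.1ᵀ := by
        have : U.1 * U.1ᵀ * (U.1 * U.1ᵀ) = U.1 * U.1ᵀ := by
          rw [Matrix.mul_assoc, ← Matrix.mul_assoc U.1ᵀ, U.2, Matrix.one_mul]
        rw [Matrix.mul_sub, Matrix.mul_one, Matrix.sub_mul, Matrix.one_mul, this, sub_self,
          sub_zero]
      rw [horizontalPart, horizontalPart, e1, e2, Matrix.transpose_mul, hSt, Matrix.transpose_mul,
        Matrix.transpose_mul, e3, ha]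
      calc _ = S.1⁻¹ * (U.1ᵀ * a * ((1 - U.1 * U.1ᵀ) * (1 - U.1 * U.1ᵀ)) * b * U.1) * S.1⁻¹ := by
            simp only [Matrix.mul_assoc]
        _ = _ := by rw [e4]
    rw [h1, h2, Matrix.trace_mul_comm _ S.1⁻¹]
    simp only [Matrix.mul_assoc]
    rw [Matrix.trace_mul_comm U.1]
    simp only [Matrix.mul_assoc]
  · rw [hB]
    congr 1
    simp only [Matrix.mul_assoc]
    rw [Matrix.trace_mul_comm U.1]
    simp only [Matrix.mul_assoc]

open scoped MatrixOrder in
/-- With `S⁻¹ = Cᵀ C`, the trace is the squared Frobenius norm of `C α Cᵀ`. -/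
theorem trace_inv_mul_nonneg (S : PD p) {α : Mat p p} (hα : αᵀ = α) :
    0 ≤ (S.1⁻¹ * α * S.1⁻¹ * α).trace ∧ ((S.1⁻¹ * α * S.1⁻¹ * α).trace = 0 → α = 0) := by
  obtain ⟨C, hC⟩ := CStarAlgebra.nonneg_iff_eq_star_mul_self.mp S.2.inv.posSemidef.nonneg
  rw [Matrix.star_eq_conjTranspose] at hC
  have hCu : IsUnit C := by
    have := S.2.inv.isUnit
    rw [hC, Matrix.isUnit_iff_isUnit_det, Matrix.det_mul] at this
    exact (Matrix.isUnit_iff_isUnit_det _).2 (isUnit_of_mul_isUnit_right this)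
  have ht : (S.1⁻¹ * α * S.1⁻¹ * α).trace = ((C * α * Cᴴ)ᴴ * (C * α * Cᴴ)).trace := by
    have : (C * α * Cᴴ)ᴴ = C * α * Cᴴ := by
      rw [Matrix.conjTranspose_mul, Matrix.conjTranspose_mul, Matrix.conjTranspose_conjTranspose,
        Matrix.conjTranspose_eq_transpose_of_trivial α, hα, Matrix.mul_assoc]
    rw [this, hC]
    simp only [Matrix.mul_assoc]
    rw [Matrix.trace_mul_comm Cᴴ]
    simp only [Matrix.mul_assoc]
  rw [ht]
  refine ⟨(Matrix.posSemidef_conjTranspose_mul_self _).trace_nonneg, fun h ↦ ?_⟩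
  rw [Matrix.trace_conjTranspose_mul_self_eq_zero_iff] at h
  have hCt : IsUnit Cᴴ := by
    rw [← Matrix.star_eq_conjTranspose]; exact hCu.star
  exact hCu.mul_right_eq_zero.1 (hCt.mul_left_eq_zero.1 h)

/-- A tangent vector `a` of `S⁺(p,n)` at `U S Uᵀ` is symmetric, and vanishes on the orthogonal
complement of the columns of `U`, as a quadratic form. -/
theorem tangentMat_spec (x : Stiefel n p × PD p)
    (v : TangentSpace (𝓡 (dimSPlus p n)) (toSPlus n p x)) :
    (tangentMat _ v)ᵀ = tangentMat _ v ∧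
      (1 - x.1.1 * x.1.1ᵀ) * tangentMat _ v * (1 - x.1.1 * x.1.1ᵀ) = 0 := by
  obtain ⟨w, rfl⟩ := surjective_mfderiv_toSPlus x v
  have hX := (mem_range_tangentPair x _).1 ⟨w, rfl⟩
  rw [tangentMat_mfderiv_toSPlus]
  generalize tangentPair x w = X at hX ⊢
  constructor
  · simp only [dproj, Matrix.transpose_add, Matrix.transpose_mul, Matrix.transpose_transpose,
      x.2.transpose_eq, hX.2, Matrix.mul_assoc]
    abel
  · have h1 : (1 - x.1.1 * x.1.1ᵀ) * x.1.1 = 0 := by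
      rw [Matrix.sub_mul, Matrix.mul_assoc, x.1.2, Matrix.mul_one, Matrix.one_mul, sub_self]
    have h2 : x.1.1ᵀ * (1 - x.1.1 * x.1.1ᵀ) = 0 := by
      rw [Matrix.mul_sub, ← Matrix.mul_assoc, x.1.2, Matrix.mul_one, Matrix.one_mul, sub_self]
    generalize 1 - x.1.1 * x.1.1ᵀ = P at h1 h2
    calc P * dproj x X * P = P * X.1 * x.2.1 * (x.1.1ᵀ * P) + P * x.1.1 * X.2 * (x.1.1ᵀ * P) +
          P * x.1.1 * (x.2.1 * X.1ᵀ * P) := by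
          simp only [dproj, Matrix.mul_add, Matrix.add_mul, Matrix.mul_assoc]
      _ = 0 := by rw [h1, h2]; simp only [Matrix.mul_zero, Matrix.zero_mul, add_zero]

/-- If the form vanishes on `a`, then `Uᵀ a U = 0` and `(1 - U Uᵀ) a U = 0`, so that `a U = 0` and
`a = (1 - U Uᵀ) a (1 - U Uᵀ)`, which is `0` for a tangent vector. -/
theorem formAt_pos {k : ℝ} (hk : 0 < k) (A : SPlus p n) (v : TangentSpace (𝓡 (dimSPlus p n)) A)
    (hv : v ≠ 0) : 0 < formAt k A (entries (tangentMat A v)) (entries (tangentMat A v)) := by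
  obtain ⟨x, rfl⟩ := toSPlus_surjective A
  obtain ⟨h1, h2⟩ := tangentMat_spec x v
  have h0 : tangentMat _ v ≠ 0 := fun h ↦ hv (tangentMat_eq_zero.1 h)
  generalize tangentMat _ v = a at h0 h1 h2
  rw [formAt_toSPlus k x h1]
  have hα : (x.1.1ᵀ * a * x.1.1)ᵀ = x.1.1ᵀ * a * x.1.1 := by
    simp only [Matrix.transpose_mul, Matrix.transpose_transpose, h1, Matrix.mul_assoc]
  obtain ⟨h3, h4⟩ := trace_inv_mul_nonneg x.2 hα
  have h5 : 0 ≤ ((horizontalPart x a)ᵀ * horizontalPart x a).trace := by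
    have := (Matrix.posSemidef_conjTranspose_mul_self (horizontalPart x a)).trace_nonneg
    rwa [Matrix.conjTranspose_eq_transpose_of_trivial] at this
  refine lt_of_le_of_ne (add_nonneg h5 (mul_nonneg hk.le h3)) fun h ↦ h0 ?_
  have h6 : ((horizontalPart x a)ᵀ * horizontalPart x a).trace = 0 := by
    have := mul_nonneg hk.le h3
    linarith
  have h7 : (x.2.1⁻¹ * (x.1.1ᵀ * a * x.1.1) * x.2.1⁻¹ * (x.1.1ᵀ * a * x.1.1)).trace = 0 := by
    rw [h6, zero_add] at h
    exact (mul_eq_zero.1 h.symm).resolve_left hk.ne'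
  have h8 := h4 h7
  have h9 : horizontalPart x a = 0 := by
    rw [← Matrix.trace_conjTranspose_mul_self_eq_zero_iff,
      Matrix.conjTranspose_eq_transpose_of_trivial, h6]
  have h10 : a * x.1.1 = 0 := by
    have := congrArg (fun Z : Mat n p ↦ Z * x.2.1) h9
    simpa only [horizontalPart, h8, Matrix.mul_zero, sub_zero, Matrix.mul_assoc, x.2.inv_mul,
      Matrix.mul_one, Matrix.zero_mul] using this
  have h11 : x.1.1ᵀ * a = 0 := by
    have := congrArg Matrix.transpose h10
    rwa [Matrix.transpose_mul, h1, Matrix.transpose_zero] at this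
  rwa [Matrix.sub_mul, Matrix.one_mul, Matrix.mul_assoc, h11, Matrix.mul_zero, sub_zero,
    Matrix.mul_sub, Matrix.mul_one, ← Matrix.mul_assoc, h10, Matrix.zero_mul, sub_zero] at h2

theorem formAt_symm (k : ℝ) (A : SPlus p n) {a b : Mat n n} (ha : aᵀ = a) (hb : bᵀ = b) :
    formAt k A (entries a) (entries b) = formAt k A (entries b) (entries a) := by
  obtain ⟨x, rfl⟩ := toSPlus_surjective A
  rw [formAt_toSPlus k x ha, formAt_toSPlus k x hb]
  congr 1
  · rw [← Matrix.trace_transpose, Matrix.transpose_mul, Matrix.transpose_transpose]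
  · rw [Matrix.mul_assoc _ x.2.1⁻¹, Matrix.trace_mul_comm, ← Matrix.mul_assoc]

theorem transpose_tangentMat (A : SPlus p n) (v : TangentSpace (𝓡 (dimSPlus p n)) A) :
    (tangentMat A v)ᵀ = tangentMat A v := by
  obtain ⟨x, rfl⟩ := toSPlus_surjective A
  exact (tangentMat_spec x v).1

/-- The Riemannian metric of `S⁺(p,n)`. -/
noncomputable def quotientMetric (p n : ℕ) {k : ℝ} (hk : 0 < k) : Metric p n :=
  pullbackMetric (atlasSPlus p n).contMDiff (contMDiff_formAt k)
    (fun A v w ↦ formAt_symm k A (transpose_tangentMat A v) (transpose_tangentMat A w))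
    (formAt_pos hk)

theorem quotientMetric_inner {k : ℝ} (hk : 0 < k) (A : SPlus p n)
    (v w : TangentSpace (𝓡 (dimSPlus p n)) A) : (quotientMetric p n hk).inner A v w =
      formAt k A (entries (tangentMat A v)) (entries (tangentMat A w)) := rfl

theorem quotientMetric_horizontal {k : ℝ} (hk : 0 < k) (x : Stiefel n p × PD p)
    {V : Mat n (n - p)} {R : Mat p p} (hUV : x.1.1ᵀ * V = 0) (hRS : R ^ 2 = x.2.1)
    (v w : TangentSpace (𝓘S n p) x) (hv : tangentPair x v ∈ horizontalSpace V R)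
    (hw : tangentPair x w ∈ horizontalSpace V R) :
    (quotientMetric p n hk).inner (toSPlus n p x)
        (mfderiv (𝓘S n p) (𝓡 (dimSPlus p n)) (toSPlus n p) x v)
        (mfderiv (𝓘S n p) (𝓡 (dimSPlus p n)) (toSPlus n p) x w) =
      metricForm k R (tangentPair x v) (tangentPair x w) := by
  rw [quotientMetric_inner, formAt_toSPlus k x (transpose_tangentMat _ _),
    tangentMat_mfderiv_toSPlus, tangentMat_mfderiv_toSPlus]
  -- a horizontal vector `(Δ, D)` is recovered from `a = dπ(Δ, D)`: `Uᵀ a U = D`, and `Δ` is its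
  -- horizontal part
  have key : ∀ X ∈ horizontalSpace V R, x.1.1ᵀ * dproj x X * x.1.1 = X.2 ∧
      horizontalPart x (dproj x X) = X.1 := by
    rintro _ ⟨B, D₀, -, rfl⟩
    have h1 : dproj x (V * B, R * D₀ * R) * x.1.1 = V * B * x.2.1 + x.1.1 * (R * D₀ * R) := by
      have hVU : Bᵀ * (Vᵀ * x.1.1) = 0 := by
        have := congrArg Matrix.transpose hUV
        rw [Matrix.transpose_mul, Matrix.transpose_transpose, Matrix.transpose_zero] at this
        rw [this, Matrix.mul_zero]
      simp only [dproj, Matrix.add_mul, Matrix.mul_assoc, x.1.2, Matrix.transpose_mul, hVU,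
        Matrix.mul_zero, Matrix.mul_one, add_zero]
    have h2 : x.1.1ᵀ * dproj x (V * B, R * D₀ * R) * x.1.1 = R * D₀ * R := by
      rw [Matrix.mul_assoc, h1, Matrix.mul_add, ← Matrix.mul_assoc _ x.1.1, x.1.2, Matrix.one_mul,
        ← Matrix.mul_assoc, ← Matrix.mul_assoc, hUV, Matrix.zero_mul, Matrix.zero_mul, zero_add]
    refine ⟨h2, ?_⟩
    rw [horizontalPart, h2, h1, add_sub_cancel_right, Matrix.mul_assoc, x.2.mul_inv, Matrix.mul_one]
  rw [(key _ hv).1, (key _ hw).1, (key _ hv).2, (key _ hw).2, metricForm, ← hRS]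
  congr 2
  have hinv : (R ^ 2)⁻¹ = R⁻¹ * R⁻¹ := by rw [pow_two, Matrix.mul_inv_rev]
  rw [hinv]
  simp only [← Matrix.mul_assoc]
  rw [Matrix.trace_mul_comm _ R⁻¹]
  simp only [← Matrix.mul_assoc]

end Metric

/-! ### Invariance of the metric -/

section Invariance

variable {n p : ℕ}

/-- Two mutually inverse smooth maps of `S⁺(p,n)` give a diffeomorphism. -/
def diffeomorphOfInverse (f g : SPlus p n → SPlus p n)
    (hf : ContMDiff (𝓡 (dimSPlus p n)) (𝓡 (dimSPlus p n)) ∞ f)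
    (hg : ContMDiff (𝓡 (dimSPlus p n)) (𝓡 (dimSPlus p n)) ∞ g)
    (hgf : Function.LeftInverse g f) (hfg : Function.RightInverse g f) :
    SPlus p n ≃ₘ^∞⟮𝓡 (dimSPlus p n), 𝓡 (dimSPlus p n)⟯ SPlus p n where
  toFun := f
  invFun := g
  left_inv := hgf
  right_inv := hfg
  contMDiff_toFun := hf
  contMDiff_invFun := hg

theorem preserves_of_hasMatDeriv {k : ℝ} (hk : 0 < k)
    (f : SPlus p n ≃ₘ^∞⟮𝓡 (dimSPlus p n), 𝓡 (dimSPlus p n)⟯ SPlus p n)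
    (F : (A : SPlus p n) → TangentSpace (𝓡 (dimSPlus p n)) A → Mat n n)
    (hF : ∀ A, HasMatDeriv (𝓡 (dimSPlus p n)) (fun B ↦ (f B).1) A (F A))
    (h : ∀ A v w, formAt k (f A) (entries (F A v)) (entries (F A w)) =
      formAt k A (entries (tangentMat A v)) (entries (tangentMat A w))) :
    Preserves (quotientMetric p n hk) f := by
  intro A v w
  have e := (hasMatDeriv_comp (f.contMDiff.mdifferentiableAt (x := A) (by simp))).unique (hF A)
  rw [quotientMetric_inner, quotientMetric_inner, ← h A v w, ← congrFun e v, ← congrFun e w]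

/-- The action `U ↦ Q U` of `O(n)` on the Stiefel manifold. -/
def rotate (Q : O n) (U : Stiefel n p) : Stiefel n p :=
  ⟨(Q : Mat n n) * U.1, by
    rw [Matrix.transpose_mul, Matrix.mul_assoc, ← Matrix.mul_assoc (Q : Mat n n)ᵀ,
      orthogonal_transpose_mul, Matrix.one_mul, U.2]⟩

theorem toSPlus_rotate (Q : O n) (U : Stiefel n p) (S : PD p) :
    (toSPlus n p (rotate Q U, S)).1 = (Q : Mat n n) * (toSPlus n p (U, S)).1 * (Q : Mat n n)ᵀ := by
  simp only [toSPlus, rotate, Matrix.transpose_mul, Matrix.mul_assoc]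

/-- The action `A ↦ Q A Qᵀ` of `O(n)` on `S⁺(p,n)`. -/
def conjugate (Q : O n) (A : SPlus p n) : SPlus p n :=
  ⟨(Q : Mat n n) * A.1 * (Q : Mat n n)ᵀ, by
    obtain ⟨⟨U, S⟩, rfl⟩ := toSPlus_surjective A
    rw [← toSPlus_rotate]
    exact (toSPlus n p (rotate Q U, S)).2⟩

theorem conjugate_toSPlus (Q : O n) (U : Stiefel n p) (S : PD p) :
    conjugate Q (toSPlus n p (U, S)) = toSPlus n p (rotate Q U, S) :=
  Subtype.ext (toSPlus_rotate Q U S).symm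

theorem contMDiff_linear {f : SPlus p n → SPlus p n} (L R : Mat n n)
    (hf : ∀ A, (f A).1 = L * A.1 * R) :
    ContMDiff (𝓡 (dimSPlus p n)) (𝓡 (dimSPlus p n)) ∞ f := fun A ↦ by
  refine (atlasSPlus p n).contMDiffAt_of_comp ?_
  have e : (fun B ↦ entries (f B).1) = fun B : SPlus p n ↦ entries (L * B.1 * R) :=
    funext fun B ↦ congrArg entries (hf B)
  rw [e]
  have h : ContDiffAt ℝ ∞ (fun a : Arr n n ↦ entries (L * Matrix.of a * R)) (entries A.1) :=
    contDiffAt_entries_mul (contDiffAt_entries_mul (contDiffAt_entries_const _)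
      (contDiffAt_arr _)) (contDiffAt_entries_const _)
  exact ContMDiffAt.comp A (f := fun B : SPlus p n ↦ entries B.1) h.contMDiffAt
    ((atlasSPlus p n).contMDiff A)

theorem hasMatDeriv_linear {f : SPlus p n → SPlus p n} (L R : Mat n n)
    (hf : ∀ A, (f A).1 = L * A.1 * R) (A : SPlus p n) :
    HasMatDeriv (𝓡 (dimSPlus p n)) (fun B ↦ (f B).1) A fun v ↦ L * tangentMat A v * R := by
  have e : (fun B ↦ (f B).1) = fun B : SPlus p n ↦ L * B.1 * R := funext hf
  rw [e]
  have h := ((hasMatDeriv_const L).mul (hasMatDeriv_coe A)).mul (hasMatDeriv_const R)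
  simpa only [Matrix.zero_mul, zero_add, Matrix.mul_zero, add_zero] using h

/-- The representative `(Q U, S)` of `Q A Qᵀ` turns the horizontal lift `(Δ, D)` into `(Q Δ, D)`. -/
theorem exists_conjugate {k : ℝ} (hk : 0 < k) (Q : O n) :
    ∃ f : SPlus p n ≃ₘ^∞⟮𝓡 (dimSPlus p n), 𝓡 (dimSPlus p n)⟯ SPlus p n,
      (∀ A : SPlus p n, (f A : Mat n n) = (Q : Mat n n) * (A : Mat n n) * (Q : Mat n n)ᵀ) ∧
        Preserves (quotientMetric p n hk) f := by
  have hQ := orthogonal_transpose_mul Q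
  have hQ' : (Q : Mat n n) * (Q : Mat n n)ᵀ = 1 := mul_eq_one_comm.1 hQ
  let Q' : O n := ⟨(Q : Mat n n)ᵀ, (Matrix.mem_orthogonalGroup_iff' (Fin n) ℝ).2 (by
    change ((Q : Mat n n)ᵀ)ᵀ * (Q : Mat n n)ᵀ = 1
    rw [Matrix.transpose_transpose, hQ'])⟩
  refine ⟨diffeomorphOfInverse (conjugate Q) (conjugate Q')
    (contMDiff_linear Q (Q : Mat n n)ᵀ fun _ ↦ rfl)
    (contMDiff_linear Q' (Q' : Mat n n)ᵀ fun _ ↦ rfl)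
    (fun A ↦ Subtype.ext ?_) (fun A ↦ Subtype.ext ?_), fun A ↦ rfl, ?_⟩
  · change (Q : Mat n n)ᵀ * ((Q : Mat n n) * A.1 * (Q : Mat n n)ᵀ) * ((Q : Mat n n)ᵀ)ᵀ = A.1
    calc _ = ((Q : Mat n n)ᵀ * (Q : Mat n n)) * A.1 * ((Q : Mat n n)ᵀ * (Q : Mat n n)) := by
          simp only [Matrix.transpose_transpose, Matrix.mul_assoc]
      _ = A.1 := by rw [hQ, Matrix.one_mul, Matrix.mul_one]
  · change (Q : Mat n n) * ((Q : Mat n n)ᵀ * A.1 * ((Q : Mat n n)ᵀ)ᵀ) * (Q : Mat n n)ᵀ = A.1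
    calc _ = ((Q : Mat n n) * (Q : Mat n n)ᵀ) * A.1 * ((Q : Mat n n) * (Q : Mat n n)ᵀ) := by
          simp only [Matrix.transpose_transpose, Matrix.mul_assoc]
      _ = A.1 := by rw [hQ', Matrix.one_mul, Matrix.mul_one]
  · refine preserves_of_hasMatDeriv hk _ _ (hasMatDeriv_linear Q (Q : Mat n n)ᵀ fun _ ↦ rfl)
      fun A v w ↦ ?_
    change formAt k (conjugate Q A) _ _ = _
    have hv := transpose_tangentMat A v
    generalize tangentMat A v = a at hv
    generalize tangentMat A w = b
    obtain ⟨⟨U, S⟩, rfl⟩ := toSPlus_surjective A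
    have h1 : ∀ c : Mat n n, (rotate Q U).1ᵀ * ((Q : Mat n n) * c * (Q : Mat n n)ᵀ) *
        (rotate Q U).1 = U.1ᵀ * c * U.1 := fun c ↦ by
      calc _ = U.1ᵀ * ((Q : Mat n n)ᵀ * (Q : Mat n n)) * c * ((Q : Mat n n)ᵀ * (Q : Mat n n)) *
            U.1 := by simp only [rotate, Matrix.transpose_mul, Matrix.mul_assoc]
        _ = _ := by rw [hQ, Matrix.mul_one, Matrix.mul_one]
    have h2 : ∀ c : Mat n n, horizontalPart (rotate Q U, S) ((Q : Mat n n) * c * (Q : Mat n n)ᵀ) =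
        (Q : Mat n n) * horizontalPart (U, S) c := fun c ↦ by
      have h3 : (Q : Mat n n) * c * (Q : Mat n n)ᵀ * (rotate Q U).1 =
          (Q : Mat n n) * (c * U.1) := by
        calc _ = (Q : Mat n n) * c * ((Q : Mat n n)ᵀ * (Q : Mat n n)) * U.1 := by
              simp only [rotate, Matrix.mul_assoc]
          _ = _ := by rw [hQ, Matrix.mul_one, Matrix.mul_assoc]
      simp only [horizontalPart, h1, h3]
      simp only [rotate, Matrix.mul_sub, Matrix.sub_mul, Matrix.mul_assoc]
    rw [conjugate_toSPlus, formAt_toSPlus k _ hv, formAt_toSPlus]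
    · simp only [h1, h2]
      rw [Matrix.transpose_mul, Matrix.mul_assoc, ← Matrix.mul_assoc (Q : Mat n n)ᵀ, hQ,
        Matrix.one_mul]
    · simp only [Matrix.transpose_mul, Matrix.transpose_transpose, hv, Matrix.mul_assoc]

/-- The multiplication of a positive definite matrix by a positive scalar. -/
def PD.scale (c : ℝ) (hc : 0 < c) (S : PD p) : PD p := ⟨c • S.1, S.2.smul hc⟩

theorem toSPlus_scale {c : ℝ} (hc : 0 < c) (U : Stiefel n p) (S : PD p) :
    (toSPlus n p (U, S.scale c hc)).1 = c • (toSPlus n p (U, S)).1 := by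
  simp only [toSPlus, PD.scale, Matrix.mul_smul, Matrix.smul_mul]

/-- The multiplication of an element of `S⁺(p,n)` by a positive scalar. -/
def SPlus.scale (c : ℝ) (hc : 0 < c) (A : SPlus p n) : SPlus p n :=
  ⟨c • A.1, by
    obtain ⟨⟨U, S⟩, rfl⟩ := toSPlus_surjective A
    rw [← toSPlus_scale hc]
    exact (toSPlus n p (U, S.scale c hc)).2⟩

/-- The representative `(U, c S)` of `c A` turns the horizontal lift `(Δ, D)` into `(Δ, c D)`, and
the factors `c` cancel against those of `(c S)⁻¹`. -/
theorem exists_scale {k : ℝ} (hk : 0 < k) {c : ℝ} (hc : 0 < c) :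
    ∃ f : SPlus p n ≃ₘ^∞⟮𝓡 (dimSPlus p n), 𝓡 (dimSPlus p n)⟯ SPlus p n,
      (∀ A : SPlus p n, (f A : Mat n n) = c • (A : Mat n n)) ∧
        Preserves (quotientMetric p n hk) f := by
  have hlin : ∀ c : ℝ, ∀ A : Mat n n, c • A = (c • (1 : Mat n n)) * A * 1 := fun c A ↦ by simp
  refine ⟨diffeomorphOfInverse (SPlus.scale c hc) (SPlus.scale c⁻¹ (inv_pos.2 hc))
    (contMDiff_linear _ _ fun A ↦ hlin c A.1) (contMDiff_linear _ _ fun A ↦ hlin c⁻¹ A.1)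
    (fun A ↦ Subtype.ext (inv_smul_smul₀ hc.ne' A.1))
    (fun A ↦ Subtype.ext (smul_inv_smul₀ hc.ne' A.1)), fun A ↦ rfl, ?_⟩
  refine preserves_of_hasMatDeriv hk _ _ (hasMatDeriv_linear _ _ fun A ↦ hlin c A.1) fun A v w ↦ ?_
  rw [← hlin, ← hlin]
  change formAt k (SPlus.scale c hc A) _ _ = _
  have hv := transpose_tangentMat A v
  generalize tangentMat A v = a at hv
  generalize tangentMat A w = b
  obtain ⟨⟨U, S⟩, rfl⟩ := toSPlus_surjective A
  have e : SPlus.scale c hc (toSPlus n p (U, S)) = toSPlus n p (U, S.scale c hc) :=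
    Subtype.ext (toSPlus_scale hc U S).symm
  have hinv : (S.scale c hc).1⁻¹ = c⁻¹ • S.1⁻¹ := by
    apply Matrix.inv_eq_left_inv
    rw [PD.scale, Matrix.smul_mul, Matrix.mul_smul, S.inv_mul, inv_smul_smul₀ hc.ne']
  have h2 : ∀ d : Mat n n, horizontalPart (U, S.scale c hc) (c • d) = horizontalPart (U, S) d :=
    fun d ↦ by
      simp only [horizontalPart, hinv, Matrix.mul_smul, Matrix.smul_mul, ← smul_sub]
      rw [inv_smul_smul₀ hc.ne']
  rw [e, formAt_toSPlus k _ hv, formAt_toSPlus k _ (by rw [Matrix.transpose_smul, hv]), h2,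
    h2, hinv]
  congr 3
  simp only [Matrix.mul_smul, Matrix.smul_mul, smul_smul]
  rw [show c * (c⁻¹ * (c * c⁻¹)) = 1 by field_simp, one_smul]

theorem toSPlus_mul_stiefel (U : Stiefel n p) (S : PD p) :
    (toSPlus n p (U, S)).1 * U.1 = U.1 * S.1 := by
  simp only [toSPlus, Matrix.mul_assoc, U.2, Matrix.mul_one]

theorem stiefel_transpose_mul_toSPlus (U : Stiefel n p) (S : PD p) :
    U.1ᵀ * (toSPlus n p (U, S)).1 = S.1 * U.1ᵀ := by
  simp only [toSPlus, ← Matrix.mul_assoc, U.2, Matrix.one_mul]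

/-- Let `a` be tangent to `S⁺(p,n)` at `A = U S Uᵀ`, and `b` its image under the differential of `A
↦ A†` at `A`. The hypotheses are the derivatives of `A A† A = A` and of `A A† = A† A`. The first
one, compressed by `U`, gives `S (Uᵀ b U) S = -Uᵀ a U`. The second one, multiplied by `U`, then
shows that `a` and `b` have the same horizontal component `Δ`, at `(U, S)` and at `(U, S⁻¹)`. -/
theorem pinv_deriv_parts (U : Stiefel n p) (S : PD p) {a b : Mat n n}
    (h1 : (a * (toSPlus n p (U, S.inv)).1 + (toSPlus n p (U, S)).1 * b) * (toSPlus n p (U, S)).1 +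
      (toSPlus n p (U, S)).1 * (toSPlus n p (U, S.inv)).1 * a = a)
    (h2 : a * (toSPlus n p (U, S.inv)).1 + (toSPlus n p (U, S)).1 * b =
      b * (toSPlus n p (U, S)).1 + (toSPlus n p (U, S.inv)).1 * a) :
    S.1 * (U.1ᵀ * b * U.1) = -(U.1ᵀ * a * U.1 * S.1⁻¹) ∧
      horizontalPart (U, S.inv) b = horizontalPart (U, S) a := by
  have hA := toSPlus_mul_stiefel U S
  have hB : (toSPlus n p (U, S.inv)).1 * U.1 = U.1 * S.1⁻¹ := toSPlus_mul_stiefel U S.inv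
  have hBA := toSPlus_inv_mul_toSPlus U S
  have hAB := toSPlus_mul_toSPlus_inv U S
  have h3 : S.1 * (U.1ᵀ * b * U.1) * S.1 = -(U.1ᵀ * a * U.1) := by
    have e := congrArg (fun Z : Mat n n ↦ U.1ᵀ * Z * U.1) h1
    simp only [hAB] at e
    have e1 : U.1ᵀ * ((a * (toSPlus n p (U, S.inv)).1 + (toSPlus n p (U, S)).1 * b) *
        (toSPlus n p (U, S)).1 + U.1 * U.1ᵀ * a) * U.1 =
        U.1ᵀ * a * U.1 + S.1 * (U.1ᵀ * b * U.1) * S.1 + U.1ᵀ * a * U.1 := by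
      calc _ = U.1ᵀ * a * ((toSPlus n p (U, S.inv)).1 * (toSPlus n p (U, S)).1) * U.1 +
            (U.1ᵀ * (toSPlus n p (U, S)).1) * b * ((toSPlus n p (U, S)).1 * U.1) +
            (U.1ᵀ * U.1) * U.1ᵀ * a * U.1 := by
            simp only [Matrix.mul_add, Matrix.add_mul, Matrix.mul_assoc]
        _ = U.1ᵀ * a * U.1 * (U.1ᵀ * U.1) + S.1 * (U.1ᵀ * b * U.1) * S.1 +
            (U.1ᵀ * U.1) * U.1ᵀ * a * U.1 := by
            rw [hBA, stiefel_transpose_mul_toSPlus, hA]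
            simp only [Matrix.mul_assoc]
        _ = _ := by rw [U.2, Matrix.mul_one, Matrix.one_mul]
    rw [e1] at e
    rw [eq_neg_iff_add_eq_zero, add_comm]
    exact add_eq_right.1 e
  have h4 : S.1 * (U.1ᵀ * b * U.1) = -(U.1ᵀ * a * U.1 * S.1⁻¹) := by
    have := congrArg (fun Z : Mat p p ↦ Z * S.1⁻¹) h3
    simpa only [Matrix.mul_assoc, S.mul_inv, Matrix.mul_one, Matrix.neg_mul] using this
  have h5 : (U.1ᵀ * b * U.1) * S.1 = -(S.1⁻¹ * (U.1ᵀ * a * U.1)) := by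
    have := congrArg (fun Z : Mat p p ↦ S.1⁻¹ * Z) h3
    simpa only [← Matrix.mul_assoc, S.inv_mul, Matrix.one_mul, Matrix.mul_neg] using this
  refine ⟨h4, ?_⟩
  have hSS : (S.inv).1⁻¹ = S.1 := congrArg Subtype.val S.inv_inv
  have h6 : a * U.1 * S.1⁻¹ + U.1 * (S.1 * (U.1ᵀ * b * U.1)) =
      b * U.1 * S.1 + U.1 * (S.1⁻¹ * (U.1ᵀ * a * U.1)) := by
    have e := congrArg (fun Z : Mat n n ↦ Z * U.1) h2
    simp only [Matrix.add_mul, Matrix.mul_assoc, hA, hB] at e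
    simp only [toSPlus, Matrix.mul_assoc] at e
    simp only [Matrix.mul_assoc]
    exact e
  rw [h4, ← neg_eq_iff_eq_neg.2 h5] at h6
  simp only [horizontalPart, hSS, Matrix.sub_mul, Matrix.mul_assoc, Matrix.mul_neg] at h6 ⊢
  rw [← sub_eq_add_neg, ← sub_eq_add_neg] at h6
  exact h6.symm

/-- The representative `(U, S⁻¹)` of `A†` turns the horizontal lift `(Δ, D)` into
`(Δ, -S⁻¹ D S⁻¹)`. -/
theorem exists_pinv {k : ℝ} (hk : 0 < k) :
    ∃ f : SPlus p n ≃ₘ^∞⟮𝓡 (dimSPlus p n), 𝓡 (dimSPlus p n)⟯ SPlus p n,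
      (∀ A : SPlus p n, IsPseudoinverse (A : Mat n n) (f A : Mat n n)) ∧
        Preserves (quotientMetric p n hk) f := by
  refine ⟨diffeomorphOfInverse SPlus.pinv SPlus.pinv contMDiff_pinv contMDiff_pinv SPlus.pinv_pinv
    SPlus.pinv_pinv, SPlus.isPseudoinverse_pinv, ?_⟩
  have hd := fun A : SPlus p n ↦
    hasMatDeriv_comp (contMDiff_pinv.mdifferentiableAt (x := A) (by simp))
  refine preserves_of_hasMatDeriv hk _ _ hd fun A v w ↦ ?_
  change formAt k A.pinv _ _ = _
  have hsymm : ∀ v, (tangentMat A.pinv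
      (mfderiv (𝓡 (dimSPlus p n)) (𝓡 (dimSPlus p n)) SPlus.pinv A v))ᵀ
      = _ := fun v ↦ transpose_tangentMat _ _
  -- the derivatives of `A A† A = A` and of `A A† = A† A`
  have h1 : ∀ v, (tangentMat A v * A.pinv.1 + A.1 * tangentMat A.pinv (mfderiv (𝓡 (dimSPlus p n))
      (𝓡 (dimSPlus p n)) SPlus.pinv A v)) * A.1 + A.1 * A.pinv.1 * tangentMat A v =
        tangentMat A v := fun v ↦ by
    have h := ((hasMatDeriv_coe A).mul (hd A)).mul (hasMatDeriv_coe A)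
    have e : (fun B : SPlus p n ↦ B.1 * B.pinv.1 * B.1) = fun B ↦ B.1 :=
      funext fun B ↦ B.isPseudoinverse_pinv.mul_mul_left
    rw [e] at h
    exact congrFun (h.unique (hasMatDeriv_coe A)) v
  have h2 : ∀ v, tangentMat A v * A.pinv.1 + A.1 * tangentMat A.pinv (mfderiv (𝓡 (dimSPlus p n))
      (𝓡 (dimSPlus p n)) SPlus.pinv A v) = tangentMat A.pinv (mfderiv (𝓡 (dimSPlus p n))
      (𝓡 (dimSPlus p n)) SPlus.pinv A v) * A.1 + A.pinv.1 * tangentMat A v := fun v ↦ by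
    have h := (hasMatDeriv_coe A).mul (hd A)
    have e : (fun B : SPlus p n ↦ B.1 * B.pinv.1) = fun B ↦ B.pinv.1 * B.1 := by
      funext B
      obtain ⟨⟨U, S⟩, rfl⟩ := toSPlus_surjective B
      rw [pinv_toSPlus, toSPlus_mul_toSPlus_inv, toSPlus_inv_mul_toSPlus]
    rw [e] at h
    exact congrFun (h.unique ((hd A).mul (hasMatDeriv_coe A))) v
  have hv := transpose_tangentMat A v
  have h1w := h1 w
  have h2w := h2 w
  have h1v := h1 v
  have h2v := h2 v
  have hbv := hsymm v
  generalize tangentMat A.pinv (mfderiv (𝓡 (dimSPlus p n)) (𝓡 (dimSPlus p n)) SPlus.pinv A v) = b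
    at h1v h2v hbv
  generalize tangentMat A.pinv (mfderiv (𝓡 (dimSPlus p n)) (𝓡 (dimSPlus p n)) SPlus.pinv A w) = b'
    at h1w h2w
  generalize tangentMat A v = a at h1v h2v hv
  generalize tangentMat A w = a' at h1w h2w
  clear h1 h2 hsymm hd
  obtain ⟨⟨U, S⟩, rfl⟩ := toSPlus_surjective A
  rw [pinv_toSPlus] at *
  have hSS : (S.inv).1⁻¹ = S.1 := congrArg Subtype.val S.inv_inv
  obtain ⟨k1, k2⟩ := pinv_deriv_parts U S h1v h2v
  obtain ⟨k3, k4⟩ := pinv_deriv_parts U S h1w h2w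
  rw [formAt_toSPlus k _ hv, formAt_toSPlus k _ hbv, k2, k4, hSS]
  congr 2
  simp only
  rw [Matrix.mul_assoc _ S.1, k1, k3, neg_mul_neg, Matrix.trace_mul_comm, Matrix.trace_mul_comm,
    ← Matrix.mul_assoc, Matrix.trace_mul_comm]
  simp only [Matrix.mul_assoc]

end Invariance

end FixedRankPSD

theorem theorem1 (n p : ℕ) (hp : p ≤ n) (k : ℝ) (hk : 0 < k) :
    -- smooth manifold structures on `V_{n,p}`, `P_p`, `(V_{n,p} × P_p) / O(p)` and `S⁺(p,n)`
    ∃ (_ : ChartedSpace (EuclideanSpace ℝ (Fin (dimStiefel n p))) (Stiefel n p))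
      (_ : IsManifold (𝓡 (dimStiefel n p)) ∞ (Stiefel n p))
      (_ : ChartedSpace (EuclideanSpace ℝ (Fin (dimPD p))) (PD p))
      (_ : IsManifold (𝓡 (dimPD p)) ∞ (PD p))
      (_ : ChartedSpace (EuclideanSpace ℝ (Fin (dimSPlus p n))) (StructureQuotient n p))
      (_ : IsManifold (𝓡 (dimSPlus p n)) ∞ (StructureQuotient n p))
      (_ : ChartedSpace (EuclideanSpace ℝ (Fin (dimSPlus p n))) (SPlus p n))
      (_ : IsManifold (𝓡 (dimSPlus p n)) ∞ (SPlus p n)),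
      -- they are the structures of embedded submanifolds of spaces of matrices, and
      -- the quotient manifold structure
      IsEmbeddingSmooth (𝓡 (dimStiefel n p)) (fun U : Stiefel n p ↦ entries (U : Mat n p)) ∧
      IsEmbeddingSmooth (𝓡 (dimPD p)) (fun S : PD p ↦ entries (S : Mat p p)) ∧
      IsEmbeddingSmooth (𝓡 (dimSPlus p n)) (fun A : SPlus p n ↦ entries (A : Mat n n)) ∧
      IsSubmersionSmooth ((𝓡 (dimStiefel n p)).prod (𝓡 (dimPD p))) (𝓡 (dimSPlus p n))
        (toQuotient n p) ∧
      -- `(V_{n,p} × P_p) / O(p) ≅ S⁺(p,n)` through `(U, S) ↦ U S Uᵀ`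
      (∃ Φ : StructureQuotient n p ≃ₘ^∞⟮𝓡 (dimSPlus p n), 𝓡 (dimSPlus p n)⟯ SPlus p n,
        ∀ x, Φ (toQuotient n p x) = toSPlus n p x) ∧
      -- the tangent space of the structure space at `(U, R²)` is the direct sum of the
      -- horizontal space and of the vertical space, the kernel of the differential of the
      -- projection
      (∀ (x : Stiefel n p × PD p) (Uperp : Mat n (n - p)) (R : Mat p p),
        Uperpᵀ * Uperp = 1 → (x.1 : Mat n p)ᵀ * Uperp = 0 →
        R.PosDef → R ^ 2 = (x.2 : Mat p p) →
        LinearMap.range (tangentPair x) =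
          horizontalSpace Uperp R ⊔ verticalSpace (x.1 : Mat n p) (x.2 : Mat p p) ∧
        Disjoint (horizontalSpace Uperp R) (verticalSpace (x.1 : Mat n p) (x.2 : Mat p p)) ∧
        ∀ v, mfderiv ((𝓡 (dimStiefel n p)).prod (𝓡 (dimPD p))) (𝓡 (dimSPlus p n))
            (toSPlus n p) x v = 0 ↔
          tangentPair x v ∈ verticalSpace (x.1 : Mat n p) (x.2 : Mat p p)) ∧
      ∃ g : Metric p n,
        -- at every representative `(U, R²)` of `A`, the metric `g` at `A` is given on
        -- horizontal vectors by the formula; so the formula does not depend on the representative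
        (∀ (x : Stiefel n p × PD p) (Uperp : Mat n (n - p)) (R : Mat p p),
          Uperpᵀ * Uperp = 1 → (x.1 : Mat n p)ᵀ * Uperp = 0 →
          R.PosDef → R ^ 2 = (x.2 : Mat p p) →
          ∀ v w, tangentPair x v ∈ horizontalSpace Uperp R →
            tangentPair x w ∈ horizontalSpace Uperp R →
            g.inner (toSPlus n p x)
                (mfderiv ((𝓡 (dimStiefel n p)).prod (𝓡 (dimPD p))) (𝓡 (dimSPlus p n))
                  (toSPlus n p) x v)
                (mfderiv ((𝓡 (dimStiefel n p)).prod (𝓡 (dimPD p))) (𝓡 (dimSPlus p n))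
                  (toSPlus n p) x w) =
              metricForm k R (tangentPair x v) (tangentPair x w)) ∧
        -- orthogonal transformations
        (∀ Q : O n, ∃ f : SPlus p n ≃ₘ^∞⟮𝓡 (dimSPlus p n), 𝓡 (dimSPlus p n)⟯ SPlus p n,
          (∀ A : SPlus p n, (f A : Mat n n) = (Q : Mat n n) * (A : Mat n n) * (Q : Mat n n)ᵀ) ∧
            Preserves g f) ∧
        -- scalings
        (∀ μ : ℝ, μ ≠ 0 →
          ∃ f : SPlus p n ≃ₘ^∞⟮𝓡 (dimSPlus p n), 𝓡 (dimSPlus p n)⟯ SPlus p n,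
            (∀ A : SPlus p n, (f A : Mat n n) = μ ^ 2 • (A : Mat n n)) ∧ Preserves g f) ∧
        -- pseudoinversion
        (∃ f : SPlus p n ≃ₘ^∞⟮𝓡 (dimSPlus p n), 𝓡 (dimSPlus p n)⟯ SPlus p n,
          (∀ A : SPlus p n, IsPseudoinverse (A : Mat n n) (f A : Mat n n)) ∧ Preserves g f) := by
  refine ⟨inferInstance, inferInstance, inferInstance, inferInstance, inferInstance, inferInstance,
    inferInstance, inferInstance, (atlasStiefel n p).isEmbeddingSmooth,
    (atlasPD p).isEmbeddingSmooth, (atlasSPlus p n).isEmbeddingSmooth,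
    isSubmersionSmooth_toQuotient, ⟨quotientDiffeomorph n p, fun _ ↦ rfl⟩, ?_,
    quotientMetric p n hk, ?_, fun Q ↦ exists_conjugate hk Q,
    fun μ hμ ↦ exists_scale hk (sq_pos_of_ne_zero hμ), exists_pinv hk⟩
  · intro x V R hV hUV hR hRS
    exact ⟨range_tangentPair_eq hp x hV hUV hR, disjoint_horizontal_vertical x.1.2 hUV,
      mfderiv_toSPlus_eq_zero_iff x⟩
  · intro x V R _ hUV _ hRS v w hv hw
    exact quotientMetric_horizontal hk x hUV hRS v w hv hw
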